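/- Let $\mathbb F$ be an algebraically closed field of characteristic $0$, $\mathfrak g$ a finite-dimensional simple Lie algebra over $\mathbb F$ with a non-degenerate symmetric invariant bilinear form $(\cdot|\cdot)$, and $\{f,2x,e\}\subset\mathfrak g$ an $\mathfrak{sl}_2$-triple ($[e,f]=2x$, $[x,e]=e$, $[x,f]=-f$). Put $\mathfrak g_j=\{a:[x,a]=ja\}$ for $j\in\frac12\mathbb Z$, $\mathfrak g_{\le k}=\bigoplus_{j\le k}\mathfrak g_j$, $\mathfrak g_{\ge k}=\bigoplus_{j\ge k}\mathfrak g_j$; let $\mathfrak g^f$ be the centralizer of $f$, $\mathfrak g^f_0=\mathfrak g_0\cap\mathfrak g^f$, let $d$ be the largest $j$ with $\mathfrak g_j\ne0$, and fix $s\in\mathfrak g_d$, $z\in\mathbb F$. For a vector space $\mathfrak a$ let $\mathcal V(\mathfrak a)=S(\mathbb F[\partial]\mathfrak a)$ be the algebra of differential polynomials. We have $\mathfrak g=\mathfrak g_{\le\frac12}\oplus\mathfrak g_{\ge1}$ and $\mathfrak g_{\le\frac12}=\mathfrak g^f\oplus[e,\mathfrak g_{\le-\frac12}]$; let $\pi_{\le\frac12}:\mathfrak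 g\to\mathfrak g_{\le\frac12}$ and $\pi:\mathfrak g_{\le\frac12}\to\mathfrak g^f$ be the corresponding projections, and let $\pi:\mathcal V(\mathfrak g_{\le\frac12})\to\mathcal V(\mathfrak g^f)$ also denote the differential algebra homomorphism extending the second one. For $a\in\mathfrak g$ let $\{a_\lambda\,\cdot\,\}_z:\mathcal V(\mathfrak g)\to\mathcal V(\mathfrak g)[\lambda]$ be the derivation such that $\{a_\lambda b\}_z=[a,b]+(a|b)\lambda+z(s|[a,b])$ for $b\in\mathfrak g$ and $\{a_\lambda\partial P\}_z=(\lambda+\partial)\{a_\lambda P\}_z$. Let $\rho:\mathcal V(\mathfrak g)\to\mathcal V(\mathfrak g_{\le\frac12})$ be the differential algebra homomorphism with $\rho(a)=\pi_{\le\frac12}(a)+(f|a)$ for $a\in\mathfrak g$. The classical $\mathcal W$-algebra is the differential subalgebra $$\mathcal W=\{P\in\mathcal V(\mathfrak g_{\le\frac12})\mid \rho\{a_\lambda P\}_z=0\ \text{ for all } a\in\mathfrak g_{\ge\frac12}\}.$$ **(1) Minimal nilpotents.** Suppose that $f$ is a minimal nilpotent element, i.e. a lowest root vector of $\mathfrak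 g$ with respect to some Cartan subalgebra and some base of its root system. Then $\pi$ restricts to a differential algebra isomorphism $\mathcal W\to\mathcal V(\mathfrak g^f)$. Moreover $\mathfrak g^f=\mathfrak g^f_0\oplus\mathfrak g_{-\frac12}\oplus\mathbb Ff$. Let $\{v_k\},\{v^k\}$ be any bases of $\mathfrak g_{\frac12}$ with $(f|[v_h,v^k])=\delta_{hk}$, let $\{a_j\},\{a^j\}$ be any bases of $\mathfrak g_0$ dual with respect to $(\cdot|\cdot)$, and let $\{c_i\},\{c^i\}$ be any bases of $\mathfrak g^f_0$ dual with respect to $(\cdot|\cdot)$. Then the inverse isomorphism $\pi^{-1}:\mathcal V(\mathfrak g^f)\to\mathcal W$ is given on generators by $$\pi^{-1}(a)=\varphi(a):=a+\tfrac12\sum_k[a,v_k]v^k\qquad(a\in\mathfrak g^f_0),$$ $$\pi^{-1}(u)=\psi(u):=u+\tfrac13\sum_{h,k}[[u,v_h],v_k]v^hv^k+\sum_k[u,v_k]v^k+\partial[e,u]\qquad(u\in\mathfrak g_{-\frac12}),$$ $$\pi^{-1}(f)=\tilde L:=L-\tfrac12\sum_i\varphi(c_i)\varphi(c^i),$$ where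 $L=f+\partial x+\frac12\sum_ja_ja^j+\sum_kv^k[f,v_k]+\frac12\sum_kv^k\partial v_k$. **(2) Short nilpotents.** Suppose that $f$ is short, i.e. $\mathfrak g=\mathfrak g_{-1}\oplus\mathfrak g_0\oplus\mathfrak g_1$. Then $\pi$ restricts to a differential algebra isomorphism $\mathcal W\to\mathcal V(\mathfrak g^f)$. Moreover $\mathfrak g^f=\mathfrak g^f_0\oplus\mathfrak g_{-1}$. For any basis $\{u_k\}$ of $\mathfrak g_{-1}$ and dual basis $\{u^k\}$ of $\mathfrak g_1$ with respect to $(\cdot|\cdot)$, the inverse isomorphism is given on generators by $\pi^{-1}(a)=a$ for $a\in\mathfrak g_0^f$ and, for $u\in\mathfrak g_{-1}$, $$\pi^{-1}(u)=u-\tfrac12\sum_k[u,u^k][e,u_k]-\tfrac18\sum_k[f,u^k]\,[e,[[e,u],u_k]]+\tfrac12\,\partial[e,u].$$ -/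

import Mathlib

open Polynomial

noncomputable section

namespace ClassicalW

/-! ### Algebras of differential polynomials -/

section DiffPoly

variable (F : Type*) [Field F]

/-- The algebra of differential polynomials `V(M) = S(F[∂] M)` over a vector space `M`. The
`F[∂]`-module `F[∂] M = F[∂] ⊗ M` is realised as `ℕ →₀ M`, with `single n m` in the role of
`∂ⁿ m`. -/
abbrev DiffPoly (M : Type*) [AddCommGroup M] [Module F M] : Type _ :=
  SymmetricAlgebra F (ℕ →₀ M)

variable {F}

/-- A linear map `d : X → A` into a commutative algebra `A` over the symmetric algebra `S(X)`
extends uniquely to a derivation `S(X) → A`. (It is constructed as the infinitesimal part of the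
algebra homomorphism `S(X) → A[ε]`, `x ↦ x + ε d(x)`.) -/
def symDer {X : Type*} [AddCommGroup X] [Module F X] {A : Type*} [CommRing A] [Algebra F A]
    [Algebra (SymmetricAlgebra F X) A] [IsScalarTower F (SymmetricAlgebra F X) A]
    (d : X →ₗ[F] A) : Derivation F (SymmetricAlgebra F X) A :=
  let j : SymmetricAlgebra F X →ₐ[F] A := IsScalarTower.toAlgHom F _ A
  let h : SymmetricAlgebra F X →ₐ[F] DualNumber A :=
    SymmetricAlgebra.lift
      ((TrivSqZeroExt.inlAlgHom F A A).toLinearMap ∘ₗ j.toLinearMap ∘ₗ SymmetricAlgebra.ι F X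
        + (TrivSqZeroExt.inrHom A A).restrictScalars F ∘ₗ d)
  have hfst : ∀ p, (h p).fst = algebraMap _ A p := by
    intro p
    have : (TrivSqZeroExt.fstHom F A A).comp h = j := by
      apply SymmetricAlgebra.algHom_ext
      ext x
      simp [h]
    exact DFunLike.congr_fun this p
  Derivation.mk'
    ((TrivSqZeroExt.sndHom A A).restrictScalars F ∘ₗ h.toLinearMap)
    (by
      intro p q
      simp [hfst, Algebra.smul_def, mul_comm])

theorem symDer_ι {X : Type*} [AddCommGroup X] [Module F X] {A : Type*} [CommRing A] [Algebra F A]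
    [Algebra (SymmetricAlgebra F X) A] [IsScalarTower F (SymmetricAlgebra F X) A]
    (d : X →ₗ[F] A) (x : X) : symDer d (SymmetricAlgebra.ι F X x) = d x := by
  simp [symDer]

variable {M N : Type*} [AddCommGroup M] [Module F M] [AddCommGroup N] [Module F N]

/-- The generator `∂ⁿ m` of `V(M)`, linear in `m`. -/
def gen (n : ℕ) : M →ₗ[F] DiffPoly F M :=
  SymmetricAlgebra.ι F (ℕ →₀ M) ∘ₗ Finsupp.lsingle n

/-- The derivation `∂` of `V(M)`: `∂ (∂ⁿ m) = ∂ⁿ⁺¹ m`. -/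
def deriv : Derivation F (DiffPoly F M) (DiffPoly F M) :=
  symDer (SymmetricAlgebra.ι F (ℕ →₀ M) ∘ₗ Finsupp.lmapDomain M F (· + 1))

theorem deriv_gen (n : ℕ) (m : M) : deriv (gen n m : DiffPoly F M) = gen (n + 1) m := by
  simp [deriv, gen, symDer_ι]

/-- The differential algebra homomorphism `V(M) → V(N)` extending a linear map `M → V(N)`:
`∂ⁿ m ↦ ∂ⁿ (φ m)`. -/
def diffLift (φ : M →ₗ[F] DiffPoly F N) : DiffPoly F M →ₐ[F] DiffPoly F N :=
  SymmetricAlgebra.lift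
    (Finsupp.lsum F fun n => ((deriv : Derivation F (DiffPoly F N) _).toLinearMap ^ n) ∘ₗ φ)

theorem diffLift_gen (φ : M →ₗ[F] DiffPoly F N) (n : ℕ) (m : M) :
    diffLift φ (gen n m) =
      ((deriv : Derivation F (DiffPoly F N) _).toLinearMap ^ n) (φ m) := by
  simp [diffLift, gen]

theorem diffPoly_induction {P : DiffPoly F M → Prop}
    (halg : ∀ r : F, P (algebraMap F _ r)) (hgen : ∀ n m, P (gen n m))
    (hmul : ∀ a b, P a → P b → P (a * b)) (hadd : ∀ a b, P a → P b → P (a + b))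
    (p : DiffPoly F M) : P p := by
  induction p using SymmetricAlgebra.induction with
  | algebraMap r => exact halg r
  | mul a b ha hb => exact hmul a b ha hb
  | add a b ha hb => exact hadd a b ha hb
  | ι x =>
    induction x using Finsupp.induction_linear with
    | zero => simpa using halg 0
    | add u v hu hv => simpa using hadd _ _ hu hv
    | single n m => exact hgen n m

theorem diffLift_deriv (φ : M →ₗ[F] DiffPoly F N) (p : DiffPoly F M) :
    diffLift φ (deriv p) = deriv (diffLift φ p) := by
  induction p using diffPoly_induction with
  | halg r => simp
  | hgen n m => rw [deriv_gen, diffLift_gen, diffLift_gen, pow_succ']; rfl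
  | hmul a b ha hb => simp [Derivation.leibniz, ha, hb]
  | hadd a b ha hb => simp [ha, hb]

/-- The operator `λ + ∂` on `V(M)[λ]`, where `∂` acts on the coefficients; the variable `λ` is the
polynomial variable `X`. -/
def lamShift : (DiffPoly F M)[X] →ₗ[F] (DiffPoly F M)[X] :=
  LinearMap.mulLeft F X +
    Polynomial.lsum fun n =>
      (monomial n).restrictScalars F ∘ₗ (deriv : Derivation F (DiffPoly F M) _).toLinearMap

end DiffPoly

/-! ### The Lie-theoretic data -/

section Lie

variable {F : Type*} [Field F] {g : Type*} [LieRing g] [LieAlgebra F g]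

/-- `halfGrade x i` is `g_{i/2}`, the eigenspace of `ad x` with eigenvalue `i/2`. -/
def halfGrade (x : g) (i : ℤ) : Submodule F g :=
  Module.End.eigenspace (LieAlgebra.ad F g x) ((i : F) / 2)

/-- `gradeLE x i` is `g_{≤ i/2}`. -/
def gradeLE (x : g) (i : ℤ) : Submodule F g := ⨆ j : ℤ, ⨆ _ : j ≤ i, halfGrade x j

/-- `gradeGE x i` is `g_{≥ i/2}`. -/
def gradeGE (x : g) (i : ℤ) : Submodule F g := ⨆ j : ℤ, ⨆ _ : i ≤ j, halfGrade x j

/-- `g^f`, the centralizer of `f` in `g`. -/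
def centr (f : g) : Submodule F g := LinearMap.ker (LieAlgebra.ad F g f)

/-- `[e, g_{≤ -1/2}]`. -/
def lieE (x e : g) : Submodule F g := (gradeLE x (-1)).map (LieAlgebra.ad F g e)

open Classical in
/-- The projection of a vector space onto `p` with kernel `q`, for complementary subspaces `p`
and `q` (by convention `0` if they are not complementary). -/
def projOnto {M : Type*} [AddCommGroup M] [Module F M] (p q : Submodule F M) : M →ₗ[F] p :=
  if h : IsCompl p q then p.projectionOnto q h else 0

/-- The projection `π_{≤1/2} : g → g_{≤1/2}` with kernel `g_{≥1}`. -/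
def projLE (x : g) : g →ₗ[F] gradeLE (F := F) x 1 := projOnto (gradeLE x 1) (gradeGE x 2)

/-- The projection `g_{≤1/2} → g^f`, `a ↦ a^♯`, with kernel `[e, g_{≤-1/2}]`. -/
def sharp (x e f : g) : gradeLE (F := F) x 1 →ₗ[F] centr (F := F) f :=
  ((gradeLE (F := F) x 1).subtype.restrict
      (p := (centr f).submoduleOf (gradeLE x 1)) (q := centr f) (fun _ h => h)) ∘ₗ
    projOnto ((centr f).submoduleOf (gradeLE x 1)) ((lieE x e).submoduleOf (gradeLE x 1))

/-- The differential algebra homomorphism `π : V(g_{≤1/2}) → V(g^f)` extending `sharp`. -/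
def piHom (x e f : g) :
    DiffPoly F (gradeLE (F := F) x 1) →ₐ[F] DiffPoly F (centr (F := F) f) :=
  diffLift (gen 0 ∘ₗ sharp x e f)

/-- The element of `V(g_{≤1/2})` given by the `g_{≤1/2}`-component of `a ∈ g`; it is the generator
`a` itself when `a ∈ g_{≤1/2}`. -/
def genLE (x : g) : g →ₗ[F] DiffPoly F (gradeLE (F := F) x 1) := gen 0 ∘ₗ projLE x

/-- The inclusion of differential algebras `V(g_{≤1/2}) → V(g)`. -/
def inclHom (x : g) : DiffPoly F (gradeLE (F := F) x 1) →ₐ[F] DiffPoly F g :=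
  diffLift (gen 0 ∘ₗ (gradeLE x 1).subtype)

variable (B : LinearMap.BilinForm F g)

/-- The differential algebra homomorphism `ρ : V(g) → V(g_{≤1/2})`,
`ρ(a) = π_{≤1/2}(a) + (f|a)`. -/
def rho (x f : g) : DiffPoly F g →ₐ[F] DiffPoly F (gradeLE (F := F) x 1) :=
  diffLift (genLE x + Algebra.linearMap F _ ∘ₗ B f)

/-- The `λ`-bracket of generators, `{a_λ b}_z = [a,b] + (a|b) λ + z (s|[a,b])`, linear in `b`. -/
def lamBase (s : g) (z : F) (a : g) : g →ₗ[F] (DiffPoly F g)[X] :=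
  (CAlgHom (R := F) (A := DiffPoly F g)).toLinearMap ∘ₗ gen 0 ∘ₗ LieAlgebra.ad F g a
    + (monomial 1).restrictScalars F ∘ₗ Algebra.linearMap F _ ∘ₗ B a
    + z • (Algebra.linearMap F (DiffPoly F g)[X] ∘ₗ B s ∘ₗ LieAlgebra.ad F g a)

/-- The `λ`-bracket `P ↦ {a_λ P}_z`, `V(g) → V(g)[λ]`, of the affine Poisson vertex algebra `V(g)`,
for `a ∈ g`: by the left Leibniz rule it is a derivation in `P`, and by sesquilinearity
`{a_λ ∂ⁿ b}_z = (λ + ∂)ⁿ {a_λ b}_z`; these determine it from the bracket of generators. -/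
def lamBracket (s : g) (z : F) (a : g) : Derivation F (DiffPoly F g) (DiffPoly F g)[X] :=
  symDer (Finsupp.lsum F fun n => (lamShift ^ n) ∘ₗ lamBase B s z a)

/-- The action `a^ρ_λ P = ρ {a_λ P}_z` of `a` on `P ∈ V(g_{≤1/2})`, with `ρ` applied to the
coefficients. -/
def rhoAct (x f s : g) (z : F) (a : g) (P : DiffPoly F (gradeLE (F := F) x 1)) :
    (DiffPoly F (gradeLE (F := F) x 1))[X] :=
  Polynomial.mapAlgHom (rho B x f) (lamBracket B s z a (inclHom x P))

theorem lamShift_C_mul {M : Type*} [AddCommGroup M] [Module F M] (a : DiffPoly F M)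
    (p : (DiffPoly F M)[X]) :
    lamShift (C a * p) = C a * lamShift p + C (deriv a) * p := by
  induction p using Polynomial.induction_on' with
  | add p q hp hq => simp only [mul_add, map_add, hp, hq]; ring
  | monomial n b =>
    simp [lamShift, C_mul_monomial, Polynomial.sum_monomial_index, X_mul_monomial, mul_add,
      mul_comm b, add_assoc]

theorem lamBracket_gen (s : g) (z : F) (a : g) (n : ℕ) (b : g) :
    lamBracket B s z a (gen n b) = (lamShift ^ n) (lamBase B s z a b) := by
  simp [lamBracket, gen, symDer_ι]

theorem lamBracket_deriv (s : g) (z : F) (a : g) (P : DiffPoly F g) :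
    lamBracket B s z a (deriv P) = lamShift (lamBracket B s z a P) := by
  induction P using diffPoly_induction with
  | halg r => simp
  | hgen n m => rw [deriv_gen, lamBracket_gen, lamBracket_gen, pow_succ']; rfl
  | hadd p q hp hq => simp [hp, hq]
  | hmul p q hp hq =>
    simp only [Derivation.leibniz, smul_eq_mul, map_add, hp, hq, Algebra.smul_def,
      Polynomial.algebraMap_eq, lamShift_C_mul]
    ring

theorem mapAlgHom_lamShift {M N : Type*} [AddCommGroup M] [Module F M] [AddCommGroup N]
    [Module F N] (φ : M →ₗ[F] DiffPoly F N) (p : (DiffPoly F M)[X]) :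
    mapAlgHom (diffLift φ) (lamShift p) = lamShift (mapAlgHom (diffLift φ) p) := by
  induction p using Polynomial.induction_on' with
  | add p q hp hq => simp only [map_add, hp, hq]
  | monomial n b =>
    simp [lamShift, Polynomial.sum_monomial_index, diffLift_deriv, X_mul_monomial]

theorem rhoAct_deriv (x f s : g) (z : F) (a : g) (P : DiffPoly F (gradeLE (F := F) x 1)) :
    rhoAct B x f s z a (deriv P) = lamShift (rhoAct B x f s z a P) := by
  simp only [rhoAct, inclHom, rho, diffLift_deriv, lamBracket_deriv, mapAlgHom_lamShift]

/-- The classical `W`-algebra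
`W = {P ∈ V(g_{≤1/2}) | a^ρ_λ P = 0 for all a ∈ g_{≥1/2}}`. -/
def W (x f s : g) (z : F) : Subalgebra F (DiffPoly F (gradeLE (F := F) x 1)) where
  carrier := {P | ∀ a ∈ gradeGE (F := F) x 1, rhoAct B x f s z a P = 0}
  mul_mem' := by
    intro p q hp hq a ha
    have h1 := hp a ha
    have h2 := hq a ha
    simp only [rhoAct] at h1 h2 ⊢
    simp only [map_mul, Derivation.leibniz, map_add, Algebra.smul_def, h1, h2, mul_zero, add_zero]
  add_mem' := by
    intro p q hp hq a ha
    have h1 := hp a ha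
    have h2 := hq a ha
    simp only [rhoAct] at h1 h2 ⊢
    simp only [map_add, h1, h2, add_zero]
  algebraMap_mem' := by
    intro r a ha
    simp [rhoAct]

theorem deriv_mem_W {x f s : g} {z : F} {P : DiffPoly F (gradeLE (F := F) x 1)}
    (hP : P ∈ W B x f s z) : deriv P ∈ W B x f s z := by
  intro a ha
  rw [rhoAct_deriv, hP a ha, map_zero]

/-- The derivation `∂` of `W`, which is a differential subalgebra of `V(g_{≤1/2})`. -/
def derivW (x f s : g) (z : F) : Derivation F (W B x f s z) (W B x f s z) :=
  Derivation.mk'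
    ((deriv : Derivation F (DiffPoly F (gradeLE (F := F) x 1)) _).toLinearMap.restrict
      (p := Subalgebra.toSubmodule (W B x f s z)) (q := Subalgebra.toSubmodule (W B x f s z))
      (fun _ h => deriv_mem_W B h))
    (by
      intro p q
      apply Subtype.ext
      change deriv (p.1 * q.1) = p.1 • deriv q.1 + q.1 • deriv p.1
      exact Derivation.leibniz _ _ _)

@[simp]
theorem coe_derivW (x f s : g) (z : F) (P : W B x f s z) :
    ((derivW B x f s z P : W B x f s z) : DiffPoly F (gradeLE (F := F) x 1)) = deriv P.1 :=
  rfl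

end Lie

/-! ### Minimal and short nilpotent elements -/

section Nilpotents

/-- `f` is a minimal nilpotent element, that is, a lowest root vector: for some Cartan subalgebra
`H` and some base of the root system of `(g, H)`, `f` is a non-zero element of the root space of
the lowest root `θ`, the root such that `β - θ` is a sum of simple roots for every root `β`. -/
def IsMinimalNilpotent (F : Type*) [Field F] [IsAlgClosed F] [CharZero F] {g : Type*} [LieRing g]
    [LieAlgebra F g] [FiniteDimensional F g] [LieAlgebra.IsSimple F g] (f : g) : Prop :=
  ∃ (H : LieSubalgebra F g) (_ : H.IsCartanSubalgebra)
    (b : (LieAlgebra.IsKilling.rootSystem H).Base) (θ : H.root),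
    (∀ β : H.root,
      (LieAlgebra.IsKilling.rootSystem H).root β - (LieAlgebra.IsKilling.rootSystem H).root θ ∈
        AddSubmonoid.closure ((LieAlgebra.IsKilling.rootSystem H).root '' b.support)) ∧
    f ∈ LieAlgebra.rootSpace H (θ : LieModule.Weight F H g) ∧ f ≠ 0

variable (F : Type*) [Field F] {g : Type*} [LieRing g] [LieAlgebra F g]

/-- The nilpotent element `f` of an `sl₂`-triple `(f, 2x, e)` is short if
`g = g_{-1} ⊕ g_0 ⊕ g_1`. -/
def IsShortNilpotent (x : g) : Prop :=
  halfGrade (F := F) x (-2) ⊔ halfGrade (F := F) x 0 ⊔ halfGrade (F := F) x 2 = ⊤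

end Nilpotents

/-! ### Explicit elements of `V(g_{≤1/2})` -/

section Elements

variable {F : Type*} [Field F] {g : Type*} [LieRing g] [LieAlgebra F g]

/-- `φ(a) = a + ½ Σ_k [a,v_k] v^k`. -/
def phi (x : g) {n : ℕ} (v v' : Fin n → g) (a : g) : DiffPoly F (gradeLE (F := F) x 1) :=
  genLE x a + (1 / 2 : F) • ∑ k, genLE x ⁅a, v k⁆ * genLE x (v' k)

/-- `ψ(u) = u + ⅓ Σ_{h,k} [[u,v_h],v_k] v^h v^k + Σ_k [u,v_k] v^k + ∂[e,u]`. -/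
def psi (x e : g) {n : ℕ} (v v' : Fin n → g) (u : g) : DiffPoly F (gradeLE (F := F) x 1) :=
  genLE x u
    + (1 / 3 : F) • ∑ h, ∑ k, genLE x ⁅⁅u, v h⁆, v k⁆ * genLE x (v' h) * genLE x (v' k)
    + ∑ k, genLE x ⁅u, v k⁆ * genLE x (v' k)
    + deriv (genLE x ⁅e, u⁆)

/-- `L = f + x' + ½ Σ_j a_j a^j + Σ_k v^k [f,v_k] + ½ Σ_k v^k ∂v_k`. -/
def virL (x f : g) {n m : ℕ} (v v' : Fin n → g) (a a' : Fin m → g) :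
    DiffPoly F (gradeLE (F := F) x 1) :=
  genLE x f + deriv (genLE x x)
    + (1 / 2 : F) • ∑ j, genLE x (a j) * genLE x (a' j)
    + ∑ k, genLE x (v' k) * genLE x ⁅f, v k⁆
    + (1 / 2 : F) • ∑ k, genLE x (v' k) * deriv (genLE x (v k))

/-- `L̃ = L - ½ Σ_i φ(c_i) φ(c^i)`. -/
def virLTilde (x f : g) {n m l : ℕ} (v v' : Fin n → g) (a a' : Fin m → g) (c c' : Fin l → g) :
    DiffPoly F (gradeLE (F := F) x 1) :=
  virL x f v v' a a' - (1 / 2 : F) • ∑ i, phi x v v' (c i) * phi x v v' (c' i)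

/-- For short `f`:
`ψ(u) = u - ½ Σ_k [u,u^k] [e,u_k] - ⅛ Σ_k [f,u^k] [e,u ∘ u_k] + ½ ∂[e,u]`, where
`a ∘ b = [[e,a],b]`. -/
def psiShort (x e f : g) {n : ℕ} (w w' : Fin n → g) (u : g) :
    DiffPoly F (gradeLE (F := F) x 1) :=
  genLE x u
    - (1 / 2 : F) • ∑ k, genLE x ⁅u, w' k⁆ * genLE x ⁅e, w k⁆
    - (1 / 8 : F) • ∑ k, genLE x ⁅f, w' k⁆ * genLE x ⁅e, ⁅⁅e, u⁆, w k⁆⁆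
    + (1 / 2 : F) • deriv (genLE x ⁅e, u⁆)

/-- The families `b`, `b'` are dual to each other with respect to the bilinear form `β`. -/
def AreDual (β : g → g → F) {n : ℕ} (b b' : Fin n → g) : Prop :=
  ∀ i j, β (b i) (b' j) = if i = j then 1 else 0

end Elements

end ClassicalW

end

/-! Since `s` has the top degree `d`, `(s|[a,q]) = 0` for `a ∈ g_{≥1/2}`. So `s` and `z` drop out,
and `W` is the common kernel of the λ-derivations of `V(g_{≤1/2})` that send a generator `q` to
`(f|[a,q]) + [a,q] + (a|q)λ`, with `[a,q]` projected to `g_{≤1/2}` (`rhoAct_eq_actDer`).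

Injectivity of `π` on `W` needs neither minimality nor shortness (`eq_zero_of_actDer`). Grade
`V(g_{≤1/2})` by the derivation extending `ad x`, so that `∂` and `λ` have degree zero. For `a` of
degree `i`, the part `[a,q] + (a|q)λ` shifts degrees by `i`, while the constant part `(f|[a,q])`
shifts them only by `i - 1`. Hence the constant parts alone kill the lowest component `P₀` of any `P
∈ W`. If `π P = 0`, then `π P₀ = 0`, because `π` preserves degrees. The functionals `(f|[a,·])` have
common kernel `g^f`, hence span its annihilator. An element killed by all of them therefore lies in
`V(g^f)`, where `π` is the identity, and so `P₀ = 0`.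

For surjectivity it is enough to find, for each `c` in a spanning set of `g^f`, an element of `W`
with image `c` under `π`. By injectivity this element is `π⁻¹(c)`, whatever bases entered its
formula (`exists_equiv_of_surjective`). What remains is to check that the explicit elements are
annihilated by `g_{≥1/2}` and have the right images.

In the minimal case `[f,[f,g]] ⊆ F f`. This forces `g_1 = F e` and `g_j = 0` for `j > 1`, so only
`e` and `g_{1/2}` have to be tested, and `[a,b] = (f|e)⁻¹ (f|[a,b]) e` on `g_{1/2}`. In the short
case only `g_1` has to be tested.

Diagonalisability of `ad x` and the decompositions of `g` come from an elementary study of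
finite-dimensional `sl₂`-modules through the Casimir operator. -/

noncomputable section

namespace ClassicalW

/-! ### Finite-dimensional `sl₂`-modules -/

section EndSl2

variable {F M : Type*} [Field F] [AddCommGroup M] [Module F M]

/-- The commutation relations of `sl₂` for three endomorphisms of a vector space. -/
structure EndSl2 (H E Φ : Module.End F M) : Prop where
  hE : ∀ v, H (E v) = E (H v) + (2 : F) • E v
  hΦ : ∀ v, H (Φ v) = Φ (H v) - (2 : F) • Φ v
  eΦ : ∀ v, E (Φ v) = Φ (E v) + H v

namespace EndSl2

variable {H E Φ : Module.End F M}

theorem symm (t : EndSl2 H E Φ) : EndSl2 (-H) Φ E where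
  hE v := by simp [t.hΦ]; abel
  hΦ v := by simp [t.hE]; abel
  eΦ v := by simp [t.eΦ]

theorem hE_pow (t : EndSl2 H E Φ) (n : ℕ) (v : M) :
    H ((E ^ n) v) = (E ^ n) (H v) + (2 * n : F) • (E ^ n) v := by
  induction n with
  | zero => simp
  | succ n ih =>
    rw [pow_succ', Module.End.mul_apply, t.hE, ih, Module.End.mul_apply, map_add, map_smul,
      add_assoc, ← add_smul]
    congr 2
    push_cast
    ring

/-- The powers of `E`, if all non-zero, would be eigenvectors of the commutator with `H` for the
distinct eigenvalues `2n`, hence an infinite independent family of endomorphisms. -/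
theorem isNilpotent_e [CharZero F] [FiniteDimensional F M] (t : EndSl2 H E Φ) :
    IsNilpotent E := by
  by_contra hn
  have hne : ∀ n, E ^ n ≠ 0 := fun n h => hn ⟨n, h⟩
  have hinj : Function.Injective fun n : ℕ => (2 * n : F) := by
    intro a b h
    simpa using h
  let A : Module.End F (Module.End F M) := LinearMap.mulLeft F H - LinearMap.mulRight F H
  have hA : ∀ n : ℕ, A.HasEigenvector (2 * n : F) (E ^ n) := by
    intro n
    refine ⟨?_, hne n⟩
    rw [Module.End.mem_eigenspace_iff]
    ext v
    simp [A, t.hE_pow]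
  have := Module.End.eigenvectors_linearIndependent' A _ hinj _ hA
  exact not_finite_iff_infinite.mpr (inferInstanceAs (Infinite ℕ)) this.finite

theorem isNilpotent_f [CharZero F] [FiniteDimensional F M] (t : EndSl2 H E Φ) :
    IsNilpotent Φ := t.symm.isNilpotent_e

/-- The Casimir operator. -/
def cas (H E Φ : Module.End F M) : Module.End F M := H * H + (2 : F) • H + (4 : F) • (Φ * E)

theorem cas_apply (v : M) : cas H E Φ v = H (H v) + (2 : F) • H v + (4 : F) • Φ (E v) := rfl

theorem cas_h (t : EndSl2 H E Φ) (v : M) : cas H E Φ (H v) = H (cas H E Φ v) := by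
  simp only [cas_apply, map_add, map_smul, t.hΦ, t.hE]
  module

theorem cas_e (t : EndSl2 H E Φ) (v : M) : cas H E Φ (E v) = E (cas H E Φ v) := by
  simp only [cas_apply, map_add, map_smul, t.hE, t.eΦ]
  module

theorem cas_f (t : EndSl2 H E Φ) (v : M) : cas H E Φ (Φ v) = Φ (cas H E Φ v) := by
  simp only [cas_apply, map_add, map_smul, t.hΦ, t.eΦ, map_sub]
  module

theorem cas_symm (t : EndSl2 H E Φ) : cas (-H) Φ E = cas H E Φ := by
  ext v
  simp only [cas_apply, LinearMap.neg_apply, map_neg, t.eΦ]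
  module

/-- The lowering operator, composed with the raising one, is injective on negative weights. -/
theorem eq_zero_of_f_e [CharZero F] [FiniteDimensional F M] (t : EndSl2 H E Φ) {μ : ℤ} (hμ : μ < 0)
    {w : M} (hw : H w = (μ : F) • w) (h0 : Φ (E w) = 0) : w = 0 := by
  by_contra hne
  obtain ⟨k, hk⟩ := t.isNilpotent_f
  -- `Φ ^ m w` is the last non-zero vector of the lowering chain. The Casimir eigenvalue on it is
  -- computed twice: transported from `w`, where `Φ E w = 0`, and directly, since `Φ` kills it.
  obtain ⟨m, hm, hm'⟩ := Nat.exists_not_and_succ_of_not_zero_of_exists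
    (p := fun n => (Φ ^ n) w = 0) (by simpa using hne) ⟨k, by simp [hk]⟩
  have h1 : H ((Φ ^ m) w) = (μ - 2 * m : F) • (Φ ^ m) w := by
    have := t.symm.hE_pow m w
    simp only [LinearMap.neg_apply, map_neg, hw, map_smul] at this
    rw [← neg_inj, this]
    module
  have h2 : cas H E Φ ((Φ ^ m) w) = (μ * μ + 2 * μ : F) • (Φ ^ m) w := by
    have hc : ∀ n, cas H E Φ ((Φ ^ n) w) = (Φ ^ n) (cas H E Φ w) := by
      intro n
      induction n with
      | zero => simp
      | succ n ih => rw [pow_succ', Module.End.mul_apply, Module.End.mul_apply, t.cas_f, ih]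
    rw [hc, cas_apply, h0, hw, map_smul, hw]
    simp only [map_add, map_smul, smul_zero, add_zero]
    module
  have h3 : Φ ((Φ ^ m) w) = 0 := by rw [← Module.End.mul_apply, ← pow_succ', hm']
  rw [← t.cas_symm, cas_apply, h3] at h2
  simp only [LinearMap.neg_apply, map_neg, h1, map_smul, map_zero, smul_zero, add_zero, smul_neg,
    neg_neg] at h2
  -- This is the difference `((μ - 2m)² - 2(μ - 2m)) - (μ² + 2μ)`, positive because `μ < 0 ≤ m`.
  have h4 : ((4 * (m + 1) * (m - μ) : ℤ) : F) • (Φ ^ m) w = 0 := by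
    rw [← sub_eq_zero] at h2
    rw [← h2]
    push_cast
    module
  rcases smul_eq_zero.1 h4 with h | h
  · rw [Int.cast_eq_zero] at h
    have : (0 : ℤ) < 4 * (m + 1) * (m - μ) := by
      apply mul_pos <;> omega
    omega
  · exact hm h

theorem eq_zero_of_e_f [CharZero F] [FiniteDimensional F M] (t : EndSl2 H E Φ) {μ : ℤ} (hμ : 0 < μ)
    {w : M} (hw : H w = (μ : F) • w) (h0 : E (Φ w) = 0) : w = 0 :=
  t.symm.eq_zero_of_f_e (μ := -μ) (by omega) (by simp [hw]) h0

/-- The square of the lowering operator is injective on vectors of weight two. -/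
theorem eq_zero_of_f_f [CharZero F] [FiniteDimensional F M] (t : EndSl2 H E Φ) {v : M}
    (hv : H v = (2 : F) • v) (h : Φ (Φ v) = 0) : v = 0 := by
  have hΦ : H (Φ v) = 0 := by rw [t.hΦ, hv, map_smul, sub_self]
  have h1 : cas H E Φ (Φ v) = 0 := by
    rw [← t.cas_symm, cas_apply, h]
    simp only [LinearMap.neg_apply, hΦ, map_zero, neg_zero, smul_zero, add_zero]
  have h2 : cas H E Φ v = (4 : F) • E (Φ v) := by
    rw [← t.cas_symm, cas_apply]
    simp only [LinearMap.neg_apply, map_neg, hv, map_smul]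
    module
  -- `cas v` has weight two and is killed by `Φ`, since the Casimir commutes with `Φ` and
  -- annihilates `Φ v`.
  have h3 : cas H E Φ v = 0 := by
    refine t.eq_zero_of_e_f (μ := 2) (by norm_num) ?_ ?_
    · rw [← t.cas_h, hv, map_smul]; norm_num
    · rw [← t.cas_f, h1, map_zero]
  rw [h2] at h3
  exact t.eq_zero_of_e_f (μ := 2) (by norm_num) (by rw [hv]; norm_num)
    ((smul_eq_zero.1 h3).resolve_left (by norm_num))

/-- `H - c n` is invertible on the sum of the earlier eigenspaces, so `v` can be corrected by an
element of that sum into an eigenvector for `c n`. This is the induction step by which annihilation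
by a product of distinct factors `H - c j` becomes an eigenvector decomposition inside `p`. -/
theorem mem_iSup_succ_of_sub_mem {p : Submodule F M} {c : ℕ → F} (hc : Function.Injective c) {n : ℕ}
    {v : M} (hv : v ∈ p)
    (h : H v - c n • v ∈ ⨆ j : Fin n, p ⊓ Module.End.eigenspace H (c j)) :
    v ∈ ⨆ j : Fin (n + 1), p ⊓ Module.End.eigenspace H (c j) := by
  have key : ∀ u ∈ ⨆ j : Fin n, p ⊓ Module.End.eigenspace H (c j),
      ∃ w ∈ ⨆ j : Fin n, p ⊓ Module.End.eigenspace H (c j), H w - c n • w = u := by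
    intro u hu
    induction hu using Submodule.iSup_induction' with
    | mem j y hy =>
      have hne : c j - c n ≠ 0 := sub_ne_zero.2 fun h => j.2.ne (hc h)
      refine ⟨(c j - c n)⁻¹ • y, Submodule.smul_mem _ _ (Submodule.mem_iSup_of_mem j hy), ?_⟩
      rw [map_smul, Module.End.mem_eigenspace_iff.1 hy.2]
      have : (c j - c n)⁻¹ • c j • y - c n • (c j - c n)⁻¹ • y
        = ((c j - c n)⁻¹ * (c j - c n)) • y := by module
      rw [this, inv_mul_cancel₀ hne, one_smul]
    | zero => exact ⟨0, zero_mem _, by simp⟩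
    | add a b _ _ ha hb =>
      obtain ⟨a', ha', rfl⟩ := ha
      obtain ⟨b', hb', rfl⟩ := hb
      exact ⟨a' + b', add_mem ha' hb', by rw [map_add]; module⟩
  obtain ⟨w, hw, hwe⟩ := key _ h
  have hle : (⨆ j : Fin n, p ⊓ Module.End.eigenspace H (c j)) ≤ p := iSup_le fun j => inf_le_left
  have hle' : (⨆ j : Fin n, p ⊓ Module.End.eigenspace H (c j)) ≤
      ⨆ j : Fin (n + 1), p ⊓ Module.End.eigenspace H (c j) :=
    iSup_le fun j => le_iSup (fun j : Fin (n + 1) => p ⊓ Module.End.eigenspace H (c j)) j.castSucc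
  have hmem : v - w ∈ p ⊓ Module.End.eigenspace H (c (Fin.last n)) := by
    refine ⟨sub_mem hv (hle hw), ?_⟩
    rw [SetLike.mem_coe, Module.End.mem_eigenspace_iff, Fin.val_last, ← sub_eq_zero, ← sub_eq_zero.2 hwe.symm, map_sub]
    module
  rw [← sub_add_cancel v w]
  exact add_mem (Submodule.mem_iSup_of_mem (Fin.last n) hmem) (hle' hw)

/-- On a vector killed by `E`, this turns `Φ ^ (n + 1) v = 0` into `Φ ^ n (H - n) v = 0`, peeling
off one factor of `∏ (H - j)`. -/
theorem e_f_pow (t : EndSl2 H E Φ) (n : ℕ) {v : M} (hv : E v = 0) :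
    E ((Φ ^ (n + 1)) v) = ((n : F) + 1) • (Φ ^ n) (H v - (n : F) • v) := by
  induction n with
  | zero => simp [t.eΦ, hv]
  | succ n ih =>
    have h1 : H ((Φ ^ (n + 1)) v) = (Φ ^ (n + 1)) (H v) - (2 * ((n + 1 : ℕ) : F)) • (Φ ^ (n + 1)) v := by
      have := t.symm.hE_pow (n + 1) v
      simp only [LinearMap.neg_apply, map_neg] at this
      rw [← neg_inj, this]
      module
    rw [pow_succ', Module.End.mul_apply, t.eΦ, ih, map_smul, ← Module.End.mul_apply, ← pow_succ',
      h1]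
    simp only [map_sub, map_smul]
    push_cast
    module

/-- The argument avoids complete reducibility. On a generalised eigenspace `p` of the Casimir,
nilpotency of `Φ` makes `H` diagonalisable with natural eigenvalues on the vectors killed by `E`.
The Casimir eigenvalue `j² + 2j` then leaves only one such `j = l`, and the filtration of `p` by the
kernels of the `E ^ k` has `H` acting on successive quotients by the distinct scalars `l - 2k`. -/
theorem iSup_eigenspace_eq_top [IsAlgClosed F] [CharZero F] [FiniteDimensional F M]
    (t : EndSl2 H E Φ) : ⨆ i : ℤ, Module.End.eigenspace H (i : F) = ⊤ := by
  rw [eq_top_iff, ← Module.End.iSup_maxGenEigenspace_eq_top (cas H E Φ)]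
  refine iSup_le fun c => ?_
  set p := (cas H E Φ).maxGenEigenspace c with hp
  have hmaps : ∀ T : Module.End F M, (∀ v, cas H E Φ (T v) = T (cas H E Φ v)) →
      ∀ v ∈ p, T v ∈ p := by
    intro T hT v hv
    exact Module.End.mapsTo_maxGenEigenspace_of_comm
      (show Commute (cas H E Φ) T from LinearMap.ext hT) c hv
  have hH := hmaps H t.cas_h
  have hE := hmaps E t.cas_e
  have hprim : ∀ n : ℕ, ∀ v ∈ p ⊓ LinearMap.ker E, (Φ ^ n) v = 0 →
      v ∈ ⨆ j : Fin n, (p ⊓ LinearMap.ker E) ⊓ Module.End.eigenspace H ((j : ℕ) : F) := by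
    intro n
    induction n with
    | zero => rintro v - h0; simp_all
    | succ n ih =>
      intro v hv h0
      refine mem_iSup_succ_of_sub_mem (c := fun j : ℕ => (j : F)) Nat.cast_injective hv (ih _ ?_ ?_)
      · refine ⟨sub_mem (hH v hv.1) (p.smul_mem _ hv.1), ?_⟩
        have hv2 : E v = 0 := hv.2
        have := t.hE v
        rw [hv2, map_zero, smul_zero, add_zero] at this
        simp [LinearMap.mem_ker, ← this, hv2]
      · have := t.e_f_pow n (v := v) hv.2
        rw [h0, map_zero] at this
        exact (smul_eq_zero.1 this.symm).resolve_left (Nat.cast_add_one_ne_zero n)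
  obtain ⟨N, hN⟩ := t.isNilpotent_f
  have hc : ∀ j : ℕ, ∀ v ∈ (p ⊓ LinearMap.ker E) ⊓ Module.End.eigenspace H (j : F), v ≠ 0 →
      ((j * j + 2 * j : ℕ) : F) = c := by
    rintro j v ⟨⟨hv1, hv2⟩, hv3⟩ hne
    have hv2 : E v = 0 := hv2
    have hv3 := Module.End.mem_eigenspace_iff.1 hv3
    have h1 : cas H E Φ v = ((j * j + 2 * j : ℕ) : F) • v := by
      rw [cas_apply, hv2, hv3, map_smul, hv3, map_zero]
      push_cast
      module
    by_contra hcne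
    have h2 : v ∈ (cas H E Φ).maxGenEigenspace ((j * j + 2 * j : ℕ) : F) :=
      (Module.End.mem_maxGenEigenspace _ _ _).2 ⟨1, by simp [h1]⟩
    exact hne (Submodule.disjoint_def.1
      (Module.End.disjoint_genEigenspace (cas H E Φ) hcne ⊤ ⊤) v h2 hv1)
  -- `j ↦ j² + 2j` is injective on `ℕ`, so `c` determines the weight of the vectors of `p` killed by
  -- `E`.
  obtain ⟨l, hl⟩ : ∃ l : ℕ, ∀ v ∈ p ⊓ LinearMap.ker E, H v = (l : F) • v := by
    by_cases hex : ∃ l : ℕ, ((l * l + 2 * l : ℕ) : F) = c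
    · obtain ⟨l, hl⟩ := hex
      refine ⟨l, fun v hv => ?_⟩
      rw [← Module.End.mem_eigenspace_iff]
      refine (iSup_le fun j => ?_ : (⨆ j : Fin N, (p ⊓ LinearMap.ker E) ⊓
        Module.End.eigenspace H ((j : ℕ) : F)) ≤ _) (hprim N v hv (by simp [hN]))
      intro w hw
      by_cases hw0 : w = 0
      · simp [hw0]
      · have := hc j w hw hw0
        rw [← hl, Nat.cast_inj] at this
        have : (j : ℕ) = l := by nlinarith
        rw [← this]
        exact hw.2
    -- Here no non-zero vector of `p` is killed by `E`, so the value of `l` is immaterial.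
    · refine ⟨0, fun v hv => ?_⟩
      have := (iSup_le fun j => ?_ : (⨆ j : Fin N, (p ⊓ LinearMap.ker E) ⊓
        Module.End.eigenspace H ((j : ℕ) : F)) ≤ ⊥) (hprim N v hv (by simp [hN]))
      · rw [(Submodule.mem_bot F).1 this]; simp
      · intro w hw
        by_contra hw0
        exact hex ⟨j, hc j w hw hw0⟩
  -- If `E ^ (k + 1) v = 0`, then `E ^ k v` has weight `l`. Moving `H` across `E ^ k` gives `E ^ k
  -- (H - (l - 2k)) v = 0`.
  have hfilt : ∀ k : ℕ, ∀ v ∈ p, (E ^ k) v = 0 →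
      v ∈ ⨆ j : Fin k, p ⊓ Module.End.eigenspace H ((l : F) - 2 * (j : ℕ)) := by
    intro k
    induction k with
    | zero => rintro v - h0; simp_all
    | succ k ih =>
      intro v hv h0
      refine mem_iSup_succ_of_sub_mem (c := fun j : ℕ => (l : F) - 2 * j)
        (fun a b h => by simpa using h) hv (ih _ ?_ ?_)
      · exact sub_mem (hH v hv) (p.smul_mem _ hv)
      · have hk : (E ^ k) v ∈ p := by
          clear h0 ih
          induction k with
          | zero => simpa
          | succ k ih => rw [pow_succ', Module.End.mul_apply]; exact hE _ ih
        have h1 := hl ((E ^ k) v) ⟨hk, by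
          rw [SetLike.mem_coe, LinearMap.mem_ker, ← Module.End.mul_apply, ← pow_succ', h0]⟩
        rw [t.hE_pow] at h1
        rw [map_sub, map_smul, eq_sub_of_add_eq h1]
        module
  obtain ⟨K, hK⟩ := t.isNilpotent_e
  intro v hv
  refine (iSup_le fun j => ?_ : (⨆ j : Fin K, p ⊓
    Module.End.eigenspace H ((l : F) - 2 * (j : ℕ))) ≤ _) (hfilt K v hv (by simp [hK]))
  refine inf_le_right.trans ?_
  refine le_trans (le_of_eq ?_) (le_iSup _ ((l : ℤ) - 2 * (j : ℕ)))
  push_cast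
  rfl

end EndSl2

end EndSl2

/-! ### The half-integer grading by `ad x` (the index `i` stands for degree `i/2`) -/

section Grading

variable {F : Type*} [Field F] {g : Type*} [LieRing g] [LieAlgebra F g]

theorem mem_halfGrade {x a : g} {i : ℤ} :
    a ∈ halfGrade (F := F) x i ↔ ⁅x, a⁆ = ((i : F) / 2) • a := by
  rw [halfGrade, Module.End.mem_eigenspace_iff, LieAlgebra.ad_apply]

theorem mem_centr {f a : g} : a ∈ centr (F := F) f ↔ ⁅f, a⁆ = 0 := by
  rw [centr, LinearMap.mem_ker, LieAlgebra.ad_apply]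

theorem halfGrade_le_gradeLE {x : g} {i j : ℤ} (h : i ≤ j) :
    halfGrade (F := F) x i ≤ gradeLE x j := le_iSup₂_of_le i h le_rfl

theorem halfGrade_le_gradeGE {x : g} {i j : ℤ} (h : j ≤ i) :
    halfGrade (F := F) x i ≤ gradeGE x j := le_iSup₂_of_le i h le_rfl

theorem gradeLE_mono {x : g} {i j : ℤ} (h : i ≤ j) : gradeLE (F := F) x i ≤ gradeLE x j :=
  iSup₂_le fun _ hk => halfGrade_le_gradeLE (hk.trans h)

theorem lie_mem_halfGrade {x a b : g} {i j : ℤ} (ha : a ∈ halfGrade (F := F) x i)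
    (hb : b ∈ halfGrade (F := F) x j) : ⁅a, b⁆ ∈ halfGrade (F := F) x (i + j) := by
  rw [mem_halfGrade] at *
  rw [leibniz_lie, ha, hb, smul_lie, lie_smul, ← add_smul]
  congr 1
  push_cast
  ring

theorem lie_mem_of_mem_halfGrade {x a : g} {i : ℤ} {p : Submodule F g}
    (h : halfGrade (F := F) x i ≤ p) (ha : a ∈ halfGrade (F := F) x i) : ⁅x, a⁆ ∈ p := by
  rw [mem_halfGrade.1 ha]
  exact p.smul_mem _ (h ha)

theorem lie_mem_gradeLE {x a : g} {i : ℤ} (ha : a ∈ gradeLE (F := F) x i) :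
    ⁅x, a⁆ ∈ gradeLE (F := F) x i := by
  refine (iSup₂_le fun j hj b hb => ?_ :
    gradeLE (F := F) x i ≤ (gradeLE x i).comap (LieAlgebra.ad F g x)) ha
  exact lie_mem_of_mem_halfGrade (halfGrade_le_gradeLE hj) hb

theorem lie_mem_gradeGE {x a : g} {i : ℤ} (ha : a ∈ gradeGE (F := F) x i) :
    ⁅x, a⁆ ∈ gradeGE (F := F) x i := by
  refine (iSup₂_le fun j hj b hb => ?_ :
    gradeGE (F := F) x i ≤ (gradeGE x i).comap (LieAlgebra.ad F g x)) ha
  exact lie_mem_of_mem_halfGrade (halfGrade_le_gradeGE hj) hb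

variable [CharZero F]

theorem halfCast_injective : Function.Injective fun i : ℤ => ((i : F) / 2) := by
  intro i j h
  have : (i : F) = j := by simpa using h
  exact_mod_cast this

theorem iSupIndep_halfGrade (x : g) : iSupIndep (halfGrade (F := F) x) :=
  (Module.End.eigenspaces_iSupIndep (LieAlgebra.ad F g x)).comp halfCast_injective

theorem disjoint_halfGrade_gradeLE {x : g} {i j : ℤ} (h : j < i) :
    Disjoint (halfGrade (F := F) x i) (gradeLE x j) :=
  (iSupIndep_halfGrade x).disjoint_biSup (y := {k | k ≤ j}) (by simpa using h)

theorem disjoint_halfGrade_gradeGE {x : g} {i j : ℤ} (h : i < j) :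
    Disjoint (halfGrade (F := F) x i) (gradeGE x j) :=
  (iSupIndep_halfGrade x).disjoint_biSup (y := {k | j ≤ k}) (by simpa using h)

theorem disjoint_halfGrade {x : g} {i j : ℤ} (h : i ≠ j) :
    Disjoint (halfGrade (F := F) x i) (halfGrade x j) :=
  (iSupIndep_halfGrade x).pairwiseDisjoint h

end Grading

/-! ### Orthogonality of graded pieces -/

section Form

variable {F : Type*} [Field F] {g : Type*} [LieRing g] [LieAlgebra F g]
  {B : LinearMap.BilinForm F g}

theorem form_lie_left (hinv : B.lieInvariant g) (a b c : g) : B ⁅a, b⁆ c = B a ⁅b, c⁆ := by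
  rw [← lie_skew, map_neg, LinearMap.neg_apply, hinv, neg_neg]

variable [CharZero F]

theorem form_eq_zero (hinv : B.lieInvariant g) {x a b : g} {i j : ℤ}
    (ha : a ∈ halfGrade (F := F) x i) (hb : b ∈ halfGrade (F := F) x j) (hij : i + j ≠ 0) :
    B a b = 0 := by
  have h := hinv x a b
  rw [mem_halfGrade.1 ha, mem_halfGrade.1 hb, map_smul, map_smul, LinearMap.smul_apply,
    smul_eq_mul, smul_eq_mul] at h
  have h2 : ((i + j : ℤ) : F) * B a b = 0 := by
    push_cast
    linear_combination 2 * h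
  exact (mul_eq_zero.1 h2).resolve_left (by exact_mod_cast hij)

theorem form_eq_zero_of_gradeLE (hinv : B.lieInvariant g) {x a b : g} {i j : ℤ}
    (ha : a ∈ halfGrade (F := F) x i) (hb : b ∈ gradeLE (F := F) x j) (hij : i + j < 0) :
    B a b = 0 := by
  refine (iSup₂_le fun k hk c hc => ?_ : gradeLE (F := F) x j ≤ LinearMap.ker (B a)) hb
  exact form_eq_zero hinv ha hc (by omega)

theorem form_eq_zero_of_gradeGE (hinv : B.lieInvariant g) {x a b : g} {i j : ℤ}
    (ha : a ∈ halfGrade (F := F) x i) (hb : b ∈ gradeGE (F := F) x j) (hij : 0 < i + j) :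
    B a b = 0 := by
  refine (iSup₂_le fun k hk c hc => ?_ : gradeGE (F := F) x j ≤ LinearMap.ker (B a)) hb
  exact form_eq_zero hinv ha hc (by omega)

end Form

/-! ### Decompositions of `g` attached to the triple -/

section Triple

variable {F : Type*} [Field F] {g : Type*} [LieRing g] [LieAlgebra F g] {x e f : g}

theorem endSl2_ad (t : IsSl2Triple ((2 : F) • x) e f) :
    EndSl2 (LieAlgebra.ad F g ((2 : F) • x)) (LieAlgebra.ad F g e) (LieAlgebra.ad F g f) where
  hE v := by
    simp only [LieAlgebra.ad_apply]
    rw [leibniz_lie, t.lie_h_e_smul F, smul_lie, add_comm]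
  hΦ v := by
    simp only [LieAlgebra.ad_apply]
    rw [leibniz_lie, t.lie_lie_smul_f F, neg_lie, smul_lie]
    abel
  eΦ v := by
    simp only [LieAlgebra.ad_apply]
    rw [leibniz_lie, t.lie_e_f, add_comm]

theorem mem_halfGrade_iff_ad {a : g} {i : ℤ} [CharZero F] :
    a ∈ halfGrade (F := F) x i ↔ LieAlgebra.ad F g ((2 : F) • x) a = (i : F) • a := by
  rw [mem_halfGrade, LieAlgebra.ad_apply, smul_lie]
  constructor
  · intro h
    rw [h, smul_smul]
    congr 1
    ring
  · intro h
    rw [div_eq_inv_mul, mul_smul, ← h, smul_smul, inv_mul_cancel₀ two_ne_zero, one_smul]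

theorem halfGrade_eq_ad [CharZero F] (i : ℤ) : halfGrade (F := F) x i =
    Module.End.eigenspace (LieAlgebra.ad F g ((2 : F) • x)) (i : F) := by
  ext a
  rw [mem_halfGrade_iff_ad, Module.End.mem_eigenspace_iff]

theorem x_mem : x ∈ halfGrade (F := F) x 0 := by
  rw [mem_halfGrade]; simp

variable [CharZero F]

theorem lie_x_e (t : IsSl2Triple ((2 : F) • x) e f) : ⁅x, e⁆ = e := by
  have := t.lie_h_e_smul F
  rw [smul_lie] at this
  exact smul_right_injective g (two_ne_zero (α := F)) this

theorem lie_x_f (t : IsSl2Triple ((2 : F) • x) e f) : ⁅x, f⁆ = -f := by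
  have := t.lie_lie_smul_f F
  rw [smul_lie, ← smul_neg] at this
  exact smul_right_injective g (two_ne_zero (α := F)) this

theorem lie_f_x (t : IsSl2Triple ((2 : F) • x) e f) : ⁅f, x⁆ = f := by
  rw [← lie_skew, lie_x_f t, neg_neg]

theorem e_mem (t : IsSl2Triple ((2 : F) • x) e f) : e ∈ halfGrade (F := F) x 2 := by
  rw [mem_halfGrade, lie_x_e t]; norm_num

theorem f_mem (t : IsSl2Triple ((2 : F) • x) e f) : f ∈ halfGrade (F := F) x (-2) := by
  rw [mem_halfGrade, lie_x_f t]; norm_num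

theorem lie_f_mem (t : IsSl2Triple ((2 : F) • x) e f) {a : g} {i : ℤ}
    (ha : a ∈ halfGrade (F := F) x i) : ⁅f, a⁆ ∈ halfGrade (F := F) x (i - 2) := by
  have := lie_mem_halfGrade (f_mem t) ha
  rwa [show -2 + i = i - 2 by ring] at this

theorem lie_e_mem (t : IsSl2Triple ((2 : F) • x) e f) {a : g} {i : ℤ}
    (ha : a ∈ halfGrade (F := F) x i) : ⁅e, a⁆ ∈ halfGrade (F := F) x (i + 2) := by
  have := lie_mem_halfGrade (e_mem t) ha
  rwa [show 2 + i = i + 2 by ring] at this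

theorem lie_x_mem_centr (t : IsSl2Triple ((2 : F) • x) e f) {a : g} (ha : a ∈ centr (F := F) f) :
    ⁅x, a⁆ ∈ centr (F := F) f := by
  rw [mem_centr] at *
  rw [leibniz_lie, ha, lie_zero, add_zero, lie_f_x t, ha]

theorem lieE_le_gradeLE (t : IsSl2Triple ((2 : F) • x) e f) : lieE (F := F) x e ≤ gradeLE x 1 := by
  rw [lieE, Submodule.map_le_iff_le_comap]
  exact iSup₂_le fun i hi a ha => halfGrade_le_gradeLE (i := i + 2) (by omega) (lie_e_mem t ha)

variable [FiniteDimensional F g]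

theorem eq_zero_of_lie_f_lie_e (t : IsSl2Triple ((2 : F) • x) e f) {i : ℤ} (hi : i < 0) {a : g}
    (ha : a ∈ halfGrade (F := F) x i) (h : ⁅f, ⁅e, a⁆⁆ = 0) : a = 0 :=
  (endSl2_ad t).eq_zero_of_f_e hi (mem_halfGrade_iff_ad.1 ha) h

theorem eq_zero_of_lie_e_lie_f (t : IsSl2Triple ((2 : F) • x) e f) {i : ℤ} (hi : 0 < i) {a : g}
    (ha : a ∈ halfGrade (F := F) x i) (h : ⁅e, ⁅f, a⁆⁆ = 0) : a = 0 :=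
  (endSl2_ad t).eq_zero_of_e_f hi (mem_halfGrade_iff_ad.1 ha) h

theorem eq_zero_of_lie_f (t : IsSl2Triple ((2 : F) • x) e f) {i : ℤ} (hi : 0 < i) {a : g}
    (ha : a ∈ halfGrade (F := F) x i) (h : ⁅f, a⁆ = 0) : a = 0 :=
  eq_zero_of_lie_e_lie_f t hi ha (by rw [h, lie_zero])

theorem centr_inf_halfGrade (t : IsSl2Triple ((2 : F) • x) e f) {i : ℤ} (hi : 0 < i) :
    centr (F := F) f ⊓ halfGrade x i = ⊥ :=
  eq_bot_iff.2 fun _ ha => eq_zero_of_lie_f t hi ha.2 (mem_centr.1 ha.1)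

variable [IsAlgClosed F]

theorem iSup_halfGrade (t : IsSl2Triple ((2 : F) • x) e f) :
    ⨆ i, halfGrade (F := F) x i = ⊤ := by
  simp only [halfGrade_eq_ad]
  exact (endSl2_ad t).iSup_eigenspace_eq_top

/-- A subspace stable under the diagonalisable `ad x` is the sum of its homogeneous parts, so
inclusions between subspaces can be tested degree by degree. -/
theorem le_of_forall_inf_halfGrade_le (t : IsSl2Triple ((2 : F) • x) e f) {p q : Submodule F g}
    (hp : ∀ a ∈ p, ⁅x, a⁆ ∈ p) (h : ∀ i, p ⊓ halfGrade x i ≤ q) : p ≤ q := by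
  have htop : ⨆ μ, (LieAlgebra.ad F g x).genEigenspace μ 1 = ⊤ := by
    rw [eq_top_iff, ← iSup_halfGrade t]
    exact iSup_le fun i => le_iSup (fun μ => (LieAlgebra.ad F g x).genEigenspace μ 1) ((i : F) / 2)
  rw [Submodule.eq_iSup_inf_genEigenspace (f := LieAlgebra.ad F g x) 1 hp htop]
  refine iSup_le fun μ => ?_
  by_cases hμ : ∃ i : ℤ, (i : F) / 2 = μ
  · obtain ⟨i, rfl⟩ := hμ
    exact h i
  -- Eigenvalues outside `½ℤ` do not occur: their eigenspaces are independent of the `g_{i/2}`,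
  -- which already span `g`.
  · have hd := (Module.End.eigenspaces_iSupIndep (LieAlgebra.ad F g x)).disjoint_biSup
      (x := μ) (y := Set.range fun i : ℤ => (i : F) / 2) hμ
    rw [iSup_range] at hd
    have : (⨆ i : ℤ, (LieAlgebra.ad F g x).eigenspace ((i : F) / 2)) = ⊤ := iSup_halfGrade t
    rw [this, disjoint_top] at hd
    refine inf_le_right.trans ?_
    exact hd.le.trans bot_le

theorem gradeLE_sup_gradeGE (t : IsSl2Triple ((2 : F) • x) e f) (i : ℤ) :
    gradeLE (F := F) x i ⊔ gradeGE x (i + 1) = ⊤ := by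
  rw [eq_top_iff, ← iSup_halfGrade t]
  refine iSup_le fun j => ?_
  rcases le_or_gt j i with h | h
  · exact (halfGrade_le_gradeLE h).trans le_sup_left
  · exact (halfGrade_le_gradeGE (by omega)).trans le_sup_right

theorem isCompl_gradeLE_gradeGE (t : IsSl2Triple ((2 : F) • x) e f) (i : ℤ) :
    IsCompl (gradeLE (F := F) x i) (gradeGE x (i + 1)) := by
  refine ⟨?_, codisjoint_iff.2 (gradeLE_sup_gradeGE t i)⟩
  rw [disjoint_iff_inf_le]
  refine le_of_forall_inf_halfGrade_le t
    (fun a ha => ⟨lie_mem_gradeLE ha.1, lie_mem_gradeGE ha.2⟩) fun j => ?_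
  rintro a ⟨⟨h1, h2⟩, h3⟩
  rcases le_or_gt j i with h | h
  · exact (disjoint_halfGrade_gradeGE (by omega)).le_bot ⟨h3, h2⟩
  · exact (disjoint_halfGrade_gradeLE (by omega)).le_bot ⟨h3, h1⟩

theorem centr_le_gradeLE (t : IsSl2Triple ((2 : F) • x) e f) :
    centr (F := F) f ≤ gradeLE x 0 := by
  refine le_of_forall_inf_halfGrade_le t (fun a ha => lie_x_mem_centr t ha) fun i => ?_
  rcases le_or_gt i 0 with h | h
  · exact inf_le_right.trans (halfGrade_le_gradeLE h)
  · rw [centr_inf_halfGrade t h]; exact bot_le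

/-- An element `[e,w]` of `g^f` satisfies `[f,[e,w]] = 0`, and `ad f ∘ ad e` is injective in
negative degrees. The subspace of such `w` is `ad x`-stable, so homogeneous `w` suffice. -/
theorem disjoint_centr_lieE (t : IsSl2Triple ((2 : F) • x) e f) :
    Disjoint (centr (F := F) f) (lieE x e) := by
  rw [Submodule.disjoint_def]
  rintro _ hv ⟨w, hw, rfl⟩
  rw [mem_centr] at hv
  have key : gradeLE (F := F) x (-1) ⊓
      LinearMap.ker (LieAlgebra.ad F g f ∘ₗ LieAlgebra.ad F g e) ≤ ⊥ := by
    refine le_of_forall_inf_halfGrade_le t (fun a ha => ⟨lie_mem_gradeLE ha.1, ?_⟩) fun i => ?_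
    · have h : ⁅f, ⁅e, a⁆⁆ = 0 := ha.2
      change ⁅f, ⁅e, ⁅x, a⁆⁆⁆ = 0
      have h1 : ⁅e, ⁅x, a⁆⁆ = ⁅x, ⁅e, a⁆⁆ - ⁅e, a⁆ := by
        rw [leibniz_lie x, lie_x_e t]; abel
      rw [h1, lie_sub, h, sub_zero, leibniz_lie, h, lie_zero, add_zero, lie_f_x t, h]
    · rintro a ⟨⟨h1, h2⟩, h3⟩
      rcases le_or_gt i (-1) with hi | hi
      · exact eq_zero_of_lie_f_lie_e t (by omega) h3 h2
      · exact (disjoint_halfGrade_gradeLE hi).le_bot ⟨h3, h1⟩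
  rw [(Submodule.mem_bot F).1 (key ⟨hw, hv⟩), map_zero]

theorem centr_sup_lieE (t : IsSl2Triple ((2 : F) • x) e f) :
    centr (F := F) f ⊔ lieE x e = gradeLE x 1 := by
  refine le_antisymm (sup_le ((centr_le_gradeLE t).trans (gradeLE_mono (by norm_num)))
    (lieE_le_gradeLE t)) ?_
  refine iSup₂_le fun i hi a ha => ?_
  have hfa := lie_f_mem t ha
  have hmaps : ∀ b ∈ halfGrade (F := F) x (i - 2),
      (LieAlgebra.ad F g f ∘ₗ LieAlgebra.ad F g e) b ∈ halfGrade (F := F) x (i - 2) := by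
    intro b hb
    have := lie_f_mem t (lie_e_mem t hb)
    rwa [show i - 2 + 2 - 2 = i - 2 by ring] at this
  -- For `i ≤ 1` the index `i - 2` is negative, so `ad f ∘ ad e` is injective on that piece and by
  -- finite dimension surjective. Solving `[f,[e,w]] = [f,a]` splits `a` as `(a - [e,w]) + [e,w]`.
  let T := (LieAlgebra.ad F g f ∘ₗ LieAlgebra.ad F g e).restrict hmaps
  have hinj : Function.Injective T := by
    rw [injective_iff_map_eq_zero]
    intro b hb
    exact Subtype.ext (eq_zero_of_lie_f_lie_e t (by omega) b.2 (congrArg Subtype.val hb))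
  obtain ⟨w, hw⟩ := LinearMap.injective_iff_surjective.1 hinj ⟨_, hfa⟩
  have hw' : ⁅f, ⁅e, (w : g)⁆⁆ = ⁅f, a⁆ := congrArg Subtype.val hw
  rw [← sub_add_cancel a ⁅e, (w : g)⁆]
  refine Submodule.add_mem_sup ?_ ⟨w, halfGrade_le_gradeLE (by omega) w.2, rfl⟩
  rw [mem_centr, lie_sub, hw', sub_self]

end Triple

/-! ### Non-degenerate pairing of opposite degrees -/

section Pairing

variable {F : Type*} [Field F] [IsAlgClosed F] [CharZero F] {g : Type*} [LieRing g]
  [LieAlgebra F g] [FiniteDimensional F g] {x e f : g} {B : LinearMap.BilinForm F g}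

theorem exists_form_ne_zero (t : IsSl2Triple ((2 : F) • x) e f) (hB : B.Nondegenerate)
    (hinv : B.lieInvariant g) {i : ℤ} {a : g} (ha : a ∈ halfGrade (F := F) x i) (ha0 : a ≠ 0) :
    ∃ b ∈ halfGrade (F := F) x (-i), B a b ≠ 0 := by
  by_contra! hcon
  refine ha0 (hB.1 a fun y => ?_)
  have : (⊤ : Submodule F g) ≤ LinearMap.ker (B a) := by
    rw [← iSup_halfGrade t]
    refine iSup_le fun j y hy => ?_
    by_cases hj : j = -i
    · subst hj; exact hcon y hy
    · exact form_eq_zero hinv ha hy (by omega)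
  exact this (Submodule.mem_top (x := y))

theorem eq_zero_of_forall_form (t : IsSl2Triple ((2 : F) • x) e f) (hB : B.Nondegenerate)
    (hinv : B.lieInvariant g) {i : ℤ} {a : g} (ha : a ∈ halfGrade (F := F) x i)
    (h : ∀ b ∈ halfGrade (F := F) x (-i), B a b = 0) : a = 0 := by
  by_contra h0
  obtain ⟨b, hb, hne⟩ := exists_form_ne_zero t hB hinv ha h0
  exact hne (h b hb)

theorem halfGrade_neg_eq_bot (t : IsSl2Triple ((2 : F) • x) e f) (hB : B.Nondegenerate)
    (hinv : B.lieInvariant g) {i : ℤ} (h : halfGrade (F := F) x i = ⊥) :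
    halfGrade (F := F) x (-i) = ⊥ := by
  refine eq_bot_iff.2 fun a ha => eq_zero_of_forall_form t hB hinv ha fun b hb => ?_
  rw [neg_neg, h] at hb
  rw [(Submodule.mem_bot F).1 hb, map_zero]

end Pairing

/-! ### Structure of the grading for a minimal nilpotent element -/

section Minimal

/-- The height functional, equal to `1` on each element of `s`, counts summands. It is a natural
number on both `y` and `-y`, hence zero. -/
theorem eq_zero_of_mem_closure_of_neg_mem {F V : Type*} [Field F] [CharZero F] [AddCommGroup V]
    [Module F V] {s : Set V} (hs : LinearIndepOn F id s) {y : V}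
    (h1 : y ∈ AddSubmonoid.closure s) (h2 : -y ∈ AddSubmonoid.closure s) : y = 0 := by
  let φ : V →ₗ[F] F := (Module.Basis.extend hs).constr F fun _ => 1
  have hφ : ∀ v ∈ s, φ v = 1 := by
    intro v hv
    have hv' := hs.subset_extend (Set.subset_univ s) hv
    have h := (Module.Basis.extend hs).constr_basis F (fun _ => (1 : F)) ⟨v, hv'⟩
    rwa [Module.Basis.extend_apply_self] at h
  have key : ∀ v ∈ AddSubmonoid.closure s, ∃ n : ℕ, φ v = n ∧ (n = 0 → v = 0) := by
    intro v hv
    induction hv using AddSubmonoid.closure_induction with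
    | mem v hv => exact ⟨1, by simp [hφ v hv], by simp⟩
    | zero => exact ⟨0, by simp, by simp⟩
    | add a b _ _ ha hb =>
      obtain ⟨n, hn, hn'⟩ := ha
      obtain ⟨m, hm, hm'⟩ := hb
      refine ⟨n + m, by simp [hn, hm], fun h => ?_⟩
      rw [hn' (by omega), hm' (by omega), add_zero]
  obtain ⟨n, hn, hn'⟩ := key _ h1
  obtain ⟨m, hm, -⟩ := key _ h2
  rw [map_neg, hn] at hm
  have : ((n + m : ℕ) : F) = 0 := by push_cast; rw [← hm]; ring
  rw [Nat.cast_eq_zero] at this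
  exact hn' (by omega)

variable {F : Type*} [Field F] [IsAlgClosed F] [CharZero F] {g : Type*} [LieRing g]
  [LieAlgebra F g] [FiniteDimensional F g] [LieAlgebra.IsSimple F g]

/-- A minimal nilpotent element `f` satisfies `[f, [f, g]] ⊆ F f`. -/
theorem IsMinimalNilpotent.lie_lie_mem_span {f : g} (hf : IsMinimalNilpotent F f) (a : g) :
    ⁅f, ⁅f, a⁆⁆ ∈ Submodule.span F {f} := by
  obtain ⟨H, _, b, θ, hθ, hfθ, hf0⟩ := hf
  let R := LieAlgebra.IsKilling.rootSystem H
  let Q := AddSubmonoid.closure (R.root '' b.support)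
  have hQ : ∀ y, y ∈ Q → -y ∈ Q → y = 0 := fun y =>
    eq_zero_of_mem_closure_of_neg_mem (F := F) b.linearIndepOn_root.id_image
  have hnz : (θ : LieModule.Weight F H g).IsNonZero := (Finset.mem_filter.1 θ.2).2
  -- Lowestness of `θ` applied to the root `-β`.
  have hneg : ∀ β : H.root, -R.root β - R.root θ ∈ Q := by
    intro β
    have hβ : (β : LieModule.Weight F H g).IsNonZero := (Finset.mem_filter.1 β.2).2
    exact hθ ⟨-(β : LieModule.Weight F H g), by simpa [LieSubalgebra.root] using hβ⟩
  have hθ2 : (2 : ℕ) • -R.root θ ∈ Q := by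
    have h := hneg θ
    rwa [show -R.root θ - R.root θ = (2 : ℕ) • -R.root θ by rw [two_nsmul]; abel] at h
  have hθ0 : R.root θ ≠ 0 := R.ne_zero θ
  have hspan : ∀ y ∈ LieAlgebra.rootSpace H (θ : LieModule.Weight F H g), y ∈ Submodule.span F {f} := by
    intro y hy
    obtain ⟨c, hc⟩ := (finrank_eq_one_iff_of_nonzero' (⟨f, hfθ⟩ :
      LieAlgebra.rootSpace H (θ : LieModule.Weight F H g)) (by simpa using hf0)).1
      (LieAlgebra.IsKilling.finrank_rootSpace_eq_one _ hnz) ⟨y, hy⟩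
    exact Submodule.mem_span_singleton.2 ⟨c, congrArg Subtype.val hc⟩
  have htop : (⨆ χ : LieModule.Weight F H g, (LieModule.genWeightSpace g χ).toSubmodule) = ⊤ := by
    rw [← LieSubmodule.iSup_toSubmodule, LieModule.iSup_genWeightSpace_eq_top' F H g,
      LieSubmodule.top_toSubmodule]
  have ha : a ∈ ⨆ χ : LieModule.Weight F H g, (LieModule.genWeightSpace g χ).toSubmodule := by
    rw [htop]; trivial
  refine (iSup_le fun β y hy => ?_ : _ ≤ (Submodule.span F {f}).comap
    (LieAlgebra.ad F g f ∘ₗ LieAlgebra.ad F g f)) ha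
  change ⁅f, ⁅f, y⁆⁆ ∈ Submodule.span F {f}
  have h1 := LieAlgebra.lie_mem_genWeightSpace_of_mem_genWeightSpace hfθ hy
  have h2 := LieAlgebra.lie_mem_genWeightSpace_of_mem_genWeightSpace hfθ h1
  by_cases h0 : ⁅f, ⁅f, y⁆⁆ = 0
  · rw [h0]; exact zero_mem _
  have hne : LieModule.genWeightSpace g
      (((θ : LieModule.Weight F H g) : H → F) +
        (((θ : LieModule.Weight F H g) : H → F) + (β : H → F))) ≠ ⊥ := by
    intro hbot
    rw [hbot] at h2
    exact h0 ((LieSubmodule.mem_bot _).1 h2)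
  let γ : LieModule.Weight F H g := ⟨_, hne⟩
  have hβ : ∀ χ : LieModule.Weight F H g, (χ : H → F) ≠ 0 → ∃ χ' : H.root, (R.root χ' : H → F) = χ := by
    intro χ hχ
    refine ⟨⟨χ, ?_⟩, rfl⟩
    exact Finset.mem_filter.2 ⟨Finset.mem_univ _, hχ⟩
  have hθc : ((R.root θ : Module.Dual F H) : H → F) = (θ : LieModule.Weight F H g) := rfl
  -- For `β = 0` the vector `[f,y]` lies in the line `g_θ = F f`, so a second bracket with `f`
  -- vanishes.
  by_cases hβ0 : (β : H → F) = 0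
  · have hy' := hspan _ (by rw [hβ0, add_zero] at h1; exact h1)
    obtain ⟨c, hc⟩ := Submodule.mem_span_singleton.1 hy'
    rw [← hc, lie_smul, lie_self, smul_zero]
    exact zero_mem _
  obtain ⟨β', hβ'⟩ := hβ β hβ0
  -- If `2θ + β = 0`, then `-β - θ = θ` is a sum of simple roots. So is `-2θ`, which forces `θ = 0`.
  by_cases hγ0 : (γ : H → F) = 0
  · exfalso
    have hsum : R.root θ + (R.root θ + R.root β') = 0 := by
      ext t
      have := congrFun hγ0 t
      have h3 := congrFun hβ' t
      have h4 := congrFun hθc t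
      simp only [LinearMap.add_apply, LinearMap.zero_apply, h3, h4]
      exact this
    have h5 : R.root θ ∈ Q := by
      have h := hneg β'
      rwa [show -R.root β' - R.root θ = R.root θ by
        rw [← sub_eq_zero, ← neg_eq_zero, ← hsum]; abel] at h
    have h6 := hQ ((2 : ℕ) • R.root θ) (AddSubmonoid.nsmul_mem _ h5 2) (by
      rwa [show -((2 : ℕ) • R.root θ) = (2 : ℕ) • -R.root θ by rw [two_nsmul, two_nsmul]; abel])
    rw [two_nsmul, ← two_smul F] at h6
    exact hθ0 ((smul_eq_zero.1 h6).resolve_left two_ne_zero)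
  · obtain ⟨γ', hγ'⟩ := hβ γ hγ0
    have hsum : R.root γ' = R.root θ + (R.root θ + R.root β') := by
      ext t
      have h2 := congrFun hγ' t
      have h3 := congrFun hβ' t
      have h4 := congrFun hθc t
      simp only [LinearMap.add_apply, h2, h3, h4]
      rfl
    -- Now `γ = 2θ + β` is a root. Lowestness puts `γ - θ = θ + β` and `-β - θ` both in `Q`, so `β =
    -- -θ` and `γ = θ`.
    have h7 : R.root θ + R.root β' ∈ Q := by
      have h := hθ γ'
      rwa [show (LieAlgebra.IsKilling.rootSystem H).root γ' - R.root θ = R.root θ + R.root β' by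
        rw [show (LieAlgebra.IsKilling.rootSystem H).root γ' = _ from hsum]; abel] at h
    have h8 := hQ _ h7 (by
      have h := hneg β'
      rwa [show -R.root β' - R.root θ = -(R.root θ + R.root β') by abel] at h)
    apply hspan
    have h9 : ((θ : LieModule.Weight F H g) : H → F) +
        (((θ : LieModule.Weight F H g) : H → F) + (β : H → F)) =
        (θ : LieModule.Weight F H g) := by
      funext t
      have h3 := congrFun hβ' t
      have h4 := congrFun hθc t
      have h5 := LinearMap.congr_fun h8 t
      rw [LinearMap.add_apply, h3, h4, LinearMap.zero_apply] at h5
      simp only [Pi.add_apply, h5, add_zero]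
    rw [h9] at h2
    exact h2

variable {x e f : g} {B : LinearMap.BilinForm F g}

/-- In index `i > 2` the vector `[f,[f,a]]` has index `i - 4 ≠ -2` but lies in `F f`, so it
vanishes. Both applications of `ad f` start from positive degrees, where it is injective. -/
theorem IsMinimalNilpotent.halfGrade_eq_bot (hf : IsMinimalNilpotent F f)
    (t : IsSl2Triple ((2 : F) • x) e f) {i : ℤ} (hi : 2 < i) : halfGrade (F := F) x i = ⊥ := by
  refine eq_bot_iff.2 fun a ha => ?_
  refine eq_zero_of_lie_f t (by omega) ha ?_
  refine eq_zero_of_lie_f t (by omega) (lie_f_mem t ha) ?_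
  have h1 := hf.lie_lie_mem_span a
  have h2 : Submodule.span F {f} ≤ halfGrade (F := F) x (-2) := by
    rw [Submodule.span_singleton_le_iff_mem]; exact f_mem t
  exact (disjoint_halfGrade (F := F) (x := x) (i := i - 2 - 2) (j := -2) (by omega)).le_bot
    ⟨lie_f_mem t (lie_f_mem t ha), h2 h1⟩

theorem IsMinimalNilpotent.halfGrade_two (hf : IsMinimalNilpotent F f)
    (t : IsSl2Triple ((2 : F) • x) e f) : halfGrade (F := F) x 2 = Submodule.span F {e} := by
  refine le_antisymm (fun a ha => ?_) (by
    rw [Submodule.span_singleton_le_iff_mem]; exact e_mem t)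
  obtain ⟨c, hc⟩ := Submodule.mem_span_singleton.1 (hf.lie_lie_mem_span a)
  have hfe : ⁅f, ⁅f, e⁆⁆ = -(2 : F) • f := by
    rw [← lie_skew f e, t.lie_e_f, lie_neg, lie_smul, lie_f_x t, neg_smul]
  -- Since `[f,[f,e]] = -2f`, adding `(c/2) e` cancels `[f,[f,a]] = c f`. The square of `ad f` is
  -- injective on `g_1`, so the corrected vector is zero.
  set a' := a + (c / 2) • e with ha'
  have hmem : a' ∈ halfGrade (F := F) x 2 := add_mem ha (Submodule.smul_mem _ _ (e_mem t))
  have h0 : ⁅f, ⁅f, a'⁆⁆ = 0 := by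
    rw [ha', lie_add, lie_add, lie_smul, lie_smul, hfe, ← hc]
    module
  have h1 : a' = 0 :=
    (endSl2_ad t).eq_zero_of_f_f (by simpa using mem_halfGrade_iff_ad.1 hmem) h0
  refine Submodule.mem_span_singleton.2 ⟨-(c / 2), ?_⟩
  rw [ha', add_eq_zero_iff_eq_neg] at h1
  rw [h1, neg_smul]

theorem form_f_e_ne_zero (hf : IsMinimalNilpotent F f) (t : IsSl2Triple ((2 : F) • x) e f)
    (hB : B.Nondegenerate) (hinv : B.lieInvariant g) : B f e ≠ 0 := by
  obtain ⟨b, hb, hne⟩ := exists_form_ne_zero t hB hinv (f_mem t) t.f_ne_zero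
  rw [neg_neg, hf.halfGrade_two t] at hb
  obtain ⟨c, rfl⟩ := Submodule.mem_span_singleton.1 hb
  intro h
  exact hne (by rw [map_smul, h, smul_zero])

theorem IsMinimalNilpotent.halfGrade_neg_two (hf : IsMinimalNilpotent F f)
    (t : IsSl2Triple ((2 : F) • x) e f) (hB : B.Nondegenerate) (hinv : B.lieInvariant g) :
    halfGrade (F := F) x (-2) = Submodule.span F {f} := by
  refine le_antisymm (fun u hu => ?_) (by
    rw [Submodule.span_singleton_le_iff_mem]; exact f_mem t)
  have hne := form_f_e_ne_zero hf t hB hinv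
  have h0 : u - (B u e / B f e) • f = 0 := by
    refine eq_zero_of_forall_form t hB hinv
      (sub_mem hu (Submodule.smul_mem _ _ (f_mem t))) fun b hb => ?_
    rw [neg_neg, hf.halfGrade_two t] at hb
    obtain ⟨c, rfl⟩ := Submodule.mem_span_singleton.1 hb
    rw [map_smul, map_sub, LinearMap.sub_apply, map_smul, LinearMap.smul_apply, smul_eq_mul,
      smul_eq_mul, div_mul_cancel₀ _ hne, sub_self, mul_zero]
  rw [sub_eq_zero.1 h0]
  exact Submodule.smul_mem _ _ (Submodule.mem_span_singleton_self f)

theorem IsMinimalNilpotent.gradeGE_one_le (hf : IsMinimalNilpotent F f)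
    (t : IsSl2Triple ((2 : F) • x) e f) :
    gradeGE (F := F) x 1 ≤ halfGrade x 1 ⊔ Submodule.span F {e} := by
  refine iSup₂_le fun i hi => ?_
  rcases lt_or_ge 2 i with h | h
  · rw [hf.halfGrade_eq_bot t h]; exact bot_le
  · obtain rfl | rfl : i = 1 ∨ i = 2 := by omega
    · exact le_sup_left
    · rw [hf.halfGrade_two t]; exact le_sup_right

theorem IsMinimalNilpotent.centr_eq (hf : IsMinimalNilpotent F f)
    (t : IsSl2Triple ((2 : F) • x) e f) (hB : B.Nondegenerate) (hinv : B.lieInvariant g) :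
    centr (F := F) f = (halfGrade x 0 ⊓ centr f) ⊔ halfGrade x (-1) ⊔ Submodule.span F {f} := by
  have hbot : ∀ i : ℤ, i < -2 → halfGrade (F := F) x i = ⊥ := by
    intro i hi
    have := halfGrade_neg_eq_bot t hB hinv (hf.halfGrade_eq_bot t (i := -i) (by omega))
    rwa [neg_neg] at this
  refine le_antisymm ?_ (sup_le (sup_le inf_le_right fun u hu => ?_) ?_)
  · refine le_of_forall_inf_halfGrade_le t (fun a ha => lie_x_mem_centr t ha) fun i => ?_
    rcases lt_or_ge 0 i with h | h
    · rw [centr_inf_halfGrade t h]; exact bot_le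
    rcases lt_or_ge i (-2) with h' | h'
    · rw [hbot i h', inf_bot_eq]; exact bot_le
    obtain rfl | rfl | rfl : i = 0 ∨ i = -1 ∨ i = -2 := by omega
    · rw [inf_comm, sup_assoc]; exact le_sup_left
    · exact inf_le_right.trans (le_sup_right.trans le_sup_left)
    · rw [hf.halfGrade_neg_two t hB hinv]; exact inf_le_right.trans le_sup_right
  · rw [mem_centr]
    have := lie_f_mem t hu
    rw [hbot _ (by norm_num)] at this
    exact (Submodule.mem_bot F).1 this
  · rw [Submodule.span_singleton_le_iff_mem, mem_centr, lie_self]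

end Minimal

/-! ### Structure of the grading for a short nilpotent element -/

section Short

variable {F : Type*} [Field F] [CharZero F] {g : Type*} [LieRing g] [LieAlgebra F g] {x e f : g}

theorem IsShortNilpotent.halfGrade_eq_bot (hs : IsShortNilpotent F x) {i : ℤ} (h0 : i ≠ 0)
    (h2 : i ≠ 2) (h3 : i ≠ -2) : halfGrade (F := F) x i = ⊥ := by
  have hd := (iSupIndep_halfGrade (F := F) x).disjoint_biSup (x := i)
    (y := {j | j = 0 ∨ j = 2 ∨ j = -2}) (by simp [h0, h2, h3])
  rw [← disjoint_top, ← show _ = ⊤ from hs]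
  refine hd.mono_right (sup_le (sup_le ?_ ?_) ?_)
  · exact le_iSup₂_of_le (-2) (by simp) le_rfl
  · exact le_iSup₂_of_le 0 (by simp) le_rfl
  · exact le_iSup₂_of_le 2 (by simp) le_rfl

theorem IsShortNilpotent.gradeGE_one_le (hs : IsShortNilpotent F x) :
    gradeGE (F := F) x 1 ≤ halfGrade x 2 := by
  refine iSup₂_le fun i hi => ?_
  by_cases h : i = 2
  · rw [h]
  · rw [hs.halfGrade_eq_bot (by omega) h (by omega)]; exact bot_le

theorem IsShortNilpotent.halfGrade_neg_two_le_centr (hs : IsShortNilpotent F x)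
    (t : IsSl2Triple ((2 : F) • x) e f) : halfGrade (F := F) x (-2) ≤ centr f := by
  intro u hu
  rw [mem_centr]
  have := lie_f_mem t hu
  rw [hs.halfGrade_eq_bot (by norm_num) (by norm_num) (by norm_num)] at this
  exact (Submodule.mem_bot F).1 this

theorem IsShortNilpotent.centr_eq [IsAlgClosed F] [FiniteDimensional F g]
    (hs : IsShortNilpotent F x) (t : IsSl2Triple ((2 : F) • x) e f) :
    centr (F := F) f = (halfGrade x 0 ⊓ centr f) ⊔ halfGrade x (-2) := by
  refine le_antisymm ?_ (sup_le inf_le_right (hs.halfGrade_neg_two_le_centr t))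
  refine le_of_forall_inf_halfGrade_le t (fun a ha => lie_x_mem_centr t ha) fun i => ?_
  by_cases h : i = 0
  · rw [h, inf_comm]; exact le_sup_left
  by_cases h' : i = -2
  · rw [h']; exact inf_le_right.trans le_sup_right
  by_cases h'' : i = 2
  · rw [centr_inf_halfGrade t (by omega)]; exact bot_le
  · rw [hs.halfGrade_eq_bot h h'' h', inf_bot_eq]; exact bot_le

end Short

/-! ### Derivations `V(M) → V(M)[λ]` that turn `∂` into `λ + ∂` -/

section LambdaDerivations

variable {F : Type*} [Field F] {M N : Type*} [AddCommGroup M] [Module F M] [AddCommGroup N]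
  [Module F N]

theorem diffPoly_differential_induction {P : DiffPoly F M → Prop}
    (halg : ∀ r : F, P (algebraMap F _ r)) (hgen : ∀ m, P (gen 0 m))
    (hderiv : ∀ a, P a → P (deriv a))
    (hmul : ∀ a b, P a → P b → P (a * b)) (hadd : ∀ a b, P a → P b → P (a + b))
    (p : DiffPoly F M) : P p := by
  refine diffPoly_induction halg (fun n m => ?_) hmul hadd p
  induction n with
  | zero => exact hgen m
  | succ n ih => rw [← deriv_gen]; exact hderiv _ ih

theorem diffLift_gen_zero (φ : M →ₗ[F] DiffPoly F N) (m : M) : diffLift φ (gen 0 m) = φ m := by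
  rw [diffLift_gen, pow_zero, Module.End.one_apply]

theorem lamShift_C (a : DiffPoly F M) : lamShift (F := F) (C a) = X * C a + C (deriv a) := by
  simp [lamShift, ← monomial_zero_left, Polynomial.sum_monomial_index]

theorem lamShift_X_mul (p : (DiffPoly F M)[X]) :
    lamShift (F := F) (X * p) = X * lamShift (F := F) p := by
  induction p using Polynomial.induction_on' with
  | add p q hp hq => simp only [mul_add, map_add, hp, hq]
  | monomial n b => simp [lamShift, X_mul_monomial, Polynomial.sum_monomial_index, mul_add]

/-- The derivation `D : V(M) → V(M)[λ]` with `D ∂ = (λ + ∂) D` extending a linear map on `M`. -/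
def lamDer (d : M →ₗ[F] (DiffPoly F M)[X]) : Derivation F (DiffPoly F M) (DiffPoly F M)[X] :=
  symDer (Finsupp.lsum F fun n => (lamShift ^ n) ∘ₗ d)

theorem lamDer_gen_zero (d : M →ₗ[F] (DiffPoly F M)[X]) (m : M) :
    lamDer d (gen 0 m) = d m := by
  simp [lamDer, gen, symDer_ι]

theorem lamDer_mul (d : M →ₗ[F] (DiffPoly F M)[X]) (p q : DiffPoly F M) :
    lamDer d (p * q) = C p * lamDer d q + C q * lamDer d p := by
  simp only [Derivation.leibniz, Algebra.smul_def, Polynomial.algebraMap_eq]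

theorem lamDer_deriv (d : M →ₗ[F] (DiffPoly F M)[X]) (p : DiffPoly F M) :
    lamDer d (deriv p) = lamShift (lamDer d p) := by
  induction p using diffPoly_induction with
  | halg r => simp
  | hgen n m =>
    rw [deriv_gen]
    simp [lamDer, gen, symDer_ι, pow_succ']
  | hadd p q hp hq => simp only [map_add, hp, hq]
  | hmul p q hp hq =>
    simp only [Derivation.leibniz, smul_eq_mul, map_add, hp, hq, Algebra.smul_def,
      Polynomial.algebraMap_eq, lamShift_C_mul]
    ring

theorem lamDer_add (d d' : M →ₗ[F] (DiffPoly F M)[X]) (p : DiffPoly F M) :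
    lamDer (d + d') p = lamDer d p + lamDer d' p := by
  induction p using diffPoly_differential_induction with
  | halg r => simp
  | hgen m => simp only [lamDer_gen_zero, LinearMap.add_apply]
  | hderiv p hp => simp only [lamDer_deriv, hp, map_add]
  | hadd p q hp hq => simp only [map_add, hp, hq]; abel
  | hmul p q hp hq => simp only [lamDer_mul, hp, hq]; ring

end LambdaDerivations

/-! ### The action of `g_{≥1/2}` on `V(g_{≤1/2})` -/

section Action

variable {F : Type*} [Field F] {g : Type*} [LieRing g] [LieAlgebra F g]

/-- The part of the action of `a` on generators given by the constants `(f|[a,q])`. -/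
def constBase (B : LinearMap.BilinForm F g) (x f a : g) :
    gradeLE (F := F) x 1 →ₗ[F] (DiffPoly F (gradeLE (F := F) x 1))[X] :=
  Algebra.linearMap F _ ∘ₗ B f ∘ₗ LieAlgebra.ad F g a ∘ₗ (gradeLE x 1).subtype

/-- The part of the action of `a` on generators given by `[a,q] + (a|q) λ`. -/
def restBase (B : LinearMap.BilinForm F g) (x a : g) :
    gradeLE (F := F) x 1 →ₗ[F] (DiffPoly F (gradeLE (F := F) x 1))[X] :=
  (CAlgHom (R := F) (A := DiffPoly F (gradeLE (F := F) x 1))).toLinearMap ∘ₗ genLE x ∘ₗ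
      LieAlgebra.ad F g a ∘ₗ (gradeLE x 1).subtype
    + (monomial 1).restrictScalars F ∘ₗ Algebra.linearMap F _ ∘ₗ B a ∘ₗ (gradeLE x 1).subtype

/-- The action of `a ∈ g_{≥1/2}` on `V(g_{≤1/2})`. -/
def actDer (B : LinearMap.BilinForm F g) (x f a : g) :
    Derivation F (DiffPoly F (gradeLE (F := F) x 1)) (DiffPoly F (gradeLE (F := F) x 1))[X] :=
  lamDer (constBase B x f a + restBase B x a)

theorem constBase_apply (B : LinearMap.BilinForm F g) (x f a : g) (q : gradeLE (F := F) x 1) :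
    constBase B x f a q = C (algebraMap F _ (B f ⁅a, (q : g)⁆)) := rfl

theorem restBase_apply (B : LinearMap.BilinForm F g) (x a : g) (q : gradeLE (F := F) x 1) :
    restBase B x a q = C (genLE x ⁅a, (q : g)⁆) + X * C (algebraMap F _ (B a q)) := by
  rw [X_mul_C, ← pow_one (X : (DiffPoly F (gradeLE (F := F) x 1))[X]), C_mul_X_pow_eq_monomial]
  rfl

theorem lie_mem_gradeGE_add {x a b : g} {i j : ℤ} (ha : a ∈ gradeGE (F := F) x i)
    (hb : b ∈ gradeGE (F := F) x j) : ⁅a, b⁆ ∈ gradeGE (F := F) x (i + j) := by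
  have h1 : ∀ k, j ≤ k → ∀ b ∈ halfGrade (F := F) x k, ⁅a, b⁆ ∈ gradeGE (F := F) x (i + j) := by
    intro k hk b hb
    have : gradeGE (F := F) x i ≤
        (gradeGE x (i + j)).comap ((LieAlgebra.ad F g : g →ₗ[F] Module.End F g).flip b) := by
      refine iSup₂_le fun l hl c hc => ?_
      exact halfGrade_le_gradeGE (by omega) (lie_mem_halfGrade hc hb)
    exact this ha
  exact (iSup₂_le h1 : gradeGE (F := F) x j ≤ (gradeGE x (i + j)).comap (LieAlgebra.ad F g a)) hb

variable [CharZero F] {B : LinearMap.BilinForm F g} {x e f s : g}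

theorem form_f_gradeLE (t : IsSl2Triple ((2 : F) • x) e f) (hinv : B.lieInvariant g) {q : g}
    (hq : q ∈ gradeLE (F := F) x 1) : B f q = 0 :=
  form_eq_zero_of_gradeLE hinv (f_mem t) hq (by norm_num)

variable [IsAlgClosed F] [FiniteDimensional F g]

theorem isCompl_gradeLE_one (t : IsSl2Triple ((2 : F) • x) e f) :
    IsCompl (gradeLE (F := F) x 1) (gradeGE x 2) := isCompl_gradeLE_gradeGE t 1

theorem projLE_coe (t : IsSl2Triple ((2 : F) • x) e f) (q : gradeLE (F := F) x 1) :
    projLE x (q : g) = q := by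
  rw [projLE, projOnto, dif_pos (isCompl_gradeLE_one t)]
  exact Submodule.projectionOnto_apply_left _ q

theorem genLE_coe (t : IsSl2Triple ((2 : F) • x) e f) (q : gradeLE (F := F) x 1) :
    genLE x (q : g) = gen 0 q := by
  rw [genLE, LinearMap.comp_apply, projLE_coe t]

theorem genLE_of_mem (t : IsSl2Triple ((2 : F) • x) e f) {q : g} (hq : q ∈ gradeLE (F := F) x 1) :
    genLE x q = gen 0 (⟨q, hq⟩ : gradeLE (F := F) x 1) := genLE_coe t ⟨q, hq⟩

theorem genLE_of_mem_gradeGE (t : IsSl2Triple ((2 : F) • x) e f) {q : g}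
    (hq : q ∈ gradeGE (F := F) x 2) : genLE (F := F) x q = 0 := by
  have : projLE (F := F) x q = 0 := by
    rw [projLE, projOnto, dif_pos (isCompl_gradeLE_one t)]
    exact (Submodule.projectionOnto_apply_eq_zero_iff _).2 hq
  rw [genLE, LinearMap.comp_apply, this, map_zero]

/-- `f` pairs non-trivially only with degree `1`, so the constants `(f|q)` vanish on `g_{≤1/2}`.
This is what makes `P ↦ ρ{a_λ P}` satisfy the Leibniz rule on `V(g_{≤1/2})`. -/
theorem rho_inclHom (t : IsSl2Triple ((2 : F) • x) e f) (hinv : B.lieInvariant g)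
    (P : DiffPoly F (gradeLE (F := F) x 1)) : rho B x f (inclHom x P) = P := by
  induction P using diffPoly_differential_induction with
  | halg r => simp
  | hgen m =>
    rw [inclHom, diffLift_gen_zero, rho]
    simp only [LinearMap.comp_apply, Submodule.subtype_apply, diffLift_gen_zero,
      LinearMap.add_apply, genLE_coe t, form_f_gradeLE t hinv m.2, map_zero, add_zero]
  | hderiv p hp =>
    rw [inclHom, rho] at *
    rw [diffLift_deriv, diffLift_deriv, hp]
  | hadd p q hp hq => rw [map_add, map_add, hp, hq]
  | hmul p q hp hq => rw [map_mul, map_mul, hp, hq]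

/-- By duality no degree below `-d` occurs, so `[a,q]` has degree at least `½ - d` and is orthogonal
to `s` in degree `d`, all degrees being those of `ad x` (half the integer index). -/
theorem form_s_lie (t : IsSl2Triple ((2 : F) • x) e f) (hB : B.Nondegenerate)
    (hinv : B.lieInvariant g) {d : ℤ} (hd : IsGreatest {i : ℤ | halfGrade (F := F) x i ≠ ⊥} d)
    (hs : s ∈ halfGrade (F := F) x d) {a : g} (ha : a ∈ gradeGE (F := F) x 1) (q : g) :
    B s ⁅a, q⁆ = 0 := by
  have hq : q ∈ gradeGE (F := F) x (-d) := by
    have : (⊤ : Submodule F g) ≤ gradeGE x (-d) := by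
      rw [← iSup_halfGrade t]
      refine iSup_le fun j => ?_
      rcases le_or_gt (-d) j with h | h
      · exact halfGrade_le_gradeGE h
      · have hj : halfGrade (F := F) x (-j) = ⊥ := by
          by_contra hne
          have := hd.2 hne
          omega
        have := halfGrade_neg_eq_bot t hB hinv hj
        rw [neg_neg] at this
        rw [this]
        exact bot_le
    exact this Submodule.mem_top
  exact form_eq_zero_of_gradeGE hinv hs (lie_mem_gradeGE_add ha hq) (by omega)

/-- Both sides obey the Leibniz rule and intertwine `∂` with `λ + ∂`, so only generators need
comparison. There the `z`-term vanishes, and `ρ` splits `[a,q]` into its projection and the constant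
`(f|[a,q])`. -/
theorem rhoAct_eq_actDer (t : IsSl2Triple ((2 : F) • x) e f) (hB : B.Nondegenerate)
    (hinv : B.lieInvariant g) {d : ℤ} (hd : IsGreatest {i : ℤ | halfGrade (F := F) x i ≠ ⊥} d)
    (hs : s ∈ halfGrade (F := F) x d) (z : F) {a : g} (ha : a ∈ gradeGE (F := F) x 1)
    (P : DiffPoly F (gradeLE (F := F) x 1)) : rhoAct B x f s z a P = actDer B x f a P := by
  induction P using diffPoly_differential_induction with
  | halg r => simp [rhoAct]
  | hgen m =>
    have h1 : inclHom x (gen 0 m) = (gen 0 (m : g) : DiffPoly F g) := by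
      rw [inclHom, diffLift_gen_zero]; rfl
    rw [rhoAct, h1, lamBracket_gen, pow_zero, Module.End.one_apply, actDer, lamDer_gen_zero,
      LinearMap.add_apply, constBase_apply, restBase_apply]
    simp only [lamBase, LinearMap.add_apply, LinearMap.smul_apply, LinearMap.comp_apply,
      LieAlgebra.ad_apply, form_s_lie t hB hinv hd hs ha, map_zero, smul_zero, add_zero, map_add]
    have h2 : rho B x f (gen 0 ⁅a, (m : g)⁆) =
        genLE x ⁅a, (m : g)⁆ + algebraMap F _ (B f ⁅a, (m : g)⁆) := by
      rw [rho, diffLift_gen_zero]; rfl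
    have h3 : mapAlgHom (rho B x f) ((CAlgHom (R := F) (A := DiffPoly F g)).toLinearMap
        (gen 0 ⁅a, (m : g)⁆)) = C (rho B x f (gen 0 ⁅a, (m : g)⁆)) := by
      simp
    have h4 : mapAlgHom (rho B x f) (((monomial 1).restrictScalars F)
        ((Algebra.linearMap F (DiffPoly F g)) (B a (m : g)))) =
        X * C (algebraMap F _ (B a (m : g))) := by
      simp [X_mul_C, ← C_mul_X_eq_monomial]
    rw [h3, h4, h2, map_add]
    ring
  | hderiv p hp => rw [rhoAct_deriv, hp, actDer, lamDer_deriv]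
  | hadd p q hp hq =>
    rw [map_add, ← hp, ← hq, rhoAct, rhoAct, rhoAct, map_add, map_add, map_add]
  | hmul p q hp hq =>
    rw [actDer, lamDer_mul, ← actDer, ← hp, ← hq]
    simp only [rhoAct, map_mul, Derivation.leibniz, Algebra.smul_def, map_add,
      Polynomial.algebraMap_eq, coe_mapAlgHom, map_C, RingHom.coe_coe, rho_inclHom t hinv]

theorem mem_W_iff (t : IsSl2Triple ((2 : F) • x) e f) (hB : B.Nondegenerate)
    (hinv : B.lieInvariant g) {d : ℤ} (hd : IsGreatest {i : ℤ | halfGrade (F := F) x i ≠ ⊥} d)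
    (hs : s ∈ halfGrade (F := F) x d) (z : F) (P : DiffPoly F (gradeLE (F := F) x 1)) :
    P ∈ W B x f s z ↔ ∀ a ∈ gradeGE (F := F) x 1, actDer B x f a P = 0 := by
  constructor
  · intro h a ha
    rw [← rhoAct_eq_actDer t hB hinv hd hs z ha]
    exact h a ha
  · intro h a ha
    rw [rhoAct_eq_actDer t hB hinv hd hs z ha]
    exact h a ha

theorem actDer_genLE (t : IsSl2Triple ((2 : F) • x) e f) (a : g) {q : g}
    (hq : q ∈ gradeLE (F := F) x 1) : actDer B x f a (genLE x q) =
      C (genLE x ⁅a, q⁆) + X * C (algebraMap F _ (B a q)) + C (algebraMap F _ (B f ⁅a, q⁆)) := by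
  rw [genLE_of_mem t hq, actDer, lamDer_gen_zero, LinearMap.add_apply, constBase_apply,
    restBase_apply, add_comm]

end Action

/-! ### Passing to the component of lowest weight -/

section LowestComponent

variable {F V U V' : Type*} [Field F] [CharZero F] [AddCommGroup V] [Module F V] [AddCommGroup U]
  [Module F U] [AddCommGroup V'] [Module F V']

theorem disjoint_eigenspace_iSup (K : Module.End F U) (i : ℤ) {s : Set ℤ} (hi : i ∉ s) :
    Disjoint (K.eigenspace ((i : F) / 2)) (⨆ j ∈ s, K.eigenspace ((j : F) / 2)) :=
  (K.eigenspaces_iSupIndep.comp (halfCast_injective (F := F))).disjoint_biSup hi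

/-- If the operators `D_a + S_a`, where `D_a` shifts weights by less than `S_a` does, annihilate a
vector, then the `D_a` annihilate its component of lowest weight. -/
theorem exists_lowest_component {H : Module.End F V} (hH : ⨆ i : ℤ, H.eigenspace ((i : F) / 2) = ⊤)
    (K : Module.End F U) (H' : Module.End F V') {π : V →ₗ[F] V'} (hπ : ∀ v, H' (π v) = π (H v))
    {A : Type*} (D S : A → V →ₗ[F] U) (w : A → ℤ)
    (hD : ∀ a v, K (D a v) = D a (H v) + ((w a : F) / 2 - 1) • D a v)
    (hS : ∀ a v, K (S a v) = S a (H v) + ((w a : F) / 2) • S a v)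
    {P : V} (hP : P ≠ 0) (hDS : ∀ a, D a P + S a P = 0) (hπP : π P = 0) :
    ∃ P₀ : V, P₀ ≠ 0 ∧ π P₀ = 0 ∧ ∀ a, D a P₀ = 0 := by
  obtain ⟨c, hc, rfl⟩ := (Submodule.mem_iSup_iff_exists_finsupp
    (fun i : ℤ => H.eigenspace ((i : F) / 2)) P).1 (by rw [hH]; trivial)
  have hne : c.support.Nonempty := by
    rw [Finsupp.support_nonempty_iff]
    rintro rfl
    exact hP Finsupp.sum_zero_index
  set m := c.support.min' hne with hm
  have hmem := c.support.min'_mem hne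
  have hc' : ∀ i, H (c i) = ((i : F) / 2) • c i := fun i => Module.End.mem_eigenspace_iff.1 (hc i)
  have hsum : (c.sum fun _ v => v) = c m + ∑ i ∈ c.support.erase m, c i := by
    rw [Finsupp.sum, Finset.add_sum_erase _ _ hmem]
  have hgt : ∀ i ∈ c.support.erase m, m < i := fun i hi =>
    lt_of_le_of_ne (c.support.min'_le i (Finset.mem_of_mem_erase hi)) (Finset.ne_of_mem_erase hi).symm
  refine ⟨c m, Finsupp.mem_support_iff.1 hmem, ?_, fun a => ?_⟩
  · have h1 : π (c m) ∈ H'.eigenspace ((m : F) / 2) := by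
      rw [Module.End.mem_eigenspace_iff, hπ, hc', map_smul]
    have h2 : π (c m) ∈ ⨆ j ∈ {j : ℤ | m < j}, H'.eigenspace ((j : F) / 2) := by
      rw [hsum, map_add, add_eq_zero_iff_eq_neg] at hπP
      rw [hπP, map_sum]
      refine neg_mem (Submodule.sum_mem _ fun i hi => ?_)
      refine Submodule.mem_iSup_of_mem i (Submodule.mem_iSup_of_mem (hgt i hi) ?_)
      rw [Module.End.mem_eigenspace_iff, hπ, hc', map_smul]
    exact (disjoint_eigenspace_iSup H' m (by simp)).le_bot ⟨h1, h2⟩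
  · have hDe : ∀ i, D a (c i) ∈ K.eigenspace (((i + w a - 2 : ℤ) : F) / 2) := by
      intro i
      rw [Module.End.mem_eigenspace_iff, hD, hc', map_smul, ← add_smul]
      congr 1
      push_cast
      ring
    have hSe : ∀ i, S a (c i) ∈ K.eigenspace (((i + w a : ℤ) : F) / 2) := by
      intro i
      rw [Module.End.mem_eigenspace_iff, hS, hc', map_smul, ← add_smul]
      congr 1
      push_cast
      ring
    -- In `D a P + S a P = 0` the term `D a (c m)` alone has index `m + w a - 2`. Every other term
    -- has a larger one, and independence of the eigenspaces makes it vanish.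
    have h2 : D a (c m) ∈ ⨆ j ∈ {j : ℤ | m + w a - 2 < j}, K.eigenspace ((j : F) / 2) := by
      have h := hDS a
      rw [hsum, map_add, add_assoc, add_eq_zero_iff_eq_neg, ← hsum] at h
      rw [h, Finsupp.sum, map_sum, map_sum]
      refine neg_mem (add_mem (Submodule.sum_mem _ fun i hi => ?_)
        (Submodule.sum_mem _ fun i hi => ?_))
      · refine Submodule.mem_iSup_of_mem _ (Submodule.mem_iSup_of_mem ?_ (hDe i))
        have := hgt i hi
        simp only [Set.mem_ofPred_eq]
        omega
      · refine Submodule.mem_iSup_of_mem _ (Submodule.mem_iSup_of_mem ?_ (hSe i))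
        have := c.support.min'_le i hi
        simp only [Set.mem_ofPred_eq]
        omega
    exact (disjoint_eigenspace_iSup K (m + w a - 2) (by simp)).le_bot ⟨hDe m, h2⟩

end LowestComponent

/-! ### Derivations induced by endomorphisms and by functionals -/

section LinearDerivations

variable {F : Type*} [Field F] {M : Type*} [AddCommGroup M] [Module F M]

theorem toLinearMap_apply (D : Derivation F (DiffPoly F M) (DiffPoly F M)) (p : DiffPoly F M) :
    D.toLinearMap p = D p := rfl

/-- The derivation `∂ⁿ m ↦ ∂ⁿ (T m)` of `V(M)` extending an endomorphism `T` of `M`. -/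
def endDer (T : Module.End F M) : Derivation F (DiffPoly F M) (DiffPoly F M) :=
  symDer (Finsupp.lsum F fun n => gen n ∘ₗ T)

theorem endDer_gen (T : Module.End F M) (n : ℕ) (m : M) :
    endDer T (gen n m) = gen n (T m) := by
  simp [endDer, gen, symDer_ι]

theorem endDer_deriv (T : Module.End F M) (p : DiffPoly F M) :
    endDer T (deriv p) = deriv (endDer T p) := by
  induction p using diffPoly_induction with
  | halg r => simp
  | hgen n m => rw [deriv_gen, endDer_gen, endDer_gen, deriv_gen]
  | hadd p q hp hq => simp only [map_add, hp, hq]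
  | hmul p q hp hq =>
    simp only [Derivation.leibniz, smul_eq_mul, map_add, hp, hq]
    ring

/-- Weights add under multiplication, so the span of the weight vectors is a subalgebra containing
all the generators. -/
theorem iSup_eigenspace_endDer [CharZero F] {T : Module.End F M}
    (hT : ⨆ i : ℤ, T.eigenspace ((i : F) / 2) = ⊤) :
    ⨆ i : ℤ, Module.End.eigenspace (endDer T).toLinearMap ((i : F) / 2) = ⊤ := by
  rw [eq_top_iff]
  rintro p -
  induction p using diffPoly_induction with
  | halg r =>
    refine Submodule.mem_iSup_of_mem 0 (Module.End.mem_eigenspace_iff.2 ?_)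
    simp
  | hgen n m =>
    have : (⊤ : Submodule F M) ≤
        (⨆ i : ℤ, Module.End.eigenspace (endDer T).toLinearMap ((i : F) / 2)).comap (gen n) := by
      rw [← hT]
      refine iSup_le fun i m hm => Submodule.mem_iSup_of_mem i ?_
      rw [Module.End.mem_eigenspace_iff] at *
      rw [toLinearMap_apply, endDer_gen, hm, map_smul]
    exact this (Submodule.mem_top (x := m))
  | hadd p q hp hq => exact add_mem hp hq
  | hmul p q hp hq =>
    induction hp using Submodule.iSup_induction' with
    | zero => simp
    | add a b _ _ ha hb => rw [add_mul]; exact add_mem ha hb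
    | mem i p hp =>
      induction hq using Submodule.iSup_induction' with
      | zero => simp
      | add a b _ _ ha hb => rw [mul_add]; exact add_mem ha hb
      | mem j q hq =>
        refine Submodule.mem_iSup_of_mem (i + j) ?_
        rw [Module.End.mem_eigenspace_iff, toLinearMap_apply] at *
        rw [Derivation.leibniz, hp, hq, smul_eq_mul, smul_eq_mul, mul_smul_comm, mul_smul_comm,
          mul_comm q, ← add_smul]
        congr 1
        push_cast
        ring

/-- The action of a derivation of `V(M)` on the coefficients of elements of `V(M)[λ]`. -/
def coeffMap (H : DiffPoly F M →ₗ[F] DiffPoly F M) : Module.End F (DiffPoly F M)[X] :=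
  Polynomial.lsum fun n => (monomial n).restrictScalars F ∘ₗ H

theorem coeffMap_monomial (H : DiffPoly F M →ₗ[F] DiffPoly F M) (n : ℕ) (a : DiffPoly F M) :
    coeffMap H (monomial n a) = monomial n (H a) := by
  simp [coeffMap, Polynomial.sum_monomial_index]

theorem coeffMap_C (H : DiffPoly F M →ₗ[F] DiffPoly F M) (a : DiffPoly F M) :
    coeffMap H (C a) = C (H a) := by
  rw [← monomial_zero_left, coeffMap_monomial, monomial_zero_left]

theorem coeffMap_X_mul (H : DiffPoly F M →ₗ[F] DiffPoly F M) (p : (DiffPoly F M)[X]) :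
    coeffMap H (X * p) = X * coeffMap H p := by
  induction p using Polynomial.induction_on' with
  | add p q hp hq => simp only [mul_add, map_add, hp, hq]
  | monomial n b => simp only [X_mul_monomial, coeffMap_monomial]

theorem coeffMap_C_mul (H : Derivation F (DiffPoly F M) (DiffPoly F M)) (a : DiffPoly F M)
    (p : (DiffPoly F M)[X]) :
    coeffMap H.toLinearMap (C a * p) = C (H a) * p + C a * coeffMap H.toLinearMap p := by
  induction p using Polynomial.induction_on' with
  | add p q hp hq => simp only [mul_add, map_add, hp, hq]; abel
  | monomial n b =>
    simp only [C_mul_monomial, coeffMap_monomial, toLinearMap_apply,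
      Derivation.leibniz, smul_eq_mul, ← map_add]
    rw [mul_comm b, add_comm]

theorem coeffMap_lamShift {H : Derivation F (DiffPoly F M) (DiffPoly F M)}
    (hH : ∀ p, H (deriv p) = deriv (H p)) (p : (DiffPoly F M)[X]) :
    coeffMap H.toLinearMap (lamShift p) = lamShift (coeffMap H.toLinearMap p) := by
  induction p using Polynomial.induction_on' with
  | add p q hp hq => simp only [map_add, hp, hq]
  | monomial n b =>
    simp only [lamShift, LinearMap.add_apply, LinearMap.mulLeft_apply, X_mul_monomial, map_add,
      coeffMap_monomial, Polynomial.lsum_apply]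
    simp [Polynomial.sum_monomial_index, coeffMap_monomial, hH]

/-- `endDer T` commutes with `∂`, which amounts to giving `∂` and `λ` weight zero. A weight shift of
a λ-derivation can therefore be read off from undifferentiated generators. -/
theorem coeffMap_lamDer (T : Module.End F M) {d : M →ₗ[F] (DiffPoly F M)[X]} {c : F}
    (hd : ∀ m, coeffMap (endDer T).toLinearMap (d m) = d (T m) + c • d m) (p : DiffPoly F M) :
    coeffMap (endDer T).toLinearMap (lamDer d p) = lamDer d (endDer T p) + c • lamDer d p := by
  induction p using diffPoly_differential_induction with
  | halg r => simp
  | hgen m => rw [endDer_gen, lamDer_gen_zero, lamDer_gen_zero, hd]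
  | hderiv p hp =>
    rw [lamDer_deriv, coeffMap_lamShift (endDer_deriv T), hp, endDer_deriv, lamDer_deriv, map_add,
      map_smul]
  | hadd p q hp hq => simp only [map_add, hp, hq, smul_add]; abel
  | hmul p q hp hq =>
    have h : endDer T (p * q) = p * endDer T q + q * endDer T p := Derivation.leibniz _ p q
    simp only [lamDer_mul, h, map_add, coeffMap_C_mul, hp, hq, smul_add, mul_add, mul_smul_comm]
    abel

/-- The `V(M)`-linear map `V(M)[λ] → V(M)`, `λⁿ ↦ ∂ⁿ b`. -/
def substGen (b : M) : (DiffPoly F M)[X] →ₗ[F] DiffPoly F M :=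
  Polynomial.lsum fun n => LinearMap.mulRight F (gen n b)

theorem substGen_C_mul (b : M) (a : DiffPoly F M) (p : (DiffPoly F M)[X]) :
    substGen b (C a * p) = a * substGen b p := by
  induction p using Polynomial.induction_on' with
  | add p q hp hq => simp only [mul_add, map_add, hp, hq]
  | monomial n c => simp [substGen, C_mul_monomial, Polynomial.sum_monomial_index, mul_assoc]

/-- The derivation `∂ⁿ m ↦ λⁿ ξ(m)`. -/
def constDer (ξ : Module.Dual F M) : Derivation F (DiffPoly F M) (DiffPoly F M)[X] :=
  lamDer (Algebra.linearMap F _ ∘ₗ ξ)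

theorem constDer_gen (ξ : Module.Dual F M) (n : ℕ) (m : M) :
    constDer ξ (gen n m) = X ^ n * C (algebraMap F _ (ξ m)) := by
  induction n with
  | zero => rw [constDer, lamDer_gen_zero, pow_zero, one_mul]; rfl
  | succ n ih =>
    have h : ∀ k : ℕ, ∀ r : F, lamShift (F := F) (X ^ k * C (algebraMap F (DiffPoly F M) r)) =
        X ^ (k + 1) * C (algebraMap F (DiffPoly F M) r) := by
      intro k r
      induction k with
      | zero => rw [pow_zero, one_mul, lamShift_C]; simp
      | succ k ih => rw [pow_succ', mul_assoc, lamShift_X_mul, ih]; ring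
    rw [constDer] at *
    rw [← deriv_gen, lamDer_deriv, ih, h]

theorem constDer_mul (ξ : Module.Dual F M) (p q : DiffPoly F M) :
    constDer ξ (p * q) = C p * constDer ξ q + C q * constDer ξ p := lamDer_mul _ p q

theorem constDer_add (ξ η : Module.Dual F M) (p : DiffPoly F M) :
    constDer (ξ + η) p = constDer ξ p + constDer η p := by
  rw [constDer, LinearMap.comp_add, lamDer_add]; rfl

theorem constDer_smul (c : F) (ξ : Module.Dual F M) (p : DiffPoly F M) :
    constDer (c • ξ) p = c • constDer ξ p := by
  induction p using diffPoly_induction with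
  | halg r => simp
  | hgen n m =>
    rw [constDer_gen, constDer_gen, LinearMap.smul_apply, smul_eq_mul, map_mul, map_mul,
      Algebra.smul_def, ← mul_assoc, mul_comm (X ^ n), mul_assoc]
    rfl
  | hadd p q hp hq => simp only [map_add, hp, hq, smul_add]
  | hmul p q hp hq => simp only [constDer_mul, hp, hq, smul_add, mul_smul_comm]

/-- A chain rule: expand `r` in the basis and replace `λⁿ` by `∂ⁿ b_k` in the derivation attached to
the `k`-th coordinate of `r`. Hence, if those constant derivations annihilate `p`, so does `endDer
r`. -/
theorem endDer_eq_sum_substGen {ι : Type*} [Fintype ι] (b : Module.Basis ι F M)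
    (r : Module.End F M) (p : DiffPoly F M) :
    endDer r p = ∑ k, substGen (b k) (constDer (b.coord k ∘ₗ r) p) := by
  induction p using diffPoly_induction with
  | halg r => simp
  | hgen n m =>
    rw [endDer_gen]
    conv_lhs => rw [← b.sum_repr (r m), map_sum]
    refine Finset.sum_congr rfl fun k _ => ?_
    rw [constDer_gen, map_smul, mul_comm, substGen_C_mul, Algebra.smul_def]
    have : substGen (b k) (X ^ n : (DiffPoly F M)[X]) = gen n (b k) := by
      rw [← monomial_one_right_eq_X_pow]
      simp [substGen, Polynomial.sum_monomial_index]
    rw [this]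
    rfl
  | hadd p q hp hq => simp only [map_add, hp, hq, Finset.sum_add_distrib]
  | hmul p q hp hq =>
    have h : endDer r (p * q) = p * endDer r q + q * endDer r p := Derivation.leibniz _ p q
    simp only [h, constDer_mul, map_add, substGen_C_mul, Finset.sum_add_distrib, ← Finset.mul_sum,
      ← hp, ← hq]

/-- An element of `V(M)` killed by the derivation extending an idempotent `r` lies in
`V(ker r)`. -/
theorem eq_diffLift_of_endDer_eq_zero [CharZero F] {r : Module.End F M} (hr : ∀ m, r (r m) = r m)
    {p : DiffPoly F M} (hp : endDer r p = 0) :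
    p = SymmetricAlgebra.lift (Finsupp.lsum F fun n => gen n ∘ₗ (LinearMap.id - r)) p := by
  have : IsAddTorsionFree (DiffPoly F M) := IsAddTorsionFree.of_isTorsionFree F _
  -- `γ` rescales the image of `r` by the variable and fixes the kernel: at `1` it is the identity,
  -- at `0` the projection to `V(ker r)`.
  let γ : DiffPoly F M →ₐ[F] (DiffPoly F M)[X] := SymmetricAlgebra.lift
    (Finsupp.lsum F fun n => (CAlgHom (R := F) (A := DiffPoly F M)).toLinearMap ∘ₗ gen n ∘ₗ
        (LinearMap.id - r)
      + LinearMap.mulLeft F X ∘ₗ (CAlgHom (R := F) (A := DiffPoly F M)).toLinearMap ∘ₗ gen n ∘ₗ r)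
  have hγ : ∀ n m, γ (gen n m) = C (gen n (m - r m)) + X * C (gen n (r m)) := by
    intro n m
    simp [γ, gen]
  have h1 : ∀ q, (γ q).eval 1 = q := by
    intro q
    induction q using diffPoly_induction with
    | halg c => simp [IsScalarTower.algebraMap_apply F (DiffPoly F M) (DiffPoly F M)[X]]
    | hgen n m => rw [hγ]; simp
    | hadd a b ha hb => rw [map_add, eval_add, ha, hb]
    | hmul a b ha hb => rw [map_mul, eval_mul, ha, hb]
  have h0 : ∀ q, (γ q).eval 0 =
      SymmetricAlgebra.lift (Finsupp.lsum F fun n => gen n ∘ₗ (LinearMap.id - r)) q := by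
    intro q
    induction q using diffPoly_induction with
    | halg c => simp [IsScalarTower.algebraMap_apply F (DiffPoly F M) (DiffPoly F M)[X]]
    | hgen n m => rw [hγ]; simp [gen]
    | hadd a b ha hb => rw [map_add, eval_add, ha, hb, map_add]
    | hmul a b ha hb => rw [map_mul, eval_mul, ha, hb, map_mul]
  -- The Euler operator in the scaling variable corresponds to `endDer r`. If the latter kills `p`,
  -- then `γ p` is constant in characteristic zero, and its values at `0` and `1` agree.
  have hd : ∀ q, X * derivative (γ q) = γ (endDer r q) := by
    intro q
    induction q using diffPoly_induction with
    | halg c => simp [IsScalarTower.algebraMap_apply F (DiffPoly F M) (DiffPoly F M)[X]]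
    | hgen n m => rw [endDer_gen, hγ, hγ, hr]; simp
    | hadd a b ha hb => rw [map_add, derivative_add, mul_add, ha, hb, map_add, map_add]
    | hmul a b ha hb =>
      rw [map_mul, derivative_mul, Derivation.leibniz, smul_eq_mul, smul_eq_mul, map_add, map_mul,
        map_mul, ← ha, ← hb]
      ring
  have h2 : derivative (γ p) = 0 := by
    have := hd p
    rw [hp, map_zero] at this
    exact monic_X.isRegular.left (by simpa using this)
  rw [← h0]
  conv_lhs => rw [← h1 p]
  rw [eq_C_of_natDegree_eq_zero (derivative_eq_zero.1 h2), eval_C, eval_C]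

end LinearDerivations

/-! ### The projection `π` and its injectivity on `W` -/

section Sharp

variable {F : Type*} [Field F] {g : Type*} [LieRing g] [LieAlgebra F g]
  {B : LinearMap.BilinForm F g} {x e f s : g}

/-- The restriction of `ad x` to `g_{≤1/2}`. -/
def adLE (x : g) : Module.End F (gradeLE (F := F) x 1) :=
  (LieAlgebra.ad F g x).restrict fun _ h => lie_mem_gradeLE h

theorem coe_adLE (q : gradeLE (F := F) x 1) : (adLE x q : g) = ⁅x, (q : g)⁆ := rfl

theorem iSup_eigenspace_adLE (x : g) :
    ⨆ i : ℤ, (adLE (F := F) x).eigenspace ((i : F) / 2) = ⊤ := by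
  have h : gradeLE (F := F) x 1 ≤
      (⨆ i : ℤ, (adLE (F := F) x).eigenspace ((i : F) / 2)).map (gradeLE x 1).subtype := by
    refine iSup₂_le fun i hi a ha => ?_
    refine ⟨⟨a, halfGrade_le_gradeLE hi ha⟩, Submodule.mem_iSup_of_mem i ?_, rfl⟩
    rw [Module.End.mem_eigenspace_iff]
    exact Subtype.ext (mem_halfGrade.1 ha)
  rw [eq_top_iff]
  intro q _
  obtain ⟨q', hq', h'⟩ := h q.2
  rwa [← Subtype.ext h']

theorem piHom_gen (n : ℕ) (q : gradeLE (F := F) x 1) :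
    piHom x e f (gen n q) = gen n (sharp x e f q) := by
  induction n with
  | zero => rw [piHom, diffLift_gen_zero]; rfl
  | succ n ih => rw [← deriv_gen, piHom, diffLift_deriv, ← piHom, ih, deriv_gen]

variable [CharZero F]

theorem lie_mem_lieE (t : IsSl2Triple ((2 : F) • x) e f) {q : g}
    (hq : q ∈ lieE (F := F) x e) : ⁅x, q⁆ ∈ lieE (F := F) x e := by
  obtain ⟨w, hw, rfl⟩ := hq
  refine ⟨w + ⁅x, w⁆, add_mem hw (lie_mem_gradeLE hw), ?_⟩
  simp only [LieAlgebra.ad_apply]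
  rw [leibniz_lie x, lie_x_e t, lie_add]

/-- `(f|[a,q])` is non-zero only for `q` of degree `1 - i/2`, while its value has degree zero; the
shift is thus `i/2 - 1`. -/
theorem coeffMap_constBase (t : IsSl2Triple ((2 : F) • x) e f) (hinv : B.lieInvariant g) {i : ℤ}
    {a : g} (ha : a ∈ halfGrade (F := F) x i) (q : gradeLE (F := F) x 1) :
    coeffMap (endDer (adLE x)).toLinearMap (constBase B x f a q) =
      constBase B x f a (adLE x q) + ((i : F) / 2 - 1) • constBase B x f a q := by
  rw [constBase_apply, constBase_apply, coeffMap_C, toLinearMap_apply, Derivation.map_algebraMap,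
    map_zero, coe_adLE, smul_C, ← map_add, Algebra.smul_def, ← map_mul, ← map_add]
  have h1 : ⁅a, ⁅x, (q : g)⁆⁆ = ⁅x, ⁅a, (q : g)⁆⁆ - ((i : F) / 2) • ⁅a, (q : g)⁆ := by
    rw [leibniz_lie x a, mem_halfGrade.1 ha, smul_lie]; abel
  have h2 : B f ⁅x, ⁅a, (q : g)⁆⁆ = B f ⁅a, (q : g)⁆ := by
    rw [← form_lie_left hinv, lie_f_x t]
  rw [h1, map_sub, h2, map_smul, smul_eq_mul]
  ring_nf
  simp

variable [IsAlgClosed F] [FiniteDimensional F g]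

theorem centr_le_gradeLE_one (t : IsSl2Triple ((2 : F) • x) e f) :
    centr (F := F) f ≤ gradeLE x 1 := (centr_le_gradeLE t).trans (gradeLE_mono (by norm_num))

theorem isCompl_submoduleOf (t : IsSl2Triple ((2 : F) • x) e f) :
    IsCompl ((centr (F := F) f).submoduleOf (gradeLE x 1))
      ((lieE x e).submoduleOf (gradeLE x 1)) := by
  constructor
  · rw [Submodule.disjoint_def]
    intro q h1 h2
    exact Subtype.ext (Submodule.disjoint_def.1 (disjoint_centr_lieE t) q h1 h2)
  · rw [codisjoint_iff, eq_top_iff]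
    rintro ⟨q, hq⟩ -
    have hq' := hq
    rw [← centr_sup_lieE t] at hq'
    obtain ⟨c, hc, l, hl, rfl⟩ := Submodule.mem_sup.1 hq'
    exact Submodule.mem_sup.2 ⟨⟨c, centr_le_gradeLE_one t hc⟩, hc, ⟨l, lieE_le_gradeLE t hl⟩, hl, rfl⟩

theorem sharp_of_mem_centr (t : IsSl2Triple ((2 : F) • x) e f) {q : gradeLE (F := F) x 1}
    (hq : (q : g) ∈ centr (F := F) f) : sharp x e f q = ⟨q, hq⟩ := by
  rw [sharp, LinearMap.comp_apply, projOnto, dif_pos (isCompl_submoduleOf t)]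
  have := Submodule.projectionOnto_apply_left (isCompl_submoduleOf t) ⟨q, hq⟩
  rw [this]
  rfl

theorem sharp_of_mem_lieE (t : IsSl2Triple ((2 : F) • x) e f) {q : gradeLE (F := F) x 1}
    (hq : (q : g) ∈ lieE (F := F) x e) : sharp x e f q = 0 := by
  rw [sharp, LinearMap.comp_apply, projOnto, dif_pos (isCompl_submoduleOf t)]
  rw [(Submodule.projectionOnto_apply_eq_zero_iff (isCompl_submoduleOf t)).2 hq, map_zero]

/-- The restriction of `ad x` to `g^f`. -/
def adCentr (t : IsSl2Triple ((2 : F) • x) e f) : Module.End F (centr (F := F) f) :=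
  (LieAlgebra.ad F g x).restrict fun _ h => lie_x_mem_centr t h

theorem sharp_adLE (t : IsSl2Triple ((2 : F) • x) e f) (q : gradeLE (F := F) x 1) :
    sharp x e f (adLE x q) = adCentr t (sharp x e f q) := by
  obtain ⟨q, hq⟩ := q
  have hq' := hq
  rw [← centr_sup_lieE t] at hq'
  obtain ⟨c, hc, l, hl, rfl⟩ := Submodule.mem_sup.1 hq'
  have h : (⟨c + l, hq⟩ : gradeLE (F := F) x 1) =
      ⟨c, centr_le_gradeLE_one t hc⟩ + ⟨l, lieE_le_gradeLE t hl⟩ := rfl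
  rw [h, map_add, map_add, map_add,
    sharp_of_mem_lieE t (q := adLE x ⟨l, lieE_le_gradeLE t hl⟩) (lie_mem_lieE t hl),
    sharp_of_mem_lieE t (q := ⟨l, lieE_le_gradeLE t hl⟩) hl,
    sharp_of_mem_centr t (q := ⟨c, centr_le_gradeLE_one t hc⟩) hc,
    sharp_of_mem_centr t (q := adLE x ⟨c, centr_le_gradeLE_one t hc⟩) (lie_x_mem_centr t hc),
    add_zero, add_zero]
  rfl

/-- The complementary projection to `sharp`, as an endomorphism of `g_{≤1/2}`. -/
def coSharp (t : IsSl2Triple ((2 : F) • x) e f) : Module.End F (gradeLE (F := F) x 1) :=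
  LinearMap.id - Submodule.inclusion (centr_le_gradeLE_one t) ∘ₗ sharp x e f

theorem coSharp_of_mem_centr (t : IsSl2Triple ((2 : F) • x) e f) {q : gradeLE (F := F) x 1}
    (hq : (q : g) ∈ centr (F := F) f) : coSharp t q = 0 := by
  rw [coSharp, LinearMap.sub_apply, LinearMap.comp_apply, sharp_of_mem_centr t hq, sub_eq_zero]
  rfl

theorem coSharp_coSharp (t : IsSl2Triple ((2 : F) • x) e f) (q : gradeLE (F := F) x 1) :
    coSharp t (coSharp t q) = coSharp t q := by
  have h : coSharp t ((Submodule.inclusion (centr_le_gradeLE_one t) ∘ₗ sharp x e f) q) = 0 :=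
    coSharp_of_mem_centr t (sharp x e f q).2
  have h2 : coSharp t q = q - (Submodule.inclusion (centr_le_gradeLE_one t) ∘ₗ sharp x e f) q := rfl
  conv_lhs => rw [h2, map_sub, h, sub_zero]

theorem piHom_endDer (t : IsSl2Triple ((2 : F) • x) e f) (P : DiffPoly F (gradeLE (F := F) x 1)) :
    endDer (adCentr t) (piHom x e f P) = piHom x e f (endDer (adLE x) P) := by
  induction P using diffPoly_induction with
  | halg r => simp
  | hgen n m => rw [piHom_gen, endDer_gen, endDer_gen, piHom_gen, sharp_adLE]
  | hadd p q hp hq => simp only [map_add, hp, hq]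
  | hmul p q hp hq => simp only [map_mul, Derivation.leibniz, smul_eq_mul, map_add, hp, hq]

theorem genLE_lie_x (t : IsSl2Triple ((2 : F) • x) e f) (q : g) :
    endDer (adLE (F := F) x) (genLE x q) = genLE x ⁅x, q⁆ := by
  have : q ∈ gradeLE (F := F) x 1 ⊔ gradeGE x 2 := by
    rw [(isCompl_gradeLE_one t).sup_eq_top]; trivial
  obtain ⟨a, ha, b, hb, rfl⟩ := Submodule.mem_sup.1 this
  rw [lie_add, map_add, map_add, map_add, genLE_of_mem_gradeGE t hb, genLE_of_mem t ha, endDer_gen,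
    genLE_of_mem_gradeGE t (lie_mem_gradeGE hb), genLE_of_mem t (lie_mem_gradeLE ha), map_zero]
  rfl

theorem coeffMap_restBase (t : IsSl2Triple ((2 : F) • x) e f) (hinv : B.lieInvariant g) {i : ℤ}
    {a : g} (ha : a ∈ halfGrade (F := F) x i) (q : gradeLE (F := F) x 1) :
    coeffMap (endDer (adLE x)).toLinearMap (restBase B x a q) =
      restBase B x a (adLE x q) + ((i : F) / 2) • restBase B x a q := by
  rw [restBase_apply, restBase_apply, map_add, coeffMap_X_mul, coeffMap_C, coeffMap_C,
    toLinearMap_apply, toLinearMap_apply, Derivation.map_algebraMap, map_zero, coe_adLE,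
    genLE_lie_x t, mul_zero, add_zero, leibniz_lie x, mem_halfGrade.1 ha, smul_lie, map_add,
    map_smul, smul_add, smul_C, map_add]
  have h2 : B a ⁅x, (q : g)⁆ = -((i : F) / 2) * B a q := by
    have := hinv x a (q : g)
    rw [mem_halfGrade.1 ha, map_smul, LinearMap.smul_apply, smul_eq_mul] at this
    rw [neg_mul, this, neg_neg]
  have h3 : algebraMap F (DiffPoly F (gradeLE (F := F) x 1)) (B a ⁅x, (q : g)⁆) +
      ((i : F) / 2) • algebraMap F (DiffPoly F (gradeLE (F := F) x 1)) (B a q) = 0 := by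
    rw [h2, Algebra.smul_def, ← map_mul, ← map_add, neg_mul, neg_add_cancel, map_zero]
  have h4 := congrArg (fun p : DiffPoly F (gradeLE (F := F) x 1) => X * C p) h3
  simp only [map_add, mul_add, map_zero, mul_zero] at h4
  rw [← mul_smul_comm, smul_C, add_comm (C ((i / 2 : F) • genLE x ⁅a, (q : g)⁆)),
    add_add_add_comm, h4, add_zero]

/-- `[f,q]` has degree at most `-1/2`, hence is orthogonal to `g_{≤0}`. By invariance the hypothesis
says that it is orthogonal to the positive degrees as well. -/
theorem mem_centr_of_forall_form (t : IsSl2Triple ((2 : F) • x) e f) (hB : B.Nondegenerate)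
    (hinv : B.lieInvariant g) {q : g} (hq : q ∈ gradeLE (F := F) x 1)
    (h : ∀ i : ℤ, 1 ≤ i → ∀ a ∈ halfGrade (F := F) x i, B f ⁅a, q⁆ = 0) :
    q ∈ centr (F := F) f := by
  rw [mem_centr]
  have hfq : ⁅f, q⁆ ∈ gradeLE (F := F) x (-1) := by
    refine (iSup₂_le fun k hk c hc => ?_ : gradeLE (F := F) x 1 ≤
      (gradeLE x (-1)).comap (LieAlgebra.ad F g f)) hq
    exact halfGrade_le_gradeLE (by omega) (lie_f_mem t hc)
  refine hB.2 _ fun y => ?_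
  have : (⊤ : Submodule F g) ≤ LinearMap.ker (B.flip ⁅f, q⁆) := by
    rw [← iSup_halfGrade t]
    refine iSup_le fun i a ha => ?_
    change B a ⁅f, q⁆ = 0
    rcases lt_or_ge i 1 with hi | hi
    · exact form_eq_zero_of_gradeLE hinv ha hfq (by omega)
    · have h1 := h i hi a ha
      rwa [← form_lie_left hinv, ← lie_skew, map_neg, LinearMap.neg_apply, neg_eq_zero,
        form_lie_left hinv] at h1
  exact this (Submodule.mem_top (x := y))

/-- An element of `V(g_{≤1/2})` killed by all constant derivations coming from `g_{≥1/2}` and by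
`π` vanishes. -/
theorem eq_zero_of_constBase (t : IsSl2Triple ((2 : F) • x) e f) (hB : B.Nondegenerate)
    (hinv : B.lieInvariant g) {P : DiffPoly F (gradeLE (F := F) x 1)}
    (hP : ∀ i : ℤ, 1 ≤ i → ∀ a ∈ halfGrade (F := F) x i, lamDer (constBase B x f a) P = 0)
    (hπ : piHom x e f P = 0) : P = 0 := by
  -- The functionals whose constant derivation kills `P` form a subspace, since that derivation is
  -- linear in the functional.
  let Ξ : Submodule F (Module.Dual F (gradeLE (F := F) x 1)) :=
    { carrier := {ξ | constDer ξ P = 0}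
      zero_mem' := by
        have := constDer_smul (0 : F) (0 : Module.Dual F (gradeLE (F := F) x 1)) P
        rwa [zero_smul, zero_smul] at this
      add_mem' := fun {ξ η} h1 h2 => by
        simp only [Set.mem_ofPred_eq] at *
        rw [constDer_add, h1, h2, add_zero]
      smul_mem' := fun c ξ h => by
        simp only [Set.mem_ofPred_eq] at *
        rw [constDer_smul, h, smul_zero] }
  have hΞ : ∀ φ : Module.Dual F (gradeLE (F := F) x 1),
      (∀ q : gradeLE (F := F) x 1, (q : g) ∈ centr (F := F) f → φ q = 0) → φ ∈ Ξ := by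
    intro φ hφ
    -- By finite-dimensional duality `Ξ` is the annihilator of its common kernel, and that kernel
    -- lies in `g^f` because `Ξ` contains all `(f|[a,·])`.
    rw [← Subspace.dualCoannihilator_dualAnnihilator_eq (W := Ξ), Submodule.mem_dualAnnihilator]
    intro q hq
    rw [Submodule.mem_dualCoannihilator] at hq
    refine hφ q (mem_centr_of_forall_form t hB hinv q.2 fun i hi a ha => ?_)
    exact hq (B f ∘ₗ LieAlgebra.ad F g a ∘ₗ (gradeLE x 1).subtype) (hP i hi a ha)
  have hend : endDer (coSharp t) P = 0 := by
    rw [endDer_eq_sum_substGen (Module.finBasis F (gradeLE (F := F) x 1))]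
    refine Finset.sum_eq_zero fun k _ => ?_
    have : (Module.finBasis F (gradeLE (F := F) x 1)).coord k ∘ₗ coSharp t ∈ Ξ :=
      hΞ _ fun q hq => by rw [LinearMap.comp_apply, coSharp_of_mem_centr t hq, map_zero]
    rw [show constDer _ P = 0 from this, map_zero]
  rw [eq_diffLift_of_endDer_eq_zero (coSharp_coSharp t) hend]
  -- `id - coSharp` is the projection to `g^f` followed by inclusion, so this substitution factors
  -- through `π`.
  have hfac : ∀ Q, SymmetricAlgebra.lift (Finsupp.lsum F fun n => gen n ∘ₗ
      (LinearMap.id - coSharp t)) Q = diffLift (gen 0 ∘ₗ Submodule.inclusion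
        (centr_le_gradeLE_one t)) (piHom x e f Q) := by
    intro Q
    induction Q using diffPoly_induction with
    | halg r => simp
    | hgen n m =>
      have h : ∀ c : centr (F := F) f, diffLift (gen 0 ∘ₗ Submodule.inclusion
          (centr_le_gradeLE_one t)) (gen n c) =
          gen n (Submodule.inclusion (centr_le_gradeLE_one t) c) := by
        intro c
        induction n with
        | zero => rw [diffLift_gen_zero]; rfl
        | succ n ih => rw [← deriv_gen, diffLift_deriv, ih, deriv_gen]
      rw [piHom_gen, h]
      simp [gen, coSharp]
    | hadd p q hp hq => rw [map_add, hp, hq, map_add, map_add]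
    | hmul p q hp hq => rw [map_mul, hp, hq, map_mul, map_mul]
  rw [hfac, hπ, map_zero]

/-- The restriction of `π` to the `W`-algebra is injective. -/
theorem eq_zero_of_actDer (t : IsSl2Triple ((2 : F) • x) e f) (hB : B.Nondegenerate)
    (hinv : B.lieInvariant g) {P : DiffPoly F (gradeLE (F := F) x 1)}
    (hP : ∀ a ∈ gradeGE (F := F) x 1, actDer B x f a P = 0)
    (hπ : piHom x e f P = 0) : P = 0 := by
  by_contra hne
  -- The operators are indexed by homogeneous elements of positive degree, so that each has a
  -- definite weight shift.
  obtain ⟨P₀, h1, h2, h3⟩ := exists_lowest_component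
    (iSup_eigenspace_endDer (iSup_eigenspace_adLE x))
    (coeffMap (endDer (adLE x)).toLinearMap) (endDer (adCentr t)).toLinearMap
    (π := (piHom x e f).toLinearMap) (fun v => piHom_endDer t v)
    (A := Σ i : {i : ℤ // 1 ≤ i}, halfGrade (F := F) x i)
    (fun a => (lamDer (constBase B x f (a.2 : g))).toLinearMap)
    (fun a => (lamDer (restBase B x (a.2 : g))).toLinearMap) (fun a => a.1)
    (fun a v => coeffMap_lamDer _ (coeffMap_constBase t hinv a.2.2) v)
    (fun a v => coeffMap_lamDer _ (coeffMap_restBase t hinv a.2.2) v)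
    hne (fun a => by
      have := hP a.2 (halfGrade_le_gradeGE a.1.2 a.2.2)
      rwa [actDer, lamDer_add] at this) hπ
  exact h1 (eq_zero_of_constBase t hB hinv (fun i hi a ha => h3 ⟨⟨i, hi⟩, ⟨a, ha⟩⟩) h2)

end Sharp

/-! ### Dual bases and canonical tensors -/

section DualBases

variable {F : Type*} [Field F] {g N : Type*} [AddCommGroup g] [Module F g] [AddCommGroup N]
  [Module F N] {S S' : Submodule F g} {β : g →ₗ[F] g →ₗ[F] F} {n : ℕ}

/-- The coefficients of `p` in the basis `b` are `β(p, b'_k)`. The arbitrary linear `Y` lets the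
expansion be used under brackets, `∂` and `π`. -/
theorem AreDual.sum_left {b : Module.Basis (Fin n) F S} {b' : Fin n → g}
    (h : AreDual (fun p q => β p q) (fun k => (b k : g)) b') (Y : g →ₗ[F] N) {p : g} (hp : p ∈ S) :
    ∑ k, β p (b' k) • Y (b k) = Y p := by
  have hp' : p = ∑ k, b.repr ⟨p, hp⟩ k • (b k : g) := by
    have := congrArg Subtype.val (b.sum_repr ⟨p, hp⟩)
    rw [Submodule.coe_sum] at this
    simp only [Submodule.coe_smul] at this
    exact this.symm
  have hc : ∀ k, β p (b' k) = b.repr ⟨p, hp⟩ k := by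
    intro k
    conv_lhs => rw [hp']
    simp only [map_sum, map_smul, LinearMap.sum_apply, LinearMap.smul_apply]
    have h' : ∀ i, β (b i) (b' k) = if i = k then 1 else 0 := fun i => h i k
    simp [h']
  conv_rhs => rw [hp', map_sum]
  simp only [hc, map_smul]

theorem AreDual.sum_right {b : Fin n → g} {b' : Module.Basis (Fin n) F S'}
    (h : AreDual (fun p q => β p q) b (fun k => (b' k : g))) (Y : g →ₗ[F] N) {p : g} (hp : p ∈ S') :
    ∑ k, β (b k) p • Y (b' k) = Y p :=
  AreDual.sum_left (β := β.flip) (fun i j => by simpa [eq_comm] using h j i) Y hp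

/-- The canonical tensor of a (skew-)symmetric form is (skew-)symmetric. -/
theorem AreDual.sum_swap {b b' : Module.Basis (Fin n) F S}
    (h : AreDual (fun p q => β p q) (fun k => (b k : g)) (fun k => (b' k : g))) {ε : F}
    (hε : ∀ p q, β p q = ε * β q p) (Φ : g →ₗ[F] g →ₗ[F] N) :
    ∑ k, Φ (b' k) (b k) = ε • ∑ k, Φ (b k) (b' k) := by
  -- Expanding `b'_j` in the basis `b` produces in both sums the same matrix `β(b'_j, b'_i)`, whose
  -- symmetry is that of `β`.
  have h1 : ∀ j, Φ (b' j) (b j) = ∑ i, β (b' j) (b' i) • Φ (b i) (b j) := fun j =>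
    (AreDual.sum_left h (Φ.flip (b j)) (b' j).2).symm
  have h2 : ∀ j, Φ (b j) (b' j) = ∑ i, β (b' j) (b' i) • Φ (b j) (b i) := fun j =>
    (AreDual.sum_left h (Φ (b j)) (b' j).2).symm
  simp only [h1, h2]
  rw [Finset.sum_comm, Finset.smul_sum]
  refine Finset.sum_congr rfl fun i _ => ?_
  rw [Finset.smul_sum]
  refine Finset.sum_congr rfl fun j _ => ?_
  rw [hε, mul_smul]

theorem exists_areDual [FiniteDimensional F g] (β : g →ₗ[F] g →ₗ[F] F)
    (hl : ∀ p ∈ S, (∀ q ∈ S', β p q = 0) → p = 0) (hr : ∀ q ∈ S', (∀ p ∈ S, β p q = 0) → q = 0) :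
    ∃ (n : ℕ) (b : Module.Basis (Fin n) F S) (b' : Module.Basis (Fin n) F S'),
      AreDual (fun p q => β p q) (fun k => (b k : g)) (fun k => (b' k : g)) := by
  let p : S →ₗ[F] S' →ₗ[F] F := β.domRestrict₁₂ S S'
  have hp : p.IsPerfPair := by
    refine LinearMap.IsPerfPair.of_injective ?_ ?_
    · rw [injective_iff_map_eq_zero]
      intro a ha
      exact Subtype.ext (hl a a.2 fun q hq => LinearMap.congr_fun ha ⟨q, hq⟩)
    · rw [injective_iff_map_eq_zero]
      intro a ha
      exact Subtype.ext (hr a a.2 fun q hq => LinearMap.congr_fun ha ⟨q, hq⟩)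
  let b' := Module.finBasis F S'
  refine ⟨_, b'.dualBasis.map p.toPerfPair.symm, b', fun i j => ?_⟩
  change p (p.toPerfPair.symm (b'.dualBasis i)) (b' j) = _
  have : p (p.toPerfPair.symm (b'.dualBasis i)) = b'.dualBasis i :=
    p.toPerfPair.apply_symm_apply _
  rw [this, Module.Basis.dualBasis_apply_self]
  simp [eq_comm]

end DualBases

/-! ### Calculus of the action and of `π` -/

section Tools

variable {F : Type*} [Field F] {g : Type*} [LieRing g] [LieAlgebra F g]
  {B : LinearMap.BilinForm F g} {x e f s : g}

theorem actDer_mul (a : g) (P Q : DiffPoly F (gradeLE (F := F) x 1)) :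
    actDer B x f a (P * Q) = C P * actDer B x f a Q + C Q * actDer B x f a P := lamDer_mul _ P Q

theorem actDer_deriv (a : g) (P : DiffPoly F (gradeLE (F := F) x 1)) :
    actDer B x f a (deriv P) = lamShift (actDer B x f a P) := lamDer_deriv _ P

theorem actDer_add_left (a b : g) (P : DiffPoly F (gradeLE (F := F) x 1)) :
    actDer B x f (a + b) P = actDer B x f a P + actDer B x f b P := by
  have h : constBase B x f (a + b) + restBase B x (a + b) =
      (constBase B x f a + restBase B x a) + (constBase B x f b + restBase B x b) := by
    ext q : 1
    simp only [LinearMap.add_apply, constBase_apply, restBase_apply, add_lie, map_add]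
    ring
  rw [actDer, h, lamDer_add]
  rfl

theorem actDer_smul_left (c : F) (a : g) (P : DiffPoly F (gradeLE (F := F) x 1)) :
    actDer B x f (c • a) P = c • actDer B x f a P := by
  induction P using diffPoly_differential_induction with
  | halg r => simp
  | hgen m =>
    simp only [actDer, lamDer_gen_zero, LinearMap.add_apply, constBase_apply, restBase_apply,
      smul_lie, map_smul, LinearMap.smul_apply, Algebra.smul_def, map_mul]
    rw [IsScalarTower.algebraMap_apply F (DiffPoly F (gradeLE (F := F) x 1))
      (DiffPoly F (gradeLE (F := F) x 1))[X], Polynomial.algebraMap_eq]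
    simp only [Algebra.algebraMap_self, RingHom.id_apply]
    ring
  | hderiv p hp => rw [actDer_deriv, actDer_deriv, hp, map_smul]
  | hadd p q hp hq => simp only [map_add, hp, hq, smul_add]
  | hmul p q hp hq => simp only [actDer_mul, hp, hq, smul_add, mul_smul_comm]

/-- The action of `a` on `P` is `α + λ β`. -/
def HasAct (B : LinearMap.BilinForm F g) (x f a : g)
    (P α β : DiffPoly F (gradeLE (F := F) x 1)) : Prop :=
  actDer B x f a P = C α + X * C β

section HasAct

variable {a : g} {P Q α α' β β' : DiffPoly F (gradeLE (F := F) x 1)}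

theorem HasAct.add (h : HasAct B x f a P α β) (h' : HasAct B x f a Q α' β') :
    HasAct B x f a (P + Q) (α + α') (β + β') := by
  rw [HasAct] at *
  rw [map_add, h, h', C_add, C_add]
  ring

theorem HasAct.smul (c : F) (h : HasAct B x f a P α β) :
    HasAct B x f a (c • P) (c • α) (c • β) := by
  rw [HasAct] at *
  have h1 := congrArg C (Algebra.smul_def c α)
  have h2 := congrArg C (Algebra.smul_def c β)
  rw [C_mul] at h1 h2
  rw [Algebra.smul_def, actDer_mul, h, Derivation.map_algebraMap, mul_zero, add_zero, h1, h2]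
  ring

theorem HasAct.sum {ι : Type*} (s : Finset ι) {P α β : ι → DiffPoly F (gradeLE (F := F) x 1)}
    (h : ∀ i, HasAct B x f a (P i) (α i) (β i)) :
    HasAct B x f a (∑ i ∈ s, P i) (∑ i ∈ s, α i) (∑ i ∈ s, β i) := by
  simp only [HasAct] at *
  simp only [map_sum, h, Finset.sum_add_distrib, Finset.mul_sum]

theorem HasAct.mul (h : HasAct B x f a P α β) (h' : HasAct B x f a Q α' β') :
    HasAct B x f a (P * Q) (P * α' + Q * α) (P * β' + Q * β) := by
  rw [HasAct] at *
  rw [actDer_mul, h, h']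
  simp only [C_add, C_mul]
  ring

theorem HasAct.deriv (h : HasAct B x f a P α 0) : HasAct B x f a (deriv P) (deriv α) α := by
  rw [HasAct] at *
  rw [actDer_deriv, h, C_0, mul_zero, add_zero, lamShift_C, add_comm]

theorem HasAct.actDer_eq_zero (h : HasAct B x f a P α β) (hα : α = 0) (hβ : β = 0) :
    actDer B x f a P = 0 := by
  rw [h, hα, hβ, C_0, mul_zero, add_zero]

end HasAct

theorem piHom_deriv (P : DiffPoly F (gradeLE (F := F) x 1)) :
    piHom x e f (deriv P) = deriv (piHom x e f P) := diffLift_deriv _ P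

/-- The elements of `g^f` whose generators are images of elements of `W` under `π` form a subspace:
it suffices to treat two subspaces to get their sum. -/
theorem exists_mem_W_of_le {z : F} {p : Submodule F g} (hp : p ≤ centr (F := F) f)
    {q : Submodule F g} (hq : q ≤ centr (F := F) f)
    (h1 : ∀ c : centr (F := F) f, (c : g) ∈ p → ∃ P ∈ W B x f s z, piHom x e f P = gen 0 c)
    (h2 : ∀ c : centr (F := F) f, (c : g) ∈ q → ∃ P ∈ W B x f s z, piHom x e f P = gen 0 c)
    (c : centr (F := F) f) (hc : (c : g) ∈ p ⊔ q) :
    ∃ P ∈ W B x f s z, piHom x e f P = gen 0 c := by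
  obtain ⟨a, ha, b, hb, hab⟩ := Submodule.mem_sup.1 hc
  obtain ⟨P, hP, hP'⟩ := h1 ⟨a, hp ha⟩ ha
  obtain ⟨Q, hQ, hQ'⟩ := h2 ⟨b, hq hb⟩ hb
  refine ⟨P + Q, add_mem hP hQ, ?_⟩
  rw [map_add, hP', hQ', ← map_add]
  congr 1
  exact Subtype.ext hab

variable [CharZero F]

theorem form_f_lie_eq_zero (hinv : B.lieInvariant g) (t : IsSl2Triple ((2 : F) • x) e f) {a q : g}
    {i j : ℤ} (ha : a ∈ halfGrade (F := F) x i) (hq : q ∈ halfGrade (F := F) x j)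
    (hij : i + j ≠ 2) : B f ⁅a, q⁆ = 0 :=
  form_eq_zero hinv (f_mem t) (lie_mem_halfGrade ha hq) (by omega)

theorem x_mem_lieE (t : IsSl2Triple ((2 : F) • x) e f) : x ∈ lieE (F := F) x e := by
  refine ⟨(1 / 2 : F) • f, Submodule.smul_mem _ _ (halfGrade_le_gradeLE (by norm_num) (f_mem t)), ?_⟩
  rw [LieAlgebra.ad_apply, lie_smul, t.lie_e_f, smul_smul]
  norm_num

variable [IsAlgClosed F] [FiniteDimensional F g]

/-- When the degrees add up to `1`, the bracket is projected away and only the constant survives.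
The lemmas that follow treat the other degree sums in the same way. -/
theorem HasAct.genLE_two (t : IsSl2Triple ((2 : F) • x) e f) (hinv : B.lieInvariant g) {a q : g}
    {i j : ℤ} (ha : a ∈ halfGrade (F := F) x i) (hq : q ∈ halfGrade (F := F) x j) (hj : j ≤ 1)
    (hij : i + j = 2) : HasAct B x f a (genLE x q) (algebraMap F _ (B f ⁅a, q⁆)) 0 := by
  rw [HasAct, actDer_genLE t a (halfGrade_le_gradeLE hj hq), form_eq_zero hinv ha hq (by omega),
    genLE_of_mem_gradeGE t (halfGrade_le_gradeGE hij.ge (lie_mem_halfGrade ha hq))]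
  simp

theorem HasAct.genLE_three (t : IsSl2Triple ((2 : F) • x) e f) (hinv : B.lieInvariant g) {a q : g}
    {i j : ℤ} (ha : a ∈ halfGrade (F := F) x i) (hq : q ∈ halfGrade (F := F) x j) (hj : j ≤ 1)
    (hij : 3 ≤ i + j) : HasAct B x f a (genLE x q) 0 0 := by
  rw [HasAct, actDer_genLE t a (halfGrade_le_gradeLE hj hq), form_eq_zero hinv ha hq (by omega),
    genLE_of_mem_gradeGE t (halfGrade_le_gradeGE (by omega) (lie_mem_halfGrade ha hq)),
    form_f_lie_eq_zero hinv t ha hq (by omega)]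
  simp

theorem HasAct.genLE_zero (t : IsSl2Triple ((2 : F) • x) e f) (hinv : B.lieInvariant g) {a q : g}
    {i j : ℤ} (ha : a ∈ halfGrade (F := F) x i) (hq : q ∈ halfGrade (F := F) x j) (hj : j ≤ 1)
    (hij : i + j = 0) :
    HasAct B x f a (genLE x q) (genLE x ⁅a, q⁆) (algebraMap F _ (B a q)) := by
  rw [HasAct, actDer_genLE t a (halfGrade_le_gradeLE hj hq),
    form_f_lie_eq_zero hinv t ha hq (by omega)]
  simp

theorem HasAct.genLE_of_ne (t : IsSl2Triple ((2 : F) • x) e f) (hinv : B.lieInvariant g) {a q : g}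
    {i j : ℤ} (ha : a ∈ halfGrade (F := F) x i) (hq : q ∈ halfGrade (F := F) x j) (hj : j ≤ 1)
    (h0 : i + j ≠ 0) (h2 : i + j ≠ 2) : HasAct B x f a (genLE x q) (genLE x ⁅a, q⁆) 0 := by
  rw [HasAct, actDer_genLE t a (halfGrade_le_gradeLE hj hq), form_f_lie_eq_zero hinv t ha hq h2,
    form_eq_zero hinv ha hq h0]
  simp

theorem piHom_genLE_of_mem_centr (t : IsSl2Triple ((2 : F) • x) e f) {a : g}
    (ha : a ∈ centr (F := F) f) : piHom x e f (genLE x a) = gen 0 (⟨a, ha⟩ : centr (F := F) f) := by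
  rw [genLE_of_mem t (centr_le_gradeLE_one t ha), piHom_gen, sharp_of_mem_centr t]

theorem piHom_genLE_of_mem_lieE (t : IsSl2Triple ((2 : F) • x) e f) {a : g}
    (ha : a ∈ lieE (F := F) x e) : piHom (F := F) x e f (genLE (F := F) x a) = 0 := by
  rw [genLE_of_mem t (lieE_le_gradeLE t ha), piHom_gen, sharp_of_mem_lieE t ha, map_zero]

theorem piHom_genLE_lie_e (t : IsSl2Triple ((2 : F) • x) e f) {u : g} {i : ℤ}
    (hu : u ∈ halfGrade (F := F) x i) (hi : i ≤ -1) :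
    piHom (F := F) x e f (genLE (F := F) x ⁅e, u⁆) = 0 :=
  piHom_genLE_of_mem_lieE t ⟨u, halfGrade_le_gradeLE hi hu, rfl⟩

/-- Reduces both cases of the theorem to exhibiting preimages. Injectivity holds for every triple,
the image is a differential subalgebra, and any element of `W` over a generator is its preimage. -/
theorem exists_equiv_of_surjective (t : IsSl2Triple ((2 : F) • x) e f) (hB : B.Nondegenerate)
    (hinv : B.lieInvariant g) {d : ℤ} (hd : IsGreatest {i : ℤ | halfGrade (F := F) x i ≠ ⊥} d)
    (hs : s ∈ halfGrade (F := F) x d) (z : F)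
    (hsurj : ∀ c : centr (F := F) f, ∃ P ∈ W B x f s z, piHom x e f P = gen 0 c) :
    ∃ E : W B x f s z ≃ₐ[F] DiffPoly F (centr (F := F) f),
      (∀ P, E P = piHom x e f P) ∧ (∀ P, E (derivW B x f s z P) = deriv (E P)) ∧
      ∀ (P : DiffPoly F (gradeLE (F := F) x 1)) (c : centr (F := F) f), P ∈ W B x f s z →
        piHom x e f P = gen 0 c → (E.symm (gen 0 c) : DiffPoly F (gradeLE (F := F) x 1)) = P := by
  let piW : W B x f s z →ₐ[F] DiffPoly F (centr (F := F) f) := (piHom x e f).comp (W B x f s z).val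
  have hinj : Function.Injective piW := by
    rw [injective_iff_map_eq_zero]
    intro P hP
    exact Subtype.ext (eq_zero_of_actDer t hB hinv
      ((mem_W_iff t hB hinv hd hs z P.1).1 P.2) hP)
  have hsur : Function.Surjective piW := by
    intro Q
    induction Q using diffPoly_differential_induction with
    | halg r => exact ⟨algebraMap F _ r, AlgHom.commutes _ _⟩
    | hgen c =>
      obtain ⟨P, hP, h⟩ := hsurj c
      exact ⟨⟨P, hP⟩, h⟩
    | hderiv a ha =>
      obtain ⟨P, rfl⟩ := ha
      exact ⟨derivW B x f s z P, piHom_deriv _⟩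
    | hadd a b ha hb =>
      obtain ⟨P, rfl⟩ := ha
      obtain ⟨Q, rfl⟩ := hb
      exact ⟨P + Q, map_add _ _ _⟩
    | hmul a b ha hb =>
      obtain ⟨P, rfl⟩ := ha
      obtain ⟨Q, rfl⟩ := hb
      exact ⟨P * Q, map_mul _ _ _⟩
  refine ⟨AlgEquiv.ofBijective piW ⟨hinj, hsur⟩, fun P => rfl, fun P => piHom_deriv _,
    fun P c hP h => ?_⟩
  have : (AlgEquiv.ofBijective piW ⟨hinj, hsur⟩).symm (gen 0 c) = ⟨P, hP⟩ := by
    rw [AlgEquiv.symm_apply_eq]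
    exact h.symm
  rw [this]

end Tools

/-! ### Identities for the invariant form and for `(p,q) ↦ (f|[p,q])` -/

section FormIdentities

variable {F : Type*} [Field F] {g N : Type*} [LieRing g] [LieAlgebra F g] [AddCommGroup N]
  [Module F N] {B : LinearMap.BilinForm F g} {x e f : g} {n : ℕ}

/-- The bilinear form `(p, q) ↦ (f|[p,q])`. -/
def omega (B : LinearMap.BilinForm F g) (f : g) : g →ₗ[F] g →ₗ[F] F :=
  (LieAlgebra.ad F g : g →ₗ[F] Module.End F g).compr₂ (B f)

theorem omega_apply (p q : g) : omega B f p q = B f ⁅p, q⁆ := rfl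

theorem algebraMap_mul_eq_smul {A : Type*} [CommRing A] [Algebra F A] (P : A) (r : F) :
    P * algebraMap F A r = r • P := by
  rw [mul_comm, Algebra.smul_def]

theorem form_f_lie_of_centr (hinv : B.lieInvariant g) {a : g} (ha : a ∈ centr (F := F) f) (p : g) :
    B f ⁅a, p⁆ = 0 := by
  rw [← form_lie_left hinv, mem_centr.1 ha, map_zero, LinearMap.zero_apply]

theorem sum_sum_eq_zero_of_antisymm {A : Type*} [CharZero F] [CommRing A] [Algebra F A] {τ : Fin n → Fin n → F}
    (hτ : ∀ h k, τ h k = -τ k h) (y : Fin n → A) : ∑ h, ∑ k, τ h k • (y h * y k) = 0 := by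
  have h1 : ∑ h, ∑ k, τ h k • (y h * y k) = -∑ h, ∑ k, τ h k • (y h * y k) := by
    conv_lhs => rw [Finset.sum_comm]
    rw [← Finset.sum_neg_distrib]
    refine Finset.sum_congr rfl fun k _ => ?_
    rw [← Finset.sum_neg_distrib]
    refine Finset.sum_congr rfl fun h _ => ?_
    rw [hτ, neg_smul, mul_comm]
  have h2 : (2 : F) • ∑ h, ∑ k, τ h k • (y h * y k) = 0 := by
    rw [two_smul]
    nth_rewrite 1 [h1]
    exact neg_add_cancel _
  exact (smul_eq_zero.1 h2).resolve_left two_ne_zero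

theorem form_f_lie_skew (p q : g) : B f ⁅p, q⁆ = -B f ⁅q, p⁆ := by
  rw [← lie_skew, map_neg]

theorem form_f_lie_lie_sub {r : F} {a b u q : g}
    (hab : ⁅a, b⁆ = r • e) (heq : ⁅e, q⁆ = 0) :
    B f ⁅a, ⁅⁅u, q⁆, b⁆⁆ - B f ⁅b, ⁅⁅u, q⁆, a⁆⁆ = -(r * B f ⁅⁅e, u⁆, q⁆) := by
  have h1 : ⁅a, ⁅⁅u, q⁆, b⁆⁆ - ⁅b, ⁅⁅u, q⁆, a⁆⁆ = ⁅⁅u, q⁆, ⁅a, b⁆⁆ := by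
    rw [leibniz_lie ⁅u, q⁆ a b, ← lie_skew b, sub_neg_eq_add, add_comm]
  have h2 : ⁅⁅u, q⁆, e⁆ = -⁅⁅e, u⁆, q⁆ := by
    rw [← lie_skew, leibniz_lie e u q, heq, lie_zero, add_zero]
  rw [← map_sub, h1, hab, lie_smul, h2, map_smul, map_neg, smul_eq_mul]
  ring

/-- `(f|[a,[[u,b],c]])` is symmetric in `a, b, c` up to multiples of `κ (f|[·,·]) (f|[[e,u],·])`, by
the Jacobi identity and `[a,b] ∈ F e`. The coefficients on each side sum to zero, and the
corrections cancel between the two sides. -/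
theorem form_f_lie_symm {κ : F} {p h k u : g}
    (hw : ∀ a ∈ ({p, h, k} : Set g), ∀ b ∈ ({p, h, k} : Set g),
      ⁅a, b⁆ = (κ * B f ⁅a, b⁆) • e)
    (he : ∀ a ∈ ({p, h, k} : Set g), ⁅e, a⁆ = 0) :
    B f ⁅p, ⁅⁅u, h⁆, k⁆⁆ + B f ⁅h, ⁅⁅u, p⁆, k⁆⁆ - 2 * B f ⁅h, ⁅⁅u, k⁆, p⁆⁆ =
      -(B f ⁅p, ⁅⁅u, k⁆, h⁆⁆ + B f ⁅k, ⁅⁅u, p⁆, h⁆⁆ - 2 * B f ⁅k, ⁅⁅u, h⁆, p⁆⁆) := by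
  have hd : ∀ a ∈ ({p, h, k} : Set g), ∀ b ∈ ({p, h, k} : Set g), ∀ q ∈ ({p, h, k} : Set g),
      B f ⁅a, ⁅⁅u, q⁆, b⁆⁆ - B f ⁅a, ⁅⁅u, b⁆, q⁆⁆ =
        κ * B f ⁅q, b⁆ * B f ⁅⁅e, u⁆, a⁆ := by
    intro a ha b hb q hq
    have h1 : ⁅⁅u, q⁆, b⁆ - ⁅⁅u, b⁆, q⁆ = ⁅u, ⁅q, b⁆⁆ := by
      rw [leibniz_lie u q b, ← lie_skew q ⁅u, b⁆]; abel
    have h2 : ⁅a, ⁅u, e⁆⁆ = ⁅⁅e, u⁆, a⁆ := by rw [← lie_skew u e, lie_neg, lie_skew]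
    have h3 := congrArg (fun y => B f ⁅a, ⁅u, y⁆⁆) (hw q hq b hb)
    simp only [lie_smul, map_smul, smul_eq_mul, h2] at h3
    rw [← map_sub, ← lie_sub, h1, h3]
  have hp : p ∈ ({p, h, k} : Set g) := by simp
  have hh : h ∈ ({p, h, k} : Set g) := by simp
  have hk : k ∈ ({p, h, k} : Set g) := by simp
  have e1 := form_f_lie_lie_sub (B := B) (f := f) (u := u) (hw p hp k hk) (he h hh)
  have e2 := form_f_lie_lie_sub (B := B) (f := f) (u := u) (hw p hp h hh) (he k hk)
  have e3 := hd h hh k hk p hp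
  have e4 := hd k hk h hh p hp
  linear_combination e1 + e2 + e3 + e4

theorem form_lie_f (hinv : B.lieInvariant g) (p v : g) :
    B p ⁅f, v⁆ = B f ⁅v, p⁆ := by
  rw [← form_lie_left hinv, ← lie_skew, map_neg, LinearMap.neg_apply, form_lie_left hinv,
    ← lie_skew v p, map_neg]

theorem lie_mem_halfGrade_of_eq {a b : g} {i j k : ℤ} (ha : a ∈ halfGrade (F := F) x i)
    (hb : b ∈ halfGrade (F := F) x j) (hij : i + j = k) : ⁅a, b⁆ ∈ halfGrade (F := F) x k :=
  hij ▸ lie_mem_halfGrade ha hb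

variable {v v' : Module.Basis (Fin n) F (halfGrade (F := F) x 1)}

theorem sum_omega_left (h : AreDual (fun p q => B f ⁅p, q⁆) (fun k => (v k : g))
    (fun k => (v' k : g))) (Y : g →ₗ[F] N) {p : g} (hp : p ∈ halfGrade (F := F) x 1) :
    ∑ k, B f ⁅p, (v' k : g)⁆ • Y (v k) = Y p :=
  AreDual.sum_left (β := omega B f) h Y hp

theorem sum_omega_right (h : AreDual (fun p q => B f ⁅p, q⁆) (fun k => (v k : g))
    (fun k => (v' k : g))) (Y : g →ₗ[F] N) {p : g} (hp : p ∈ halfGrade (F := F) x 1) :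
    ∑ k, B f ⁅(v k : g), p⁆ • Y (v' k) = Y p :=
  AreDual.sum_right (β := omega B f) h Y hp

end FormIdentities

/-! ### Minimal case: the explicit elements are annihilated -/

section Minimal

variable {F : Type*} [Field F] [CharZero F] {g : Type*} [LieRing g] [LieAlgebra F g]
  {B : LinearMap.BilinForm F g} {x e f s : g} {n : ℕ}

/-- As `p` commutes with `e`, the left side is `(f|[e,[p,u]]) = -2(x|[p,u])`, and `(x|[p,u]) =
([x,p]|u)`. -/
theorem form_f_lie_lie_e (t : IsSl2Triple ((2 : F) • x) e f) (hinv : B.lieInvariant g) {p : g}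
    {i : ℤ} (hp : p ∈ halfGrade (F := F) x i) (hep : ⁅e, p⁆ = 0) (u : g) :
    B f ⁅p, ⁅e, u⁆⁆ = -(i : F) * B p u := by
  have h1 : ⁅p, ⁅e, u⁆⁆ = ⁅e, ⁅p, u⁆⁆ := by rw [leibniz_lie e p u, hep, zero_lie, zero_add]
  rw [h1, ← form_lie_left hinv, ← lie_skew, t.lie_e_f, ← form_lie_left hinv, neg_lie, smul_lie,
    mem_halfGrade.1 hp]
  simp only [map_neg, map_smul, LinearMap.neg_apply, LinearMap.smul_apply, smul_eq_mul]
  ring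

theorem lie_e_lie_f_of_lie_e (t : IsSl2Triple ((2 : F) • x) e f) {p : g}
    (hp : p ∈ halfGrade (F := F) x 1) (hep : ⁅e, p⁆ = 0) : ⁅e, ⁅f, p⁆⁆ = p := by
  rw [leibniz_lie, t.lie_e_f, hep, lie_zero, add_zero, smul_lie, mem_halfGrade.1 hp, smul_smul]
  norm_num

/-- The λ-free part of the action of `p` on `ψ(u)`. The linear terms cancel at once. With `A = ∑ v^k
[[u,v_k],p]`, the cubic sum contributes `⅓(A + 2A)` and the quadratic one `-A`, which accounts for
the factor `⅓`. -/
theorem sum_cubic_eq_zero {A : Type*} [CommRing A] [Algebra F A]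
    {v v' : Module.Basis (Fin n) F (halfGrade (F := F) x 1)}
    (h : AreDual (fun p q => B f ⁅p, q⁆) (fun k => (v k : g)) (fun k => (v' k : g))) {κ : F}
    (hκ : ∀ a ∈ halfGrade (F := F) x 1, ∀ b ∈ halfGrade (F := F) x 1,
      ⁅a, b⁆ = (κ * B f ⁅a, b⁆) • e)
    (he : ∀ a ∈ halfGrade (F := F) x 1, ⁅e, a⁆ = 0) {u p : g}
    (hu : u ∈ halfGrade (F := F) x (-1)) (hp : p ∈ halfGrade (F := F) x 1) (G : g →ₗ[F] A) :
    G ⁅p, u⁆ + (1 / 3 : F) • ∑ i, ∑ k, (G ⁅⁅u, (v i : g)⁆, (v k : g)⁆ * G (v' i) *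
        algebraMap F A (B f ⁅p, (v' k : g)⁆) +
      G (v' k) * (G ⁅⁅u, (v i : g)⁆, (v k : g)⁆ * algebraMap F A (B f ⁅p, (v' i : g)⁆) +
        G (v' i) * algebraMap F A (B f ⁅p, ⁅⁅u, (v i : g)⁆, (v k : g)⁆⁆))) +
      ∑ k, (G ⁅u, (v k : g)⁆ * algebraMap F A (B f ⁅p, (v' k : g)⁆) +
        G (v' k) * G ⁅p, ⁅u, (v k : g)⁆⁆) = 0 := by
  have hu1 : ∀ a ∈ halfGrade (F := F) x 1, ∀ b ∈ halfGrade (F := F) x 1,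
      ⁅⁅u, a⁆, b⁆ ∈ halfGrade (F := F) x 1 := fun a ha b hb =>
    lie_mem_halfGrade_of_eq (lie_mem_halfGrade hu ha) hb (by norm_num)
  have hq1 : ∑ k, B f ⁅p, (v' k : g)⁆ • G ⁅u, (v k : g)⁆ = G ⁅u, p⁆ :=
    sum_omega_left h (G ∘ₗ (LieAlgebra.ad F g u : g →ₗ[F] g)) hp
  have hq2 : ∑ k, G (v' k) * G ⁅p, ⁅u, (v k : g)⁆⁆ = -∑ k, G (v' k) * G ⁅⁅u, (v k : g)⁆, p⁆ := by
    rw [← Finset.sum_neg_distrib]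
    refine Finset.sum_congr rfl fun k _ => ?_
    rw [← lie_skew p, map_neg, mul_neg]
  have hc3 : ∑ i, ∑ k, B f ⁅p, (v' k : g)⁆ • (G ⁅⁅u, (v i : g)⁆, (v k : g)⁆ * G (v' i)) =
      ∑ i, G (v' i) * G ⁅⁅u, (v i : g)⁆, p⁆ := by
    refine Finset.sum_congr rfl fun i _ => ?_
    have := sum_omega_left h (G ∘ₗ (LieAlgebra.ad F g ⁅u, (v i : g)⁆ : g →ₗ[F] g)) hp
    simp only [LinearMap.comp_apply, LieAlgebra.ad_apply] at this
    rw [← this, Finset.mul_sum]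
    refine Finset.sum_congr rfl fun k _ => ?_
    rw [mul_smul_comm, mul_comm]
  have hc2 : ∑ i, ∑ k, B f ⁅p, (v' i : g)⁆ • (G (v' k) * G ⁅⁅u, (v i : g)⁆, (v k : g)⁆) =
      ∑ k, G (v' k) * G ⁅⁅u, p⁆, (v k : g)⁆ := by
    rw [Finset.sum_comm]
    refine Finset.sum_congr rfl fun k _ => ?_
    have := sum_omega_left h (G ∘ₗ ((LieAlgebra.ad F g : g →ₗ[F] Module.End F g).flip (v k)) ∘ₗ
      (LieAlgebra.ad F g u : g →ₗ[F] g)) hp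
    simp only [LinearMap.comp_apply, LieAlgebra.ad_apply] at this
    have h' : G ⁅⁅u, p⁆, (v k : g)⁆ = ∑ i, B f ⁅p, (v' i : g)⁆ • G ⁅⁅u, (v i : g)⁆, (v k : g)⁆ := this.symm
    rw [h', Finset.mul_sum]
    refine Finset.sum_congr rfl fun i _ => ?_
    rw [mul_smul_comm]
  have key : ∑ i, ∑ k, B f ⁅p, ⁅⁅u, (v i : g)⁆, (v k : g)⁆⁆ • (G (v' k) * G (v' i)) +
      ∑ k, G (v' k) * G ⁅⁅u, p⁆, (v k : g)⁆ = (2 : F) • ∑ k, G (v' k) * G ⁅⁅u, (v k : g)⁆, p⁆ := by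
    have h2 : ∑ k, G (v' k) * G ⁅⁅u, p⁆, (v k : g)⁆ =
        ∑ i, ∑ k, B f ⁅(v i : g), ⁅⁅u, p⁆, (v k : g)⁆⁆ • (G (v' k) * G (v' i)) := by
      rw [Finset.sum_comm]
      refine Finset.sum_congr rfl fun k _ => ?_
      rw [← sum_omega_right h G (hu1 p hp _ (v k).2), Finset.mul_sum]
      simp only [mul_smul_comm]
    have h3 : ∑ k, G (v' k) * G ⁅⁅u, (v k : g)⁆, p⁆ =
        ∑ i, ∑ k, B f ⁅(v i : g), ⁅⁅u, (v k : g)⁆, p⁆⁆ • (G (v' k) * G (v' i)) := by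
      rw [Finset.sum_comm]
      refine Finset.sum_congr rfl fun k _ => ?_
      rw [← sum_omega_right h G (hu1 _ (v k).2 p hp), Finset.mul_sum]
      simp only [mul_smul_comm]
    -- Once everything is expanded in the products `v^k v^i`, the difference of the two sides has
    -- antisymmetric coefficients, while the products commute.
    have h4 := sum_sum_eq_zero_of_antisymm (τ := fun i k =>
      B f ⁅p, ⁅⁅u, (v i : g)⁆, (v k : g)⁆⁆ + B f ⁅(v i : g), ⁅⁅u, p⁆, (v k : g)⁆⁆ -
        2 * B f ⁅(v i : g), ⁅⁅u, (v k : g)⁆, p⁆⁆) (fun i k => ?_) (fun k => G (v' k))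
    · beta_reduce at h4
      rw [h2, h3, ← sub_eq_zero, Finset.smul_sum, ← Finset.sum_add_distrib,
        ← Finset.sum_sub_distrib, ← h4]
      refine Finset.sum_congr rfl fun i _ => ?_
      rw [Finset.smul_sum, ← Finset.sum_add_distrib, ← Finset.sum_sub_distrib]
      refine Finset.sum_congr rfl fun k _ => ?_
      rw [mul_comm (G (v' k))]
      module
    · have hm : ∀ a ∈ ({p, (v i : g), (v k : g)} : Set g), a ∈ halfGrade (F := F) x 1 := by
        rintro a (rfl | rfl | rfl)
        exacts [hp, (v i).2, (v k).2]
      exact form_f_lie_symm (fun a ha b hb => hκ a (hm a ha) b (hm b hb))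
        fun a ha => he a (hm a ha)
  simp only [algebraMap_mul_eq_smul, mul_add, mul_smul_comm, Finset.sum_add_distrib]
  rw [hc3, hc2, hq1, hq2, ← lie_skew p u, map_neg, eq_sub_of_add_eq key]
  module

/-- Symmetry of the Casimir tensor makes the two halves of the first sum equal. Expanding `[p,a^j]`
in the `v^k` and contracting over `j` turns each into `-∑ v^k [p,[f,v_k]]`. -/
theorem sum_casimir_eq_zero {A : Type*} [CommRing A] [Algebra F A]
    {v v' : Module.Basis (Fin n) F (halfGrade (F := F) x 1)}
    (t : IsSl2Triple ((2 : F) • x) e f) (hinv : B.lieInvariant g) (hsymm : B.IsSymm)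
    (h : AreDual (fun p q => B f ⁅p, q⁆) (fun k => (v k : g)) (fun k => (v' k : g))) {m : ℕ}
    {a a' : Module.Basis (Fin m) F (halfGrade (F := F) x 0)}
    (ha : AreDual (fun p q => B p q) (fun k => (a k : g)) (fun k => (a' k : g))) {p : g}
    (hp : p ∈ halfGrade (F := F) x 1) (G : g →ₗ[F] A) :
    (1 / 2 : F) • ∑ j, (G (a j) * G ⁅p, (a' j : g)⁆ + G (a' j) * G ⁅p, (a j : g)⁆) +
      ∑ k, G (v' k) * G ⁅p, ⁅f, (v k : g)⁆⁆ = 0 := by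
  have h1 := AreDual.sum_swap (β := B) ha (ε := 1) (fun p q => by rw [one_mul, hsymm.eq])
    (((LinearMap.mul F A).compl₁₂ G (G ∘ₗ (LieAlgebra.ad F g p : g →ₗ[F] g))))
  simp only [LinearMap.compl₁₂_apply, LinearMap.mul_apply', LinearMap.comp_apply,
    LieAlgebra.ad_apply, one_smul] at h1
  have h2 : ∑ j, G (a j) * G ⁅p, (a' j : g)⁆ = -∑ k, G (v' k) * G ⁅p, ⁅f, (v k : g)⁆⁆ := by
    have h3 : ∀ j, G (a j) * G ⁅p, (a' j : g)⁆ =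
        ∑ k, -(B ⁅p, ⁅f, (v k : g)⁆⁆ (a' j) • (G (v' k) * G (a j))) := by
      intro j
      rw [← sum_omega_right h G (lie_mem_halfGrade_of_eq hp (a' j).2 (by norm_num)),
        Finset.mul_sum]
      refine Finset.sum_congr rfl fun k _ => ?_
      have : B f ⁅(v k : g), ⁅p, (a' j : g)⁆⁆ = -B ⁅p, ⁅f, (v k : g)⁆⁆ (a' j) := by
        rw [← form_lie_left hinv, hsymm.eq, form_lie_left hinv, form_lie_left hinv,
          ← lie_skew, map_neg]
      rw [mul_smul_comm, mul_comm, ← neg_smul, this]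
    simp only [h3]
    rw [Finset.sum_comm, ← Finset.sum_neg_distrib]
    refine Finset.sum_congr rfl fun k _ => ?_
    rw [← AreDual.sum_left (β := B) ha G (lie_mem_halfGrade_of_eq hp
      (lie_mem_halfGrade (f_mem t) (v k).2) (by norm_num)), Finset.mul_sum,
      ← Finset.sum_neg_distrib]
    simp only [mul_smul_comm]
  rw [Finset.sum_add_distrib, h1, ← two_smul F, smul_smul, h2]
  norm_num

variable [IsAlgClosed F] [FiniteDimensional F g]
  {v v' : Module.Basis (Fin n) F (halfGrade (F := F) x 1)}

/-- Because `a` centralises `f`, `ad a` preserves `(f|[·,·])` infinitesimally. Both factors of the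
quadratic term then contribute `[a,p]`, and the `½` makes their sum cancel `[p,a]`. -/
theorem actDer_phi_one (t : IsSl2Triple ((2 : F) • x) e f) (hinv : B.lieInvariant g)
    (h : AreDual (fun p q => B f ⁅p, q⁆) (fun k => (v k : g)) (fun k => (v' k : g))) {a p : g}
    (ha0 : a ∈ halfGrade (F := F) x 0) (ha : a ∈ centr (F := F) f)
    (hp : p ∈ halfGrade (F := F) x 1) :
    actDer B x f p (phi x (fun k => (v k : g)) (fun k => (v' k : g)) a) = 0 := by
  have hav : ∀ k, ⁅a, (v k : g)⁆ ∈ halfGrade (F := F) x 1 := fun k =>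
    lie_mem_halfGrade_of_eq ha0 (v k).2 (by norm_num)
  have hap : ⁅a, p⁆ ∈ halfGrade (F := F) x 1 := lie_mem_halfGrade_of_eq ha0 hp (by norm_num)
  have H1 := HasAct.genLE_of_ne t hinv hp ha0 (by norm_num) (by norm_num) (by norm_num)
  have H2 := fun k => (HasAct.genLE_two t hinv hp (hav k) le_rfl (by norm_num)).mul
    (HasAct.genLE_two t hinv hp (v' k).2 le_rfl (by norm_num))
  refine (H1.add ((HasAct.sum Finset.univ H2).smul (1 / 2 : F))).actDer_eq_zero ?_ (by simp)
  have h1 : ∀ k, B f ⁅p, ⁅a, (v k : g)⁆⁆ = B f ⁅(v k : g), ⁅a, p⁆⁆ := by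
    intro k
    have := form_f_lie_of_centr hinv ha ⁅p, (v k : g)⁆
    rw [leibniz_lie, map_add, form_f_lie_skew ⁅a, p⁆] at this
    linear_combination this
  simp only [algebraMap_mul_eq_smul, h1, Finset.sum_add_distrib]
  rw [sum_omega_right h (genLE x) hap]
  have h2 := sum_omega_left h (genLE x ∘ₗ (LieAlgebra.ad F g a : g →ₗ[F] g)) hp
  simp only [LinearMap.comp_apply, LieAlgebra.ad_apply] at h2
  rw [h2, ← lie_skew p a, map_neg]
  module

theorem actDer_phi_e (t : IsSl2Triple ((2 : F) • x) e f) (hinv : B.lieInvariant g) {a : g}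
    (ha0 : a ∈ halfGrade (F := F) x 0) (ha : a ∈ centr (F := F) f) :
    actDer B x f e (phi x (fun k => (v k : g)) (fun k => (v' k : g)) a) = 0 := by
  have hav : ∀ k, ⁅a, (v k : g)⁆ ∈ halfGrade (F := F) x 1 := fun k =>
    lie_mem_halfGrade_of_eq ha0 (v k).2 (by norm_num)
  have H1 := HasAct.genLE_two t hinv (e_mem t) ha0 (by norm_num) (by norm_num)
  have H2 := fun k => (HasAct.genLE_three t hinv (e_mem t) (hav k) le_rfl (by norm_num)).mul
    (HasAct.genLE_three t hinv (e_mem t) (v' k).2 le_rfl (by norm_num))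
  refine (H1.add ((HasAct.sum Finset.univ H2).smul (1 / 2 : F))).actDer_eq_zero ?_ (by simp)
  rw [form_f_lie_skew, form_f_lie_of_centr hinv ha]
  simp

/-- The λ-free part is `sum_cubic_eq_zero`. In the coefficient of `λ`, `∂[e,u]` contributes
`(f|[p,[e,u]]) = -(p|u)` against `(p|u)` from `u`. -/
theorem actDer_psi_one (t : IsSl2Triple ((2 : F) • x) e f) (hinv : B.lieInvariant g)
    (h : AreDual (fun p q => B f ⁅p, q⁆) (fun k => (v k : g)) (fun k => (v' k : g))) {κ : F}
    (hκ : ∀ a ∈ halfGrade (F := F) x 1, ∀ b ∈ halfGrade (F := F) x 1,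
      ⁅a, b⁆ = (κ * B f ⁅a, b⁆) • e)
    (he : ∀ a ∈ halfGrade (F := F) x 1, ⁅e, a⁆ = 0) {u p : g}
    (hu : u ∈ halfGrade (F := F) x (-1)) (hp : p ∈ halfGrade (F := F) x 1) :
    actDer B x f p (psi x e (fun k => (v k : g)) (fun k => (v' k : g)) u) = 0 := by
  have hu0 : ∀ a ∈ halfGrade (F := F) x 1, ⁅u, a⁆ ∈ halfGrade (F := F) x 0 := fun a ha =>
    lie_mem_halfGrade_of_eq hu ha (by norm_num)
  have hu1 : ∀ a ∈ halfGrade (F := F) x 1, ∀ b ∈ halfGrade (F := F) x 1,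
      ⁅⁅u, a⁆, b⁆ ∈ halfGrade (F := F) x 1 := fun a ha b hb =>
    lie_mem_halfGrade_of_eq (hu0 a ha) hb (by norm_num)
  have heu : ⁅e, u⁆ ∈ halfGrade (F := F) x 1 :=
    lie_mem_halfGrade_of_eq (e_mem t) hu (by norm_num)
  have H1 := HasAct.genLE_zero t hinv hp hu (by norm_num) (by norm_num)
  have H2 := fun i k => ((HasAct.genLE_two t hinv hp (hu1 _ (v i).2 _ (v k).2) le_rfl
    (by norm_num)).mul (HasAct.genLE_two t hinv hp (v' i).2 le_rfl (by norm_num))).mul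
      (HasAct.genLE_two t hinv hp (v' k).2 le_rfl (by norm_num))
  have H3 := fun k => (HasAct.genLE_of_ne t hinv hp (hu0 _ (v k).2) (by norm_num) (by norm_num)
    (by norm_num)).mul (HasAct.genLE_two t hinv hp (v' k).2 le_rfl (by norm_num))
  have H4 := (HasAct.genLE_two t hinv hp heu le_rfl (by norm_num)).deriv
  refine (((H1.add ((HasAct.sum Finset.univ fun i => HasAct.sum Finset.univ (H2 i)).smul
    (1 / 3 : F))).add (HasAct.sum Finset.univ H3)).add H4).actDer_eq_zero ?_ ?_
  · rw [Derivation.map_algebraMap, add_zero]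
    exact sum_cubic_eq_zero h hκ he hu hp (genLE x)
  · simp [form_f_lie_lie_e t hinv hp (he p hp)]

/-- Only `u` and the quadratic sum are moved by `e`; the latter contributes `-[e,u]`, by expansion
in the `v^k`. -/
theorem actDer_psi_e (t : IsSl2Triple ((2 : F) • x) e f) (hinv : B.lieInvariant g)
    (h : AreDual (fun p q => B f ⁅p, q⁆) (fun k => (v k : g)) (fun k => (v' k : g)))
    (he : ∀ a ∈ halfGrade (F := F) x 1, ⁅e, a⁆ = 0) {u : g}
    (hu : u ∈ halfGrade (F := F) x (-1)) :
    actDer B x f e (psi x e (fun k => (v k : g)) (fun k => (v' k : g)) u) = 0 := by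
  have hu0 : ∀ a ∈ halfGrade (F := F) x 1, ⁅u, a⁆ ∈ halfGrade (F := F) x 0 := fun a ha =>
    lie_mem_halfGrade_of_eq hu ha (by norm_num)
  have hu1 : ∀ a ∈ halfGrade (F := F) x 1, ∀ b ∈ halfGrade (F := F) x 1,
      ⁅⁅u, a⁆, b⁆ ∈ halfGrade (F := F) x 1 := fun a ha b hb =>
    lie_mem_halfGrade_of_eq (hu0 a ha) hb (by norm_num)
  have heu : ⁅e, u⁆ ∈ halfGrade (F := F) x 1 :=
    lie_mem_halfGrade_of_eq (e_mem t) hu (by norm_num)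
  have H1 := HasAct.genLE_of_ne t hinv (e_mem t) hu (by norm_num) (by norm_num) (by norm_num)
  have H2 := fun i k => ((HasAct.genLE_three t hinv (e_mem t) (hu1 _ (v i).2 _ (v k).2) le_rfl
    (by norm_num)).mul (HasAct.genLE_three t hinv (e_mem t) (v' i).2 le_rfl (by norm_num))).mul
      (HasAct.genLE_three t hinv (e_mem t) (v' k).2 le_rfl (by norm_num))
  have H3 := fun k => (HasAct.genLE_two t hinv (e_mem t) (hu0 _ (v k).2) (by norm_num)
    (by norm_num)).mul (HasAct.genLE_three t hinv (e_mem t) (v' k).2 le_rfl (by norm_num))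
  have H4 := (HasAct.genLE_three t hinv (e_mem t) heu le_rfl (by norm_num)).deriv
  refine (((H1.add ((HasAct.sum Finset.univ fun i => HasAct.sum Finset.univ (H2 i)).smul
    (1 / 3 : F))).add (HasAct.sum Finset.univ H3)).add H4).actDer_eq_zero ?_ (by simp)
  have h1 : ∀ k, B f ⁅e, ⁅u, (v k : g)⁆⁆ = -B f ⁅(v k : g), ⁅e, u⁆⁆ := by
    intro k
    rw [leibniz_lie, he _ (v k).2, lie_zero, add_zero, form_f_lie_skew]
  have h2 := sum_omega_right h (genLE x) heu
  simp only [mul_zero, zero_add, add_zero, Finset.sum_const_zero, smul_zero, map_zero, h1,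
    algebraMap_mul_eq_smul, neg_smul, Finset.sum_neg_distrib, h2]
  exact add_neg_cancel _

variable {m : ℕ} {a a' : Module.Basis (Fin m) F (halfGrade (F := F) x 0)}

/-- Without `λ`: the Casimir cancels `∑ v^k [p,[f,v_k]]`, `[f,p]` cancels `[p,f]`, and `½∂p` cancels
`∂[p,x]`. The coefficient of `λ` is `-½p + p - ½p`. -/
theorem actDer_virL_one (t : IsSl2Triple ((2 : F) • x) e f) (hinv : B.lieInvariant g)
    (hsymm : B.IsSymm)
    (h : AreDual (fun p q => B f ⁅p, q⁆) (fun k => (v k : g)) (fun k => (v' k : g)))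
    (ha : AreDual (fun p q => B p q) (fun k => (a k : g)) (fun k => (a' k : g)))
    {p : g}
    (hp : p ∈ halfGrade (F := F) x 1) :
    actDer B x f p (virL x f (fun k => (v k : g)) (fun k => (v' k : g)) (fun k => (a k : g))
      (fun k => (a' k : g))) = 0 := by
  have hfv : ∀ k, ⁅f, (v k : g)⁆ ∈ halfGrade (F := F) x (-1) := fun k =>
    lie_mem_halfGrade_of_eq (f_mem t) (v k).2 (by norm_num)
  have H1 := HasAct.genLE_of_ne t hinv hp (f_mem t) (by norm_num) (by norm_num) (by norm_num)
  have H2 := (HasAct.genLE_of_ne t hinv hp x_mem (by norm_num) (by norm_num) (by norm_num)).deriv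
  have H3 := fun j => (HasAct.genLE_of_ne t hinv hp (a j).2 (by norm_num) (by norm_num)
    (by norm_num)).mul (HasAct.genLE_of_ne t hinv hp (a' j).2 (by norm_num) (by norm_num)
    (by norm_num))
  have H4 := fun k => (HasAct.genLE_two t hinv hp (v' k).2 le_rfl (by norm_num)).mul
    (HasAct.genLE_zero t hinv hp (hfv k) (by norm_num) (by norm_num))
  have H5 := fun k => (HasAct.genLE_two t hinv hp (v' k).2 le_rfl (by norm_num)).mul
    (HasAct.genLE_two t hinv hp (v k).2 le_rfl (by norm_num)).deriv
  have hpx : ⁅p, x⁆ = -((1 / 2 : F) • p) := by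
    rw [← lie_skew, mem_halfGrade.1 hp]; norm_num
  refine ((((H1.add H2).add ((HasAct.sum Finset.univ H3).smul (1 / 2 : F))).add
    (HasAct.sum Finset.univ H4)).add ((HasAct.sum Finset.univ H5).smul (1 / 2 : F))).actDer_eq_zero
      ?_ ?_
  · have h1 := sum_casimir_eq_zero t hinv hsymm h ha hp (genLE x)
    have h2 := sum_omega_left h (genLE x ∘ₗ (LieAlgebra.ad F g f : g →ₗ[F] g)) hp
    have h3 := sum_omega_left h (deriv.toLinearMap ∘ₗ genLE x) hp
    simp only [LinearMap.comp_apply, LieAlgebra.ad_apply, Derivation.coeFn_coe] at h2 h3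
    simp only [Derivation.map_algebraMap, mul_zero, zero_add, algebraMap_mul_eq_smul, h3,
      Finset.sum_add_distrib, h2]
    rw [Finset.sum_add_distrib] at h1
    have h5 : deriv (genLE (F := F) x ⁅p, x⁆) = -((1 / 2 : F) • deriv (genLE (F := F) x p)) := by
      rw [hpx, map_neg, map_neg, map_smul, Derivation.map_smul]
    rw [eq_neg_of_add_eq_zero_right h1, ← lie_skew p f, h5, map_neg]
    module
  · have h2 := sum_omega_right h (genLE x) hp
    have h4 : ∑ k, B f ⁅p, (v k : g)⁆ • genLE (F := F) x (v' k : g) = -genLE (F := F) x p := by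
      rw [← h2, ← Finset.sum_neg_distrib]
      exact Finset.sum_congr rfl fun k _ => by rw [form_f_lie_skew, neg_smul]
    simp only [mul_zero, add_zero, algebraMap_mul_eq_smul, form_lie_f hinv, h4, h2,
      Finset.sum_const_zero, smul_zero, hpx, map_neg, map_smul]
    module

/-- The Casimir contributes `[f,e]` against `[e,f]`, and `∑ v^k [e,[f,v_k]] = ∑ v^k v_k` vanishes
because the canonical tensor of a skew form is skew. The `λ`-terms from `f` and `∂x` cancel. -/
theorem actDer_virL_e (t : IsSl2Triple ((2 : F) • x) e f) (hinv : B.lieInvariant g)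
    (hsymm : B.IsSymm)
    (h : AreDual (fun p q => B f ⁅p, q⁆) (fun k => (v k : g)) (fun k => (v' k : g)))
    (ha : AreDual (fun p q => B p q) (fun k => (a k : g)) (fun k => (a' k : g)))
    (he : ∀ a ∈ halfGrade (F := F) x 1, ⁅e, a⁆ = 0) :
    actDer B x f e (virL x f (fun k => (v k : g)) (fun k => (v' k : g)) (fun k => (a k : g))
      (fun k => (a' k : g))) = 0 := by
  have hfv : ∀ k, ⁅f, (v k : g)⁆ ∈ halfGrade (F := F) x (-1) := fun k =>
    lie_mem_halfGrade_of_eq (f_mem t) (v k).2 (by norm_num)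
  have hE := e_mem t
  have H1 := HasAct.genLE_zero t hinv hE (f_mem t) (by norm_num) (by norm_num)
  have H2 := (HasAct.genLE_two t hinv hE x_mem (by norm_num) (by norm_num)).deriv
  have H3 := fun j => (HasAct.genLE_two t hinv hE (a j).2 (by norm_num) (by norm_num)).mul
    (HasAct.genLE_two t hinv hE (a' j).2 (by norm_num) (by norm_num))
  have H4 := fun k => (HasAct.genLE_three t hinv hE (v' k).2 le_rfl (by norm_num)).mul
    (HasAct.genLE_of_ne t hinv hE (hfv k) (by norm_num) (by norm_num) (by norm_num))
  have H5 := fun k => (HasAct.genLE_three t hinv hE (v' k).2 le_rfl (by norm_num)).mul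
    (HasAct.genLE_three t hinv hE (v k).2 le_rfl (by norm_num)).deriv
  refine ((((H1.add H2).add ((HasAct.sum Finset.univ H3).smul (1 / 2 : F))).add
    (HasAct.sum Finset.univ H4)).add ((HasAct.sum Finset.univ H5).smul (1 / 2 : F))).actDer_eq_zero
      ?_ ?_
  · have hfe : ⁅f, e⁆ ∈ halfGrade (F := F) x 0 :=
      lie_mem_halfGrade_of_eq (f_mem t) hE (by norm_num)
    have h1 : ∑ j, B f ⁅e, (a' j : g)⁆ • genLE (F := F) x (a j : g) = genLE (F := F) x ⁅f, e⁆ := by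
      rw [← AreDual.sum_left (β := B) ha (genLE x) hfe]
      simp only [form_lie_left hinv]
    have h2 : ∑ j, B f ⁅e, (a j : g)⁆ • genLE (F := F) x (a' j : g) = genLE (F := F) x ⁅f, e⁆ := by
      rw [← AreDual.sum_right (β := B) ha (genLE x) hfe]
      refine Finset.sum_congr rfl fun j _ => ?_
      rw [← form_lie_left hinv, hsymm.eq]
    have h3 := fun k => lie_e_lie_f_of_lie_e t (v k).2 (he _ (v k).2)
    have h4 := AreDual.sum_swap (β := omega B f) h (ε := -1) (fun p q => by
      rw [omega_apply, omega_apply, form_f_lie_skew, neg_one_mul])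
      ((LinearMap.mul F (DiffPoly F (gradeLE (F := F) x 1))).compl₁₂ (genLE x) (genLE x))
    simp only [LinearMap.compl₁₂_apply, LinearMap.mul_apply'] at h4
    have h5 : ∑ k, genLE (F := F) x (v' k : g) * genLE (F := F) x (v k : g) = 0 := by
      simp only [mul_comm (genLE x (v _ : g))] at h4
      have h6 : (2 : F) • ∑ k, genLE (F := F) x (v' k : g) * genLE (F := F) x (v k : g) = 0 := by
        rw [two_smul]
        nth_rewrite 1 [h4]
        rw [neg_one_smul]
        exact neg_add_cancel _
      exact (smul_eq_zero.1 h6).resolve_left two_ne_zero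
    simp only [Derivation.map_algebraMap, mul_zero, add_zero, map_zero,
      algebraMap_mul_eq_smul, Finset.sum_add_distrib, h1, h2, h3, h5, Finset.sum_const_zero,
      smul_zero]
    rw [← lie_skew e f, map_neg]
    module
  · have h1 : B f ⁅e, x⁆ = -B e f := by
      rw [← lie_skew, lie_x_e t, map_neg, hsymm.eq]
    simp [h1]

end Minimal

/-! ### Minimal case: images under `π` and existence of dual bases -/

section Minimal

variable {F : Type*} [Field F] [CharZero F] {g : Type*} [LieRing g] [LieAlgebra F g]
  {B : LinearMap.BilinForm F g} {x e f s : g}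

theorem form_x_eq_zero (t : IsSl2Triple ((2 : F) • x) e f) (hinv : B.lieInvariant g) {c : g}
    (hc : c ∈ centr (F := F) f) : B x c = 0 := by
  have h : B ((2 : F) • x) c = 0 := by
    rw [← t.lie_e_f, form_lie_left hinv, mem_centr.1 hc, map_zero]
  rw [map_smul, LinearMap.smul_apply] at h
  exact (smul_eq_zero.1 h).resolve_left two_ne_zero

/-- `[f,y]` is a multiple of `f = [f,x]`. This gives `g_0 = F x + g_0^f`. -/
theorem exists_sub_smul_x_mem_centr (t : IsSl2Triple ((2 : F) • x) e f)
    (hf : halfGrade (F := F) x (-2) = Submodule.span F {f}) {y : g}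
    (hy : y ∈ halfGrade (F := F) x 0) :
    ∃ r : F, y - r • x ∈ (halfGrade x 0 ⊓ centr f : Submodule F g) := by
  have h : ⁅f, y⁆ ∈ halfGrade (F := F) x (-2) :=
    lie_mem_halfGrade_of_eq (f_mem t) hy (by norm_num)
  rw [hf] at h
  obtain ⟨r, hr⟩ := Submodule.mem_span_singleton.1 h
  refine ⟨r, sub_mem hy (Submodule.smul_mem _ _ x_mem), ?_⟩
  rw [SetLike.mem_coe, mem_centr, lie_sub, lie_smul, lie_f_x t, hr, sub_self]

variable [IsAlgClosed F] [FiniteDimensional F g] {n : ℕ}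
  {v v' : Module.Basis (Fin n) F (halfGrade (F := F) x 1)}

/-- `p = [e,[f,p]]` lies in `[e, g_{≤-1/2}]`. Hence `π` kills every product with a factor `v^k`. -/
theorem piHom_genLE_one (t : IsSl2Triple ((2 : F) • x) e f)
    (he : ∀ a ∈ halfGrade (F := F) x 1, ⁅e, a⁆ = 0) {p : g} (hp : p ∈ halfGrade (F := F) x 1) :
    piHom (F := F) x e f (genLE (F := F) x p) = 0 := by
  rw [← lie_e_lie_f_of_lie_e t hp (he p hp)]
  exact piHom_genLE_lie_e t (lie_f_mem t hp) (by norm_num)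

theorem piHom_phi (t : IsSl2Triple ((2 : F) • x) e f)
    (he : ∀ a ∈ halfGrade (F := F) x 1, ⁅e, a⁆ = 0) {a : g} (ha : a ∈ centr (F := F) f) :
    piHom x e f (phi x (fun k => (v k : g)) (fun k => (v' k : g)) a) =
      gen 0 (⟨a, ha⟩ : centr (F := F) f) := by
  rw [phi, map_add, map_smul, map_sum, piHom_genLE_of_mem_centr t ha]
  simp only [map_mul, piHom_genLE_one t he (v' _).2, mul_zero, Finset.sum_const_zero, smul_zero,
    add_zero]

theorem piHom_psi (t : IsSl2Triple ((2 : F) • x) e f)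
    (he : ∀ a ∈ halfGrade (F := F) x 1, ⁅e, a⁆ = 0) {u : g}
    (hu : u ∈ halfGrade (F := F) x (-1)) (huf : u ∈ centr (F := F) f) :
    piHom x e f (psi x e (fun k => (v k : g)) (fun k => (v' k : g)) u) =
      gen 0 (⟨u, huf⟩ : centr (F := F) f) := by
  rw [psi, map_add, map_add, map_add, map_smul, map_sum, map_sum, piHom_deriv,
    piHom_genLE_of_mem_centr t huf, piHom_genLE_lie_e t hu le_rfl]
  simp only [map_sum, map_mul, piHom_genLE_one t he (v' _).2, mul_zero, Finset.sum_const_zero,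
    smul_zero, add_zero, map_zero]

variable {m l : ℕ} {a a' : Module.Basis (Fin m) F (halfGrade (F := F) x 0)}
  {c c' : Module.Basis (Fin l) F (halfGrade x 0 ⊓ centr f : Submodule F g)}

/-- `x` is orthogonal to `g_0^f` and killed by `π`, so the Casimir tensor of `g_0` maps to that of
`g_0^f`. This is why subtracting `½ ∑ φ(c_i)φ(c^i)` from `L` leaves an element over `f`. -/
theorem sum_piHom_genLE (t : IsSl2Triple ((2 : F) • x) e f) (hinv : B.lieInvariant g)
    (hsymm : B.IsSymm) (hf : halfGrade (F := F) x (-2) = Submodule.span F {f})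
    (ha : AreDual (fun p q => B p q) (fun k => (a k : g)) (fun k => (a' k : g)))
    (hc : AreDual (fun p q => B p q) (fun k => (c k : g)) (fun k => (c' k : g))) :
    ∑ j, piHom (F := F) x e f (genLE (F := F) x (a j : g)) *
        piHom (F := F) x e f (genLE (F := F) x (a' j : g)) =
      ∑ i, piHom (F := F) x e f (genLE (F := F) x (c i : g)) *
        piHom (F := F) x e f (genLE (F := F) x (c' i : g)) := by
  let Γ : g →ₗ[F] DiffPoly F (centr (F := F) f) := (piHom x e f).toLinearMap ∘ₗ genLE x
  change ∑ j, Γ (a j) * Γ (a' j) = ∑ i, Γ (c i) * Γ (c' i)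
  have hΓ : ∀ y ∈ halfGrade (F := F) x 0, Γ y = ∑ i, B y (c' i) • Γ (c i) := by
    intro y hy
    obtain ⟨r, hr⟩ := exists_sub_smul_x_mem_centr t hf hy
    have h1 : Γ x = 0 := piHom_genLE_of_mem_lieE t (x_mem_lieE t)
    have h2 := AreDual.sum_left (β := B) hc Γ hr
    simp only [map_sub, map_smul, LinearMap.sub_apply, LinearMap.smul_apply, h1, smul_zero,
      sub_zero, form_x_eq_zero t hinv (c' _).2.2] at h2
    exact h2.symm
  have h3 : ∀ j, Γ (a j) * Γ (a' j) = ∑ i, B (c' i) (a' j) • (Γ (c i) * Γ (a j)) := by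
    intro j
    rw [hΓ _ (a' j).2, Finset.mul_sum]
    refine Finset.sum_congr rfl fun i _ => ?_
    rw [mul_smul_comm, mul_comm, hsymm.eq]
  simp only [h3]
  rw [Finset.sum_comm]
  refine Finset.sum_congr rfl fun i _ => ?_
  rw [← AreDual.sum_left (β := B) ha Γ (c' i).2.1, Finset.mul_sum]
  simp only [mul_smul_comm]

theorem piHom_virLTilde (t : IsSl2Triple ((2 : F) • x) e f) (hinv : B.lieInvariant g)
    (hsymm : B.IsSymm) (he : ∀ a ∈ halfGrade (F := F) x 1, ⁅e, a⁆ = 0)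
    (hf : halfGrade (F := F) x (-2) = Submodule.span F {f})
    (ha : AreDual (fun p q => B p q) (fun k => (a k : g)) (fun k => (a' k : g)))
    (hc : AreDual (fun p q => B p q) (fun k => (c k : g)) (fun k => (c' k : g)))
    (hff : f ∈ centr (F := F) f) :
    piHom x e f (virLTilde x f (fun k => (v k : g)) (fun k => (v' k : g)) (fun k => (a k : g))
      (fun k => (a' k : g)) (fun k => (c k : g)) (fun k => (c' k : g))) =
      gen 0 (⟨f, hff⟩ : centr (F := F) f) := by
  have h1 := sum_piHom_genLE t hinv hsymm hf ha hc
  have h2 : ∀ y : (halfGrade x 0 ⊓ centr f : Submodule F g),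
      piHom x e f (phi x (fun k => (v k : g)) (fun k => (v' k : g)) (y : g)) =
        piHom x e f (genLE x (y : g)) := fun y => by
    rw [piHom_phi t he y.2.2, piHom_genLE_of_mem_centr t y.2.2]
  rw [virLTilde, virL, map_sub]
  simp only [map_add, map_smul, map_sum, map_mul, h1, h2, piHom_genLE_one t he (v' _).2, zero_mul,
    Finset.sum_const_zero, smul_zero, add_zero, piHom_deriv,
    piHom_genLE_of_mem_lieE t (x_mem_lieE t), map_zero, piHom_genLE_of_mem_centr t hff]
  exact add_sub_cancel_right _ _

/-- Non-degeneracy of the skew form on `g_{1/2}`: `ad f` is injective there, and `g_{-1/2}` pairs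
non-degenerately with `g_{1/2}`. -/
theorem exists_areDual_omega (t : IsSl2Triple ((2 : F) • x) e f) (hB : B.Nondegenerate)
    (hinv : B.lieInvariant g) :
    ∃ (n : ℕ) (v v' : Module.Basis (Fin n) F (halfGrade (F := F) x 1)),
      AreDual (fun p q => B f ⁅p, q⁆) (fun k => (v k : g)) (fun k => (v' k : g)) := by
  have h : ∀ p ∈ halfGrade (F := F) x 1, (∀ q ∈ halfGrade (F := F) x 1, B f ⁅p, q⁆ = 0) →
      p = 0 := by
    intro p hp h
    refine eq_zero_of_lie_f t (by norm_num) hp ?_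
    refine eq_zero_of_forall_form t hB hinv (lie_f_mem t hp) fun b hb => ?_
    rw [form_lie_left hinv]
    exact h b (by simpa using hb)
  refine exists_areDual (omega B f) h fun q hq h' => h q hq fun p hp => ?_
  rw [form_f_lie_skew, ← omega_apply, h' p hp, neg_zero]

theorem exists_areDual_form (t : IsSl2Triple ((2 : F) • x) e f) (hB : B.Nondegenerate)
    (hsymm : B.IsSymm) (hinv : B.lieInvariant g) {i j : ℤ} (hij : i + j = 0) :
    ∃ (n : ℕ) (a : Module.Basis (Fin n) F (halfGrade (F := F) x i))
      (a' : Module.Basis (Fin n) F (halfGrade (F := F) x j)),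
      AreDual (fun p q => B p q) (fun k => (a k : g)) (fun k => (a' k : g)) := by
  obtain rfl := eq_neg_of_add_eq_zero_right hij
  refine exists_areDual B (fun p hp h => eq_zero_of_forall_form t hB hinv hp h) fun q hq h =>
    eq_zero_of_forall_form t hB hinv hq fun b hb => ?_
  rw [neg_neg] at hb
  rw [hsymm.eq, h b hb]

end Minimal

/-! ### The isomorphism for minimal nilpotent elements -/

section Minimal

variable {F : Type*} [Field F] [CharZero F] [IsAlgClosed F] {g : Type*} [LieRing g]
  [LieAlgebra F g] [FiniteDimensional F g] [LieAlgebra.IsSimple F g]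
  {B : LinearMap.BilinForm F g} {x e f s : g}

theorem IsMinimalNilpotent.lie_e_eq_zero (hf : IsMinimalNilpotent F f)
    (t : IsSl2Triple ((2 : F) • x) e f) {a : g} (ha : a ∈ halfGrade (F := F) x 1) : ⁅e, a⁆ = 0 := by
  have := lie_mem_halfGrade_of_eq (k := 3) (e_mem t) ha (by norm_num)
  rw [hf.halfGrade_eq_bot t (by norm_num)] at this
  exact (Submodule.mem_bot F).1 this

theorem IsMinimalNilpotent.lie_eq_smul_e (hf : IsMinimalNilpotent F f)
    (t : IsSl2Triple ((2 : F) • x) e f) (hB : B.Nondegenerate) (hinv : B.lieInvariant g) {a b : g}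
    (ha : a ∈ halfGrade (F := F) x 1) (hb : b ∈ halfGrade (F := F) x 1) :
    ⁅a, b⁆ = ((B f e)⁻¹ * B f ⁅a, b⁆) • e := by
  have := lie_mem_halfGrade_of_eq (k := 2) ha hb (by norm_num)
  rw [hf.halfGrade_two t] at this
  obtain ⟨c, hc⟩ := Submodule.mem_span_singleton.1 this
  rw [← hc, map_smul, smul_eq_mul, mul_comm c,
    inv_mul_cancel_left₀ (form_f_e_ne_zero hf t hB hinv)]

theorem IsMinimalNilpotent.mem_W (hf : IsMinimalNilpotent F f)
    (t : IsSl2Triple ((2 : F) • x) e f) (hB : B.Nondegenerate) (hinv : B.lieInvariant g) {d : ℤ}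
    (hd : IsGreatest {i : ℤ | halfGrade (F := F) x i ≠ ⊥} d) (hs : s ∈ halfGrade (F := F) x d)
    (z : F) {P : DiffPoly F (gradeLE (F := F) x 1)}
    (h1 : ∀ p ∈ halfGrade (F := F) x 1, actDer B x f p P = 0) (h2 : actDer B x f e P = 0) :
    P ∈ W B x f s z := by
  rw [mem_W_iff t hB hinv hd hs]
  intro a ha
  obtain ⟨p, hp, q, hq, rfl⟩ := Submodule.mem_sup.1 (hf.gradeGE_one_le t ha)
  obtain ⟨r, rfl⟩ := Submodule.mem_span_singleton.1 hq
  rw [actDer_add_left, actDer_smul_left, h1 p hp, h2, smul_zero, add_zero]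

/-- The form stays non-degenerate on `g_0^f`, because `g_0 = F x + g_0^f` and `x` is orthogonal to
`g_0^f`. -/
theorem IsMinimalNilpotent.exists_areDual_centr (hf : IsMinimalNilpotent F f)
    (t : IsSl2Triple ((2 : F) • x) e f) (hB : B.Nondegenerate) (hsymm : B.IsSymm)
    (hinv : B.lieInvariant g) :
    ∃ (n : ℕ) (c c' : Module.Basis (Fin n) F (halfGrade x 0 ⊓ centr f : Submodule F g)),
      AreDual (fun p q => B p q) (fun k => (c k : g)) (fun k => (c' k : g)) := by
  have h : ∀ p ∈ (halfGrade x 0 ⊓ centr f : Submodule F g),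
      (∀ q ∈ (halfGrade x 0 ⊓ centr f : Submodule F g), B p q = 0) → p = 0 := by
    intro p hp h
    refine eq_zero_of_forall_form t hB hinv hp.1 fun y hy => ?_
    obtain ⟨r, hr⟩ := exists_sub_smul_x_mem_centr t (hf.halfGrade_neg_two t hB hinv) hy
    have := h _ hr
    rwa [map_sub, map_smul, ← hsymm.eq x, form_x_eq_zero t hinv hp.2, smul_zero, sub_zero] at this
  refine exists_areDual B h fun q hq h' => h q hq fun p hp => ?_
  rw [hsymm.eq, h' p hp]

theorem IsMinimalNilpotent.exists_equiv (hf : IsMinimalNilpotent F f)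
    (t : IsSl2Triple ((2 : F) • x) e f) (hB : B.Nondegenerate) (hsymm : B.IsSymm)
    (hinv : B.lieInvariant g) {d : ℤ} (hd : IsGreatest {i : ℤ | halfGrade (F := F) x i ≠ ⊥} d)
    (hs : s ∈ halfGrade (F := F) x d) (z : F) :
      ∃ E : W B x f s z ≃ₐ[F] DiffPoly F (centr (F := F) f),
        (∀ P, E P = piHom x e f P) ∧
        (∀ P, E (derivW B x f s z P) = deriv (E P)) ∧
        centr (F := F) f = (halfGrade x 0 ⊓ centr f) ⊔ halfGrade x (-1) ⊔ Submodule.span F {f} ∧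
        ∀ (n : ℕ) (v v' : Module.Basis (Fin n) F (halfGrade (F := F) x 1)),
          AreDual (fun p q => B f ⁅p, q⁆) (fun k => (v k : g)) (fun k => (v' k : g)) →
          (∀ a ∈ halfGrade (F := F) x 0, ∀ ha : a ∈ centr (F := F) f,
            (E.symm (gen 0 ⟨a, ha⟩) : DiffPoly F (gradeLE (F := F) x 1)) =
              phi x (fun k => (v k : g)) (fun k => (v' k : g)) a) ∧
          (∀ u ∈ halfGrade (F := F) x (-1), ∃ hu : u ∈ centr (F := F) f,
            (E.symm (gen 0 ⟨u, hu⟩) : DiffPoly F (gradeLE (F := F) x 1)) =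
              psi x e (fun k => (v k : g)) (fun k => (v' k : g)) u) ∧
          ∀ (m : ℕ) (a a' : Module.Basis (Fin m) F (halfGrade (F := F) x 0)),
            AreDual (fun p q => B p q) (fun k => (a k : g)) (fun k => (a' k : g)) →
          ∀ (l : ℕ) (c c' : Module.Basis (Fin l) F (halfGrade x 0 ⊓ centr f : Submodule F g)),
            AreDual (fun p q => B p q) (fun k => (c k : g)) (fun k => (c' k : g)) →
            ∃ hf : f ∈ centr (F := F) f,
              (E.symm (gen 0 ⟨f, hf⟩) : DiffPoly F (gradeLE (F := F) x 1)) =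
                virLTilde x f (fun k => (v k : g)) (fun k => (v' k : g))
                  (fun k => (a k : g)) (fun k => (a' k : g))
                  (fun k => (c k : g)) (fun k => (c' k : g)) := by
  have he : ∀ a ∈ halfGrade (F := F) x 1, ⁅e, a⁆ = 0 := fun a => hf.lie_e_eq_zero t
  have hκ := fun a (ha : a ∈ halfGrade (F := F) x 1) b (hb : b ∈ halfGrade (F := F) x 1) =>
    hf.lie_eq_smul_e t hB hinv ha hb
  have hc := hf.centr_eq t hB hinv
  have hu : halfGrade (F := F) x (-1) ≤ centr f := by
    rw [hc]; exact le_sup_right.trans le_sup_left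
  have hff : f ∈ centr (F := F) f := mem_centr.2 (lie_self f)
  have hW := fun {P} => hf.mem_W (P := P) t hB hinv hd hs z
  have hphi : ∀ {n : ℕ} {v v' : Module.Basis (Fin n) F (halfGrade (F := F) x 1)},
      AreDual (fun p q => B f ⁅p, q⁆) (fun k => (v k : g)) (fun k => (v' k : g)) →
      ∀ a ∈ halfGrade (F := F) x 0, a ∈ centr (F := F) f →
        phi x (fun k => (v k : g)) (fun k => (v' k : g)) a ∈ W B x f s z :=
    fun h a ha0 ha => hW (fun p => actDer_phi_one t hinv h ha0 ha) (actDer_phi_e t hinv ha0 ha)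
  have hpsi : ∀ {n : ℕ} {v v' : Module.Basis (Fin n) F (halfGrade (F := F) x 1)},
      AreDual (fun p q => B f ⁅p, q⁆) (fun k => (v k : g)) (fun k => (v' k : g)) →
      ∀ u ∈ halfGrade (F := F) x (-1),
        psi x e (fun k => (v k : g)) (fun k => (v' k : g)) u ∈ W B x f s z :=
    fun h u hu => hW (fun p => actDer_psi_one t hinv h hκ he hu) (actDer_psi_e t hinv h he hu)
  have hL : ∀ {n m l : ℕ} {v v' : Module.Basis (Fin n) F (halfGrade (F := F) x 1)}
      {a a' : Module.Basis (Fin m) F (halfGrade (F := F) x 0)}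
      {c c' : Module.Basis (Fin l) F (halfGrade x 0 ⊓ centr f : Submodule F g)},
      AreDual (fun p q => B f ⁅p, q⁆) (fun k => (v k : g)) (fun k => (v' k : g)) →
      AreDual (fun p q => B p q) (fun k => (a k : g)) (fun k => (a' k : g)) →
        virLTilde x f (fun k => (v k : g)) (fun k => (v' k : g)) (fun k => (a k : g))
          (fun k => (a' k : g)) (fun k => (c k : g)) (fun k => (c' k : g)) ∈ W B x f s z :=
    fun {n m l v v' a a' c c'} h ha => sub_mem
      (hW (fun p => actDer_virL_one t hinv hsymm h ha) (actDer_virL_e t hinv hsymm h ha he))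
      (Subalgebra.smul_mem _ (sum_mem fun i _ =>
        mul_mem (hphi h _ (c i).2.1 (c i).2.2) (hphi h _ (c' i).2.1 (c' i).2.2)) _)
  -- Auxiliary dual bases serve only to prove surjectivity. The resulting isomorphism does not
  -- depend on them, so the formulas hold for arbitrary ones.
  obtain ⟨n, v, v', hv⟩ := exists_areDual_omega t hB hinv
  obtain ⟨m, a, a', ha⟩ := exists_areDual_form t hB hsymm hinv (add_zero (0 : ℤ))
  obtain ⟨l, c, c', hcc⟩ := hf.exists_areDual_centr t hB hsymm hinv
  obtain ⟨E, hE1, hE2, hE3⟩ := exists_equiv_of_surjective t hB hinv hd hs z (fun y => by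
    have hy := hc.le y.2
    refine exists_mem_W_of_le (sup_le inf_le_right hu)
      ((Submodule.span_singleton_le_iff_mem _ _).2 hff)
      (fun y hy => exists_mem_W_of_le inf_le_right hu (fun y hy => ?_) (fun y hy => ?_) y hy)
      (fun y hy => ?_) y hy
    · exact ⟨_, hphi hv _ hy.1 hy.2, piHom_phi t he hy.2⟩
    · exact ⟨_, hpsi hv _ hy, piHom_psi t he hy y.2⟩
    · obtain ⟨r, hr⟩ := Submodule.mem_span_singleton.1 hy
      refine ⟨r • _, Subalgebra.smul_mem _ (hL (c := c) (c' := c') hv ha) r, ?_⟩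
      rw [map_smul, piHom_virLTilde t hinv hsymm he (hf.halfGrade_neg_two t hB hinv) ha hcc hff,
        ← map_smul]
      exact congrArg _ (Subtype.ext hr))
  refine ⟨E, hE1, hE2, hc, fun n v v' hv => ⟨fun a ha0 ha => ?_, fun u hu' => ⟨hu hu', ?_⟩,
    fun m a a' ha l c c' hcc => ⟨hff, ?_⟩⟩⟩
  · exact hE3 _ _ (hphi hv a ha0 ha) (piHom_phi t he ha)
  · exact hE3 _ _ (hpsi hv u hu') (piHom_psi t he hu' _)
  · exact hE3 _ _ (hL hv ha)
      (piHom_virLTilde t hinv hsymm he (hf.halfGrade_neg_two t hB hinv) ha hcc hff)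

end Minimal

/-! ### The isomorphism for short nilpotent elements -/

section Short

variable {F : Type*} [Field F] [CharZero F] {g : Type*} [LieRing g] [LieAlgebra F g]
  {B : LinearMap.BilinForm F g} {x e f s : g}

theorem IsShortNilpotent.lie_e_eq_zero (hx : IsShortNilpotent F x)
    (t : IsSl2Triple ((2 : F) • x) e f) {a : g} (ha : a ∈ halfGrade (F := F) x 2) : ⁅e, a⁆ = 0 := by
  have := lie_mem_halfGrade_of_eq (k := 4) (e_mem t) ha (by norm_num)
  rw [hx.halfGrade_eq_bot (by norm_num) (by norm_num) (by norm_num)] at this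
  exact (Submodule.mem_bot F).1 this

/-- Reduces the brackets produced by the cubic sum of `ψ(u)` to `[e,[[f,a],u]]`. The inputs are
`[e,[f,a]] = 2a`, `[f,[e,u]] = 2u`, and the vanishing of `[u,[[f,a],f]]` in degree `-2`. -/
theorem IsShortNilpotent.lie_cubic_eq_zero (hx : IsShortNilpotent F x)
    (t : IsSl2Triple ((2 : F) • x) e f) {a u : g} (ha : a ∈ halfGrade (F := F) x 2)
    (hu : u ∈ halfGrade (F := F) x (-2)) :
    ⁅e, ⁅⁅e, u⁆, ⁅⁅f, a⁆, f⁆⁆⁆ = -(2 : F) • ⁅e, ⁅⁅f, a⁆, u⁆⁆ ∧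
      ⁅f, ⁅a, ⁅e, u⁆⁆⁆ = ⁅e, ⁅⁅f, a⁆, u⁆⁆ := by
  have hb : ⁅f, a⁆ ∈ halfGrade (F := F) x 0 :=
    lie_mem_halfGrade_of_eq (f_mem t) ha (by norm_num)
  have hw : ⁅⁅f, a⁆, f⁆ ∈ halfGrade (F := F) x (-2) :=
    lie_mem_halfGrade_of_eq hb (f_mem t) (by norm_num)
  have hxb : ⁅x, ⁅f, a⁆⁆ = 0 := by rw [mem_halfGrade.1 hb]; simp
  have heb : ⁅e, ⁅f, a⁆⁆ = (2 : F) • a := by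
    rw [leibniz_lie, t.lie_e_f, hx.lie_e_eq_zero t ha, lie_zero, add_zero, smul_lie,
      mem_halfGrade.1 ha]
    norm_num
  have hfu : ⁅f, ⁅e, u⁆⁆ = (2 : F) • u := by
    have hu0 : ⁅f, u⁆ = 0 := mem_centr.1 (hx.halfGrade_neg_two_le_centr t hu)
    rw [leibniz_lie, hu0, lie_zero, add_zero, ← lie_skew f e, t.lie_e_f, neg_lie, smul_lie,
      mem_halfGrade.1 hu]
    norm_num
  have huw : ⁅u, ⁅⁅f, a⁆, f⁆⁆ = 0 := by
    have := lie_mem_halfGrade_of_eq (k := -4) hu hw (by norm_num)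
    rw [hx.halfGrade_eq_bot (by norm_num) (by norm_num) (by norm_num)] at this
    exact (Submodule.mem_bot F).1 this
  have hew : ⁅e, ⁅⁅f, a⁆, f⁆⁆ = -(2 : F) • ⁅f, a⁆ := by
    rw [leibniz_lie, heb, t.lie_e_f, lie_smul, ← lie_skew _ x, hxb, neg_zero, smul_zero, add_zero,
      smul_lie, ← lie_skew a f, smul_neg, neg_smul]
  constructor
  · have h := leibniz_lie e u ⁅⁅f, a⁆, f⁆
    rw [huw, lie_zero, hew, lie_smul, ← lie_skew u ⁅f, a⁆] at h
    have h' : ⁅⁅e, u⁆, ⁅⁅f, a⁆, f⁆⁆ = -(2 : F) • ⁅⁅f, a⁆, u⁆ := by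
      rw [eq_neg_of_add_eq_zero_left h.symm]
      module
    rw [h', lie_smul]
  · rw [leibniz_lie f, hfu, leibniz_lie e, heb, lie_smul, smul_lie, add_comm]

variable [IsAlgClosed F] [FiniteDimensional F g] {n : ℕ}
  {w : Module.Basis (Fin n) F (halfGrade (F := F) x (-2))}
  {w' : Module.Basis (Fin n) F (halfGrade (F := F) x 2)}

/-- With `Y = [e,[[f,a],u]]`, the first sum contributes `[u,a] - ½Y` and the second `-⅛(-2Y - 2Y) =
½Y`. These cancel against `[a,u]`, and the `λ`-terms are `(a|u) - (a|u)`. -/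
theorem IsShortNilpotent.actDer_psiShort (hx : IsShortNilpotent F x)
    (t : IsSl2Triple ((2 : F) • x) e f) (hinv : B.lieInvariant g) (hsymm : B.IsSymm)
    (h : AreDual (fun p q => B p q) (fun k => (w k : g)) (fun k => (w' k : g))) {a u : g}
    (ha : a ∈ halfGrade (F := F) x 2) (hu : u ∈ halfGrade (F := F) x (-2)) :
    actDer B x f a (psiShort x e f (fun k => (w k : g)) (fun k => (w' k : g)) u) = 0 := by
  have hE := e_mem t
  have heu : ⁅e, u⁆ ∈ halfGrade (F := F) x 0 := lie_mem_halfGrade_of_eq hE hu (by norm_num)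
  have huw : ∀ k, ⁅u, (w' k : g)⁆ ∈ halfGrade (F := F) x 0 := fun k =>
    lie_mem_halfGrade_of_eq hu (w' k).2 (by norm_num)
  have hfw : ∀ k, ⁅f, (w' k : g)⁆ ∈ halfGrade (F := F) x 0 := fun k =>
    lie_mem_halfGrade_of_eq (f_mem t) (w' k).2 (by norm_num)
  have hew : ∀ k, ⁅e, (w k : g)⁆ ∈ halfGrade (F := F) x 0 := fun k =>
    lie_mem_halfGrade_of_eq hE (w k).2 (by norm_num)
  have heew : ∀ k, ⁅e, ⁅⁅e, u⁆, (w k : g)⁆⁆ ∈ halfGrade (F := F) x 0 := fun k =>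
    lie_mem_halfGrade_of_eq hE (lie_mem_halfGrade heu (w k).2) (by norm_num)
  have hB0 : ∀ {b : g}, b ∈ halfGrade (F := F) x 0 →
      HasAct B x f a (genLE x b) (algebraMap F _ (B f ⁅a, b⁆)) 0 := fun hb =>
    HasAct.genLE_two t hinv ha hb (by norm_num) (by norm_num)
  have H1 := HasAct.genLE_zero t hinv ha hu (by norm_num) (by norm_num)
  have H2 := fun k => (hB0 (huw k)).mul (hB0 (hew k))
  have H3 := fun k => (hB0 (hfw k)).mul (hB0 (heew k))
  have H4 := (hB0 heu).deriv
  have hP : psiShort x e f (fun k => (w k : g)) (fun k => (w' k : g)) u = genLE (F := F) x u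
      + (-(1 / 2) : F) • ∑ k, genLE (F := F) x ⁅u, (w' k : g)⁆ * genLE (F := F) x ⁅e, (w k : g)⁆
      + (-(1 / 8) : F) • ∑ k, genLE (F := F) x ⁅f, (w' k : g)⁆ *
        genLE (F := F) x ⁅e, ⁅⁅e, u⁆, (w k : g)⁆⁆
      + (1 / 2 : F) • deriv (genLE (F := F) x ⁅e, u⁆) := by
    rw [psiShort, neg_smul, neg_smul, ← sub_eq_add_neg, ← sub_eq_add_neg]
  rw [hP]
  have hae : ∀ y, B f ⁅a, ⁅e, y⁆⁆ = -2 * B a y := fun y => by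
    rw [form_f_lie_lie_e t hinv ha (hx.lie_e_eq_zero t ha)]; norm_num
  refine (((H1.add ((HasAct.sum Finset.univ H2).smul (-(1 / 2) : F))).add
    ((HasAct.sum Finset.univ H3).smul (-(1 / 8) : F))).add (H4.smul (1 / 2 : F))).actDer_eq_zero
      ?_ ?_
  · let G : g →ₗ[F] DiffPoly F (gradeLE (F := F) x 1) := genLE x
    have hba : ⁅f, a⁆ ∈ halfGrade (F := F) x 0 :=
      lie_mem_halfGrade_of_eq (f_mem t) ha (by norm_num)
    have h1 : ∑ k, B f ⁅a, ⁅e, (w k : g)⁆⁆ • G ⁅u, (w' k : g)⁆ = -(2 : F) • G ⁅u, a⁆ := by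
      have := AreDual.sum_right (β := B) h (G ∘ₗ (LieAlgebra.ad F g u : g →ₗ[F] g)) ha
      simp only [LinearMap.comp_apply, LieAlgebra.ad_apply] at this
      rw [← this, Finset.smul_sum]
      refine Finset.sum_congr rfl fun k _ => ?_
      rw [hae, mul_smul, hsymm.eq]
    have h2 : ∑ k, B f ⁅a, ⁅u, (w' k : g)⁆⁆ • G ⁅e, (w k : g)⁆ = G ⁅e, ⁅⁅f, a⁆, u⁆⁆ := by
      have := AreDual.sum_left (β := B) h (G ∘ₗ (LieAlgebra.ad F g e : g →ₗ[F] g))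
        (lie_mem_halfGrade_of_eq hba hu (by norm_num))
      simp only [LinearMap.comp_apply, LieAlgebra.ad_apply] at this
      rw [← this]
      simp only [form_lie_left hinv]
    have h3 : ∑ k, B f ⁅a, ⁅e, ⁅⁅e, u⁆, (w k : g)⁆⁆⁆ • G ⁅f, (w' k : g)⁆ =
        -(2 : F) • G ⁅f, ⁅a, ⁅e, u⁆⁆⁆ := by
      have := AreDual.sum_right (β := B) h (G ∘ₗ (LieAlgebra.ad F g f : g →ₗ[F] g))
        (lie_mem_halfGrade_of_eq ha heu (by norm_num))
      simp only [LinearMap.comp_apply, LieAlgebra.ad_apply] at this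
      rw [← this, Finset.smul_sum]
      refine Finset.sum_congr rfl fun k _ => ?_
      rw [hae, mul_smul, hsymm.eq (w k : g), form_lie_left hinv]
    have h4 : ∑ k, B f ⁅a, ⁅f, (w' k : g)⁆⁆ • G ⁅e, ⁅⁅e, u⁆, (w k : g)⁆⁆ =
        G ⁅e, ⁅⁅e, u⁆, ⁅⁅f, a⁆, f⁆⁆⁆ := by
      have := AreDual.sum_left (β := B) h (G ∘ₗ (LieAlgebra.ad F g e : g →ₗ[F] g) ∘ₗ
        (LieAlgebra.ad F g ⁅e, u⁆ : g →ₗ[F] g))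
        (lie_mem_halfGrade_of_eq hba (f_mem t) (by norm_num))
      simp only [LinearMap.comp_apply, LieAlgebra.ad_apply] at this
      rw [← this]
      simp only [form_lie_left hinv]
    obtain ⟨h5, h6⟩ := hx.lie_cubic_eq_zero t ha hu
    simp only [Derivation.map_algebraMap, smul_zero, add_zero, algebraMap_mul_eq_smul,
      Finset.sum_add_distrib]
    change G ⁅a, u⁆ + (-(1 / 2) : F) • (∑ k, B f ⁅a, ⁅e, (w k : g)⁆⁆ • G ⁅u, (w' k : g)⁆ +
      ∑ k, B f ⁅a, ⁅u, (w' k : g)⁆⁆ • G ⁅e, (w k : g)⁆) + (-(1 / 8) : F) •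
      (∑ k, B f ⁅a, ⁅e, ⁅⁅e, u⁆, (w k : g)⁆⁆⁆ • G ⁅f, (w' k : g)⁆ +
      ∑ k, B f ⁅a, ⁅f, (w' k : g)⁆⁆ • G ⁅e, ⁅⁅e, u⁆, (w k : g)⁆⁆) = 0
    rw [h1, h2, h3, h4, h5, h6, map_smul, ← lie_skew a u, map_neg]
    module
  · have h1 : B a u = -(1 / 2) * B f ⁅a, ⁅e, u⁆⁆ := by rw [hae]; ring
    simp only [mul_zero, add_zero, Finset.sum_const_zero, Algebra.smul_def, ← map_mul,
      ← map_add, h1]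
    rw [← map_zero (algebraMap F (DiffPoly F (gradeLE (F := F) x 1)))]
    congr 1
    ring

/-- Every correction term has a factor in `[e, g_{-1}]` or is a derivative of such an element, hence
is killed by `π`. -/
theorem piHom_psiShort (t : IsSl2Triple ((2 : F) • x) e f) {u : g}
    (hu : u ∈ halfGrade (F := F) x (-2)) (huf : u ∈ centr (F := F) f) :
    piHom x e f (psiShort x e f (fun k => (w k : g)) (fun k => (w' k : g)) u) =
      gen 0 (⟨u, huf⟩ : centr (F := F) f) := by
  have heu : ⁅e, u⁆ ∈ halfGrade (F := F) x 0 :=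
    lie_mem_halfGrade_of_eq (e_mem t) hu (by norm_num)
  have h1 := fun k => piHom_genLE_lie_e t (w k).2 (by norm_num)
  have h2 := fun k => piHom_genLE_lie_e t (lie_mem_halfGrade heu (w k).2) (by norm_num)
  rw [psiShort, map_add, map_sub, map_sub]
  simp only [map_smul, map_sum, map_mul, h1, h2, mul_zero, Finset.sum_const_zero, smul_zero,
    sub_zero, piHom_deriv, piHom_genLE_lie_e t hu (by norm_num), map_zero, add_zero,
    piHom_genLE_of_mem_centr t huf]

theorem IsShortNilpotent.mem_W (hx : IsShortNilpotent F x)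
    (t : IsSl2Triple ((2 : F) • x) e f) (hB : B.Nondegenerate) (hinv : B.lieInvariant g) {d : ℤ}
    (hd : IsGreatest {i : ℤ | halfGrade (F := F) x i ≠ ⊥} d) (hs : s ∈ halfGrade (F := F) x d)
    (z : F) {P : DiffPoly F (gradeLE (F := F) x 1)}
    (h : ∀ p ∈ halfGrade (F := F) x 2, actDer B x f p P = 0) : P ∈ W B x f s z := by
  rw [mem_W_iff t hB hinv hd hs]
  exact fun a ha => h a (hx.gradeGE_one_le ha)

theorem IsShortNilpotent.exists_equiv (hx : IsShortNilpotent F x)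
    (t : IsSl2Triple ((2 : F) • x) e f) (hB : B.Nondegenerate) (hsymm : B.IsSymm)
    (hinv : B.lieInvariant g) {d : ℤ} (hd : IsGreatest {i : ℤ | halfGrade (F := F) x i ≠ ⊥} d)
    (hs : s ∈ halfGrade (F := F) x d) (z : F) :
    ∃ E : W B x f s z ≃ₐ[F] DiffPoly F (centr (F := F) f),
        (∀ P, E P = piHom x e f P) ∧
        (∀ P, E (derivW B x f s z P) = deriv (E P)) ∧
        centr (F := F) f = (halfGrade x 0 ⊓ centr f) ⊔ halfGrade x (-2) ∧
        (∀ a ∈ halfGrade (F := F) x 0, ∀ ha : a ∈ centr (F := F) f,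
          (E.symm (gen 0 ⟨a, ha⟩) : DiffPoly F (gradeLE (F := F) x 1)) = genLE x a) ∧
        ∀ (n : ℕ) (w : Module.Basis (Fin n) F (halfGrade (F := F) x (-2)))
          (w' : Module.Basis (Fin n) F (halfGrade (F := F) x 2)),
          AreDual (fun p q => B p q) (fun k => (w k : g)) (fun k => (w' k : g)) →
          ∀ u ∈ halfGrade (F := F) x (-2), ∃ hu : u ∈ centr (F := F) f,
            (E.symm (gen 0 ⟨u, hu⟩) : DiffPoly F (gradeLE (F := F) x 1)) =
              psiShort x e f (fun k => (w k : g)) (fun k => (w' k : g)) u := by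
  have hc := hx.centr_eq t
  have hu := hx.halfGrade_neg_two_le_centr t
  have hgen : ∀ a ∈ halfGrade (F := F) x 0, a ∈ centr (F := F) f → genLE x a ∈ W B x f s z := by
    refine fun a ha0 ha => hx.mem_W t hB hinv hd hs z fun p hp =>
      (HasAct.genLE_two t hinv hp ha0 (by norm_num) (by norm_num)).actDer_eq_zero ?_ rfl
    rw [form_f_lie_skew, form_f_lie_of_centr hinv ha, neg_zero, map_zero]
  have hpsi : ∀ {n : ℕ} {w : Module.Basis (Fin n) F (halfGrade (F := F) x (-2))}
      {w' : Module.Basis (Fin n) F (halfGrade (F := F) x 2)},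
      AreDual (fun p q => B p q) (fun k => (w k : g)) (fun k => (w' k : g)) →
      ∀ u ∈ halfGrade (F := F) x (-2),
        psiShort x e f (fun k => (w k : g)) (fun k => (w' k : g)) u ∈ W B x f s z :=
    fun h u hu => hx.mem_W t hB hinv hd hs z fun p hp => hx.actDer_psiShort t hinv hsymm h hp hu
  obtain ⟨n, w, w', hw⟩ := exists_areDual_form t hB hsymm hinv (neg_add_cancel (2 : ℤ))
  obtain ⟨E, hE1, hE2, hE3⟩ := exists_equiv_of_surjective t hB hinv hd hs z (fun y =>
    exists_mem_W_of_le inf_le_right hu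
      (fun y hy => ⟨_, hgen _ hy.1 hy.2, piHom_genLE_of_mem_centr t y.2⟩)
      (fun y hy => ⟨_, hpsi hw _ hy, piHom_psiShort t hy y.2⟩) y (hc.le y.2))
  exact ⟨E, hE1, hE2, hc,
    fun a ha0 ha => hE3 _ _ (hgen a ha0 ha) (piHom_genLE_of_mem_centr t ha),
    fun n w w' hw u hu' => ⟨hu hu', hE3 _ _ (hpsi hw u hu') (piHom_psiShort t hu' _)⟩⟩

end Short

end ClassicalW

end

open ClassicalW in
theorem corollary4p2 {F : Type*} [Field F] [IsAlgClosed F] [CharZero F]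
    {g : Type*} [LieRing g] [LieAlgebra F g] [FiniteDimensional F g] [LieAlgebra.IsSimple F g]
    (B : LinearMap.BilinForm F g) (hB : B.Nondegenerate) (hsymm : B.IsSymm)
    (hinv : B.lieInvariant g)
    (x e f : g) (htriple : IsSl2Triple ((2 : F) • x) e f)
    (d : ℤ) (hd : IsGreatest {i : ℤ | halfGrade (F := F) x i ≠ ⊥} d)
    (s : g) (hs : s ∈ halfGrade (F := F) x d) (z : F) :
    -- the decompositions defining the projections `π_{≤1/2}` and `π`
    IsCompl (gradeLE (F := F) x 1) (gradeGE x 2) ∧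
    Disjoint (centr (F := F) f) (lieE x e) ∧ centr (F := F) f ⊔ lieE x e = gradeLE x 1 ∧
    -- minimal nilpotent elements
    (IsMinimalNilpotent F f →
      ∃ E : W B x f s z ≃ₐ[F] DiffPoly F (centr (F := F) f),
        (∀ P, E P = piHom x e f P) ∧
        (∀ P, E (derivW B x f s z P) = deriv (E P)) ∧
        centr (F := F) f = (halfGrade x 0 ⊓ centr f) ⊔ halfGrade x (-1) ⊔ Submodule.span F {f} ∧
        ∀ (n : ℕ) (v v' : Module.Basis (Fin n) F (halfGrade (F := F) x 1)),
          AreDual (fun p q => B f ⁅p, q⁆) (fun k => (v k : g)) (fun k => (v' k : g)) →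
          (∀ a ∈ halfGrade (F := F) x 0, ∀ ha : a ∈ centr (F := F) f,
            (E.symm (gen 0 ⟨a, ha⟩) : DiffPoly F (gradeLE (F := F) x 1)) =
              phi x (fun k => (v k : g)) (fun k => (v' k : g)) a) ∧
          (∀ u ∈ halfGrade (F := F) x (-1), ∃ hu : u ∈ centr (F := F) f,
            (E.symm (gen 0 ⟨u, hu⟩) : DiffPoly F (gradeLE (F := F) x 1)) =
              psi x e (fun k => (v k : g)) (fun k => (v' k : g)) u) ∧
          ∀ (m : ℕ) (a a' : Module.Basis (Fin m) F (halfGrade (F := F) x 0)),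
            AreDual (fun p q => B p q) (fun k => (a k : g)) (fun k => (a' k : g)) →
          ∀ (l : ℕ) (c c' : Module.Basis (Fin l) F (halfGrade x 0 ⊓ centr f : Submodule F g)),
            AreDual (fun p q => B p q) (fun k => (c k : g)) (fun k => (c' k : g)) →
            ∃ hf : f ∈ centr (F := F) f,
              (E.symm (gen 0 ⟨f, hf⟩) : DiffPoly F (gradeLE (F := F) x 1)) =
                virLTilde x f (fun k => (v k : g)) (fun k => (v' k : g))
                  (fun k => (a k : g)) (fun k => (a' k : g))
                  (fun k => (c k : g)) (fun k => (c' k : g))) ∧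
    -- short nilpotent elements
    (IsShortNilpotent F x →
      ∃ E : W B x f s z ≃ₐ[F] DiffPoly F (centr (F := F) f),
        (∀ P, E P = piHom x e f P) ∧
        (∀ P, E (derivW B x f s z P) = deriv (E P)) ∧
        centr (F := F) f = (halfGrade x 0 ⊓ centr f) ⊔ halfGrade x (-2) ∧
        (∀ a ∈ halfGrade (F := F) x 0, ∀ ha : a ∈ centr (F := F) f,
          (E.symm (gen 0 ⟨a, ha⟩) : DiffPoly F (gradeLE (F := F) x 1)) = genLE x a) ∧
        ∀ (n : ℕ) (w : Module.Basis (Fin n) F (halfGrade (F := F) x (-2)))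
          (w' : Module.Basis (Fin n) F (halfGrade (F := F) x 2)),
          AreDual (fun p q => B p q) (fun k => (w k : g)) (fun k => (w' k : g)) →
          ∀ u ∈ halfGrade (F := F) x (-2), ∃ hu : u ∈ centr (F := F) f,
            (E.symm (gen 0 ⟨u, hu⟩) : DiffPoly F (gradeLE (F := F) x 1)) =
              psiShort x e f (fun k => (w k : g)) (fun k => (w' k : g)) u) := by
  refine ⟨isCompl_gradeLE_one htriple, disjoint_centr_lieE htriple, centr_sup_lieE htriple,
    fun hf => hf.exists_equiv htriple hB hsymm hinv hd hs z,
    fun hx => hx.exists_equiv htriple hB hsymm hinv hd hs z⟩
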